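/- Let $d\ge 1$, let $2\le q_0<\infty$, and let $\mathcal B$ be a Banach space of martingale cotype $q_0$: there is a constant $C$ such that for every probability space $\Omega$, every increasing sequence $(\mathcal E_n)_{n\ge 0}$ of conditional expectations on $\Omega$ and every $f\in L^{q_0}(\Omega;\mathcal B)$, $$\mathbb E\|\mathcal E_0f\|^{q_0}+\sum_{n\ge 1}\mathbb E\|\mathcal E_nf-\mathcal E_{n-1}f\|^{q_0}\le C\,\mathbb E\|f\|^{q_0}.$$ For a locally integrable $f:\mathbb R^d\to\mathcal B$ and $t>0$ put $A_tf(x)=\frac1{|B_t|}\int_{B_t}f(x+y)\,dy$, where $B_t$ is the open Euclidean ball of radius $t$ centred at $0$, and define the short variation $$\mathcal{SV}_{q_0}f(x)=\sup_{(t_i)}\Big(\sum_{k\in\mathbb Z}\ \sum_{i:\,(t_i,t_{i+1}]\subset(2^k,2^{k+1}]}\|A_{t_{i+1}}f(x)-A_{t_i}f(x)\|^{q_0}\Big)^{1/q_0}\in[0,\infty],$$ where the supremum runs over all increasing sequences $(t_i)_{i\ge 0}$ of positive real numbers. This is a measurable function of $x$, and the following hold, with constants independent of $f$ and $\lambda$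 (they may depend on $d$, $\mathcal B$, $q_0$, and in (i) on $p$). (i) For every $1<p<\infty$ there is a constant $C$ with $$\|\mathcal{SV}_{q_0}f\|_{L^p(\mathbb R^d)}\le C\,\|f\|_{L^p(\mathbb R^d;\mathcal B)}\qquad\text{for all } f\in L^p(\mathbb R^d;\mathcal B).$$ (ii) There is a constant $C$ such that for all $f\in L^1(\mathbb R^d;\mathcal B)$ and all $\lambda>0$, $$\big|\{x:\mathcal{SV}_{q_0}f(x)>\lambda\}\big|\le\frac C\lambda\,\|f\|_{L^1(\mathbb R^d;\mathcal B)}.$$ (iii) There is a constant $C$ such that for every $f\in L^\infty(\mathbb R^d;\mathcal B)$ which has compact support or, more generally, for which $\mathcal{SV}_{q_0}f$ is not almost everywhere equal to $\infty$, the function $\mathcal{SV}_{q_0}f$ is finite almost everywhere and locally integrable, and $$\|\mathcal{SV}_{q_0}f\|_{BMO}:=\sup_Q\frac1{|Q|}\int_Q\Big|\mathcal{SV}_{q_0}f-\frac1{|Q|}\int_Q\mathcal{SV}_{q_0}f\Big|\le C\,\|f\|_{L^\infty(\mathbb R^d;\mathcal B)},$$ where $Q$ runs over all cubes in $\mathbb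 R^d$ with sides parallel to the axes. -/

import Mathlib

open MeasureTheory
open scoped ENNReal NNReal

/-- A real Banach space `B` has martingale cotype `q` if there is a constant `C` such that for
every probability space, every increasing sequence `ℱ 0 ≤ ℱ 1 ≤ …` of sub-σ-algebras and every
`f ∈ L^q(Ω; B)`,
`E ‖E_0 f‖^q + ∑_{n ≥ 1} E ‖E_n f - E_{n-1} f‖^q ≤ C E ‖f‖^q`, with `E_n = E[· | ℱ n]`. -/
def MartingaleCotype (q : ℝ) (B : Type*) [NormedAddCommGroup B] [NormedSpace ℝ B]
    [CompleteSpace B] : Prop :=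
  ∃ C : ℝ≥0, ∀ (Ω : Type) [mΩ : MeasurableSpace Ω] (μ : Measure Ω) [IsProbabilityMeasure μ]
    (ℱ : Filtration ℕ mΩ) (f : Ω → B), MemLp f (ENNReal.ofReal q) μ →
      ∫⁻ ω, ‖(μ[f | ℱ 0]) ω‖ₑ ^ q ∂μ
        + ∑' n : ℕ, ∫⁻ ω, ‖(μ[f | ℱ (n + 1)]) ω - (μ[f | ℱ n]) ω‖ₑ ^ q ∂μ
      ≤ C * ∫⁻ ω, ‖f ω‖ₑ ^ q ∂μ

section

variable {d : ℕ} {B : Type*} [NormedAddCommGroup B] [NormedSpace ℝ B]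

/-- `A_t f(x)`, the mean of `f` over the open Euclidean ball of radius `t` centred at `x`. -/
noncomputable def ballAverage (f : EuclideanSpace ℝ (Fin d) → B) (t : ℝ)
    (x : EuclideanSpace ℝ (Fin d)) : B :=
  ⨍ y in Metric.ball (0 : EuclideanSpace ℝ (Fin d)) t, f (x + y) ∂volume

/-- The short variation: the supremum over all increasing sequences `(t_i)` of positive reals of
`(∑_k ∑_{i : (t_i, t_{i+1}] ⊆ (2^k, 2^{k+1}]} ‖A_{t_{i+1}} f(x) - A_{t_i} f(x)‖^q)^{1/q}`.
Cutting the intervals `(t_i, t_{i+1}]` that contain powers of `2` at those powers amounts to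
inserting these powers into the sequence, so it does not change the supremum. -/
noncomputable def shortVariation (q : ℝ) (f : EuclideanSpace ℝ (Fin d) → B)
    (x : EuclideanSpace ℝ (Fin d)) : ℝ≥0∞ :=
  ⨆ (t : ℕ → ℝ) (_ : StrictMono t) (_ : ∀ i, 0 < t i),
    (∑' k : ℤ, ∑' i : {i : ℕ // Set.Ioc (t i) (t (i + 1)) ⊆
          Set.Ioc ((2 : ℝ) ^ k) ((2 : ℝ) ^ (k + 1))},
        ‖ballAverage f (t (i.1 + 1)) x - ballAverage f (t i.1) x‖ₑ ^ q) ^ (1 / q)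

/-- The closed cube with sides parallel to the axes, centre `c` and side length `2 r`. -/
def cube (c : EuclideanSpace ℝ (Fin d)) (r : ℝ) : Set (EuclideanSpace ℝ (Fin d)) :=
  {x | ∀ i, |x i - c i| ≤ r}

/-- The `BMO` seminorm `sup_Q |Q|⁻¹ ∫_Q |g - g_Q|`, the supremum over all cubes `Q`
(to be used for locally integrable `g`). -/
noncomputable def bmoSeminorm (g : EuclideanSpace ℝ (Fin d) → ℝ) : ℝ≥0∞ :=
  ⨆ (c : EuclideanSpace ℝ (Fin d)) (r : ℝ) (_ : 0 < r),
    ⨍⁻ x in cube c r, ‖g x - ⨍ y in cube c r, g y ∂volume‖ₑ ∂volume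

end

/-! Write q = q₀, let E_j be averaging over the dyadic cubes of side 2^j, and let V_k f(x) be the
q-variation of t ↦ A_t f(x) over 2^k ≤ t ≤ 2^(k+1). The q-th power of the short variation is at most
Σ_k (V_k f)^q, so the scales can be treated one at a time.

The exponent q. Expand f in the differences D_j = E_j f - E_{j+1} f. The operators V_k are almost
orthogonal to them: ∫ (V_k D_j)^q ≲ 2^(-|j-k|) ∫ ‖D_j‖^q. For j < k the function D_j has mean zero
on cubes much smaller than the balls, so only cubes meeting the boundary of a ball contribute, and
these fill a thin annulus (`exists_lintegral_scaleSup_le_of_mean_zero`). For j ≥ k it is constant on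
large cubes, so V_k D_j vanishes except near their boundaries
(`exists_lintegral_scaleSup_le_of_const`). Hölder's inequality with geometric weights sums the
pieces, and martingale cotype on the dyadic filtration bounds Σ_j ∫ ‖D_j‖^q by ∫ ‖f‖^q
(`exists_tsum_lintegral_dyadicAvg_sub_le`).

Weak type (1, 1). In a Calderón–Zygmund decomposition at height c the good part is bounded by a
multiple of c and is handled in L^q. Let b_l be the bad part on stopping cubes of side 2^l. Off a
neighbourhood of these cubes, V_k b_l vanishes for k ≤ l; for k > l the mean-zero estimate still
decays, with c^(q-1) ∫ ‖b_l‖ in place of ∫ ‖b_l‖^q (`exists_lintegral_compl_stopNbhd_le`).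

Oscillation and BMO. On a ball of radius R, split f into a part near the ball, handled in L^q, and a
far part. The averages of the far part at two points of the ball differ by integrals over annuli of
width about R, which gives a gain of a power of R / 2^k at scale 2^k, summable over 2^k ≳ R
(`exists_shortVariation_oscillation_le`). The size of f enters only through its L^q means over
concentric larger balls, and for bounded f this is the BMO estimate.

The other exponents. For 1 < p < q, Marcinkiewicz interpolation between weak type (1, 1) and strong
type (q, q). For p > q, the same oscillation lemma yields a good-λ inequality
(`exists_volume_stopUnion_le`) comparing the dyadic maximal function of the short variation with the
large values of f. Summing it over geometric levels and absorbing proves the bound for f in L^q as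
well; truncation and Fatou's lemma remove that restriction. -/

section

open Set Filter Topology

set_option linter.unusedSectionVars false

/-! ### Dyadic cubes -/

section Dyadic

variable {d : ℕ} {B : Type*} [NormedAddCommGroup B] [NormedSpace ℝ B]

/-- The index of the half-open dyadic cube of side length `2 ^ k` containing `x`. -/
noncomputable def dyadicIndex (k : ℤ) (x : EuclideanSpace ℝ (Fin d)) : Fin d → ℤ :=
  fun i => ⌊x i / 2 ^ k⌋

lemma measurable_dyadicIndex (k : ℤ) : Measurable (dyadicIndex (d := d) k) := by
  refine measurable_pi_lambda _ fun i => ?_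
  have : Measurable fun x : EuclideanSpace ℝ (Fin d) => x i / (2 : ℝ) ^ k := by fun_prop
  exact this.floor

lemma measurableSet_dyadicIndex (k : ℤ) (A : Set (Fin d → ℤ)) :
    MeasurableSet (dyadicIndex k ⁻¹' A) :=
  measurable_dyadicIndex k (Set.to_countable A).measurableSet

/-- This gives the nestedness of the dyadic grid: for an integer n, n ≤ c / N means n * N ≤ c, which
is a condition on ⌊c⌋ only. -/
lemma Int.floor_div_natCast_congr {a b : ℝ} (h : ⌊a⌋ = ⌊b⌋) {N : ℕ} (hN : 0 < N) :
    ⌊a / N⌋ = ⌊b / N⌋ := by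
  have hN' : (0 : ℝ) < N := by exact_mod_cast hN
  have key : ∀ (c : ℝ) (n : ℤ), n ≤ ⌊c / N⌋ ↔ n * N ≤ ⌊c⌋ := by
    intro c n
    rw [Int.le_floor, Int.le_floor, le_div_iff₀ hN']
    push_cast
    rfl
  apply le_antisymm
  · rw [key, ← h, ← key]
  · rw [key, h, ← key]

lemma dyadicIndex_eq_of_le {j k : ℤ} (hjk : j ≤ k) {x y : EuclideanSpace ℝ (Fin d)}
    (h : dyadicIndex j x = dyadicIndex j y) : dyadicIndex k x = dyadicIndex k y := by
  obtain ⟨n, rfl⟩ := Int.le.dest hjk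
  funext i
  have hi := congrFun h i
  simp only [dyadicIndex] at hi ⊢
  have := Int.floor_div_natCast_congr hi (N := 2 ^ n) (by positivity)
  rw [zpow_add₀ two_ne_zero, ← div_div, ← div_div]
  simpa using this

lemma dyadicIndex_add_zsmul (k : ℤ) (x y : EuclideanSpace ℝ (Fin d)) (m : Fin d → ℤ)
    (h : ∀ i, y i = x i + 2 ^ k * m i) : dyadicIndex k y = dyadicIndex k x + m := by
  funext i
  simp only [dyadicIndex, Pi.add_apply, h i]
  rw [add_div, mul_div_cancel_left₀ _ (by positivity), Int.floor_add_intCast]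

lemma EuclideanSpace.abs_coord_sub_le_dist (x y : EuclideanSpace ℝ (Fin d)) (i : Fin d) :
    |x i - y i| ≤ dist x y := by
  rw [dist_eq_norm]
  simpa using PiLp.norm_apply_le (x - y) i

lemma EuclideanSpace.dist_le_card_mul {x y : EuclideanSpace ℝ (Fin d)} {r : ℝ} (hr : 0 ≤ r)
    (h : ∀ i, |x i - y i| ≤ r) : dist x y ≤ d * r := by
  rw [EuclideanSpace.dist_eq]
  apply Real.sqrt_le_iff.2 ⟨by positivity, ?_⟩
  calc ∑ i, dist (x i) (y i) ^ 2 ≤ ∑ i : Fin d, r ^ 2 := by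
        gcongr with i
        rw [Real.dist_eq]; exact h i
    _ = d * r ^ 2 := by simp
    _ ≤ (d * r) ^ 2 := by
        rw [mul_pow]
        gcongr
        rcases Nat.eq_zero_or_pos d with h0 | h0
        · simp [h0]
        · have : (1 : ℝ) ≤ d := by exact_mod_cast h0
          nlinarith

lemma dist_le_of_dyadicIndex_eq {k : ℤ} {x y : EuclideanSpace ℝ (Fin d)}
    (h : dyadicIndex k x = dyadicIndex k y) : dist x y ≤ d * 2 ^ k := by
  refine EuclideanSpace.dist_le_card_mul (by positivity) fun i => ?_
  have h1 := Int.abs_sub_lt_one_of_floor_eq_floor (congrFun h i)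
  have h2 : (0 : ℝ) < 2 ^ k := by positivity
  rw [← sub_div, abs_div, abs_of_pos h2, div_lt_one h2] at h1
  exact h1.le

/-- The volume of a dyadic cube of side length `2 ^ k`. -/
noncomputable def dyadicVol (d : ℕ) (k : ℤ) : ℝ≥0∞ := ENNReal.ofReal (((2 : ℝ) ^ k) ^ d)

lemma dyadicVol_ne_zero (k : ℤ) : dyadicVol d k ≠ 0 := by
  rw [dyadicVol, Ne, ENNReal.ofReal_eq_zero, not_le]; positivity

lemma dyadicVol_ne_top (k : ℤ) : dyadicVol d k ≠ ∞ := ENNReal.ofReal_ne_top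

lemma dyadicVol_add_natCast (k : ℤ) (n : ℕ) :
    dyadicVol d (k + n) = (2 ^ n) ^ d * dyadicVol d k := by
  rw [dyadicVol, dyadicVol, zpow_add₀ two_ne_zero, mul_comm, mul_pow,
    ENNReal.ofReal_mul (by positivity), zpow_natCast, ENNReal.ofReal_pow (by positivity),
    ENNReal.ofReal_pow (by positivity)]
  simp

lemma dyadicVol_succ (k : ℤ) : dyadicVol d (k + 1) = 2 ^ d * dyadicVol d k := by
  have := dyadicVol_add_natCast (d := d) k 1
  simpa using this

/-- Volumes of coordinate boxes in Euclidean space. -/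
lemma EuclideanSpace.volume_setOf_forall_mem (s : Fin d → Set ℝ) (hs : ∀ i, MeasurableSet (s i)) :
    volume {x : EuclideanSpace ℝ (Fin d) | ∀ i, x i ∈ s i} = ∏ i, volume (s i) := by
  have h := (PiLp.volume_preserving_ofLp (Fin d)).measure_preimage
    (s := Set.univ.pi s) (MeasurableSet.univ_pi hs).nullMeasurableSet
  rw [volume_pi_pi] at h
  rw [← h]
  congr 1
  ext x
  simp

lemma dyadicIndex_eq_iff (k : ℤ) (n : Fin d → ℤ) (x : EuclideanSpace ℝ (Fin d)) :
    dyadicIndex k x = n ↔ ∀ i, x i ∈ Ico (n i * (2 : ℝ) ^ k) ((n i + 1) * 2 ^ k) := by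
  rw [funext_iff]
  refine forall_congr' fun i => ?_
  have h2 : (0 : ℝ) < 2 ^ k := by positivity
  rw [dyadicIndex, Int.floor_eq_iff, mem_Ico, le_div_iff₀ h2, div_lt_iff₀ h2]

lemma volume_dyadicCube (k : ℤ) (n : Fin d → ℤ) :
    volume (dyadicIndex k ⁻¹' {n}) = dyadicVol d k := by
  have : dyadicIndex k ⁻¹' {n} = {x : EuclideanSpace ℝ (Fin d) |
      ∀ i, x i ∈ Ico (n i * (2 : ℝ) ^ k) ((n i + 1) * 2 ^ k)} := by
    ext x
    simp [dyadicIndex_eq_iff]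
  rw [this, EuclideanSpace.volume_setOf_forall_mem _ fun i => measurableSet_Ico]
  simp only [Real.volume_Ico, dyadicVol]
  rw [ENNReal.ofReal_pow (by positivity)]
  simp [add_mul]

lemma isBounded_dyadicCube (k : ℤ) (n : Fin d → ℤ) :
    Bornology.IsBounded (dyadicIndex (d := d) k ⁻¹' {n}) := by
  rw [Metric.isBounded_iff]
  refine ⟨d * 2 ^ k, fun x hx y hy => dist_le_of_dyadicIndex_eq (k := k) ?_⟩
  rw [mem_preimage, mem_singleton_iff] at hx hy
  rw [hx, hy]

/-! ### Integration over unions of dyadic cubes -/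

lemma dyadicIndex_preimage_eq_iUnion (k : ℤ) (A : Set (Fin d → ℤ)) :
    dyadicIndex (d := d) k ⁻¹' A = ⋃ n : A, dyadicIndex k ⁻¹' {n.1} := by
  ext x; simp

lemma pairwise_disjoint_dyadicCube (k : ℤ) (A : Set (Fin d → ℤ)) :
    Pairwise (Function.onFun Disjoint fun n : A => dyadicIndex (d := d) k ⁻¹' {n.1}) := by
  intro n m hnm
  refine Disjoint.preimage _ ?_
  rw [disjoint_singleton]
  exact fun h => hnm (Subtype.ext h)

lemma lintegral_dyadicIndex_preimage (k : ℤ) (A : Set (Fin d → ℤ))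
    (h : EuclideanSpace ℝ (Fin d) → ℝ≥0∞) :
    ∫⁻ x in dyadicIndex k ⁻¹' A, h x = ∑' n : A, ∫⁻ x in dyadicIndex k ⁻¹' {n.1}, h x := by
  rw [dyadicIndex_preimage_eq_iUnion, lintegral_iUnion
    (fun n => measurableSet_dyadicIndex k _) (pairwise_disjoint_dyadicCube k A)]

lemma lintegral_eq_tsum_dyadicCube (k : ℤ) (h : EuclideanSpace ℝ (Fin d) → ℝ≥0∞) :
    ∫⁻ x, h x = ∑' n : Fin d → ℤ, ∫⁻ x in dyadicIndex k ⁻¹' {n}, h x := by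
  rw [← setLIntegral_univ, ← preimage_univ (f := dyadicIndex (d := d) k),
    lintegral_dyadicIndex_preimage]
  exact tsum_univ fun n => ∫⁻ x in dyadicIndex k ⁻¹' {n}, h x

lemma volume_eq_tsum_dyadicCube (k : ℤ) (S : Set (EuclideanSpace ℝ (Fin d)))
    (hS : MeasurableSet S) :
    volume S = ∑' n : Fin d → ℤ, volume (S ∩ dyadicIndex k ⁻¹' {n}) := by
  rw [← lintegral_indicator_one hS, lintegral_eq_tsum_dyadicCube k]
  congr 1 with n
  rw [lintegral_indicator_one hS, Measure.restrict_apply hS]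

lemma setIntegral_dyadicIndex_preimage_eq_zero {k : ℤ} {A : Set (Fin d → ℤ)}
    {g : EuclideanSpace ℝ (Fin d) → B} (hg : IntegrableOn g (dyadicIndex k ⁻¹' A))
    (h0 : ∀ n, ∫ x in dyadicIndex k ⁻¹' {n}, g x = 0) :
    ∫ x in dyadicIndex k ⁻¹' A, g x = 0 := by
  rw [dyadicIndex_preimage_eq_iUnion] at hg ⊢
  rw [integral_iUnion (fun n => measurableSet_dyadicIndex k _) (pairwise_disjoint_dyadicCube k A)
    hg]
  simp [h0]

/-! ### Dyadic averages -/

/-- The mean of `f` over the dyadic cube of side length `2 ^ k` containing `x`. -/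
noncomputable def dyadicAvg (f : EuclideanSpace ℝ (Fin d) → B) (k : ℤ)
    (x : EuclideanSpace ℝ (Fin d)) : B :=
  (dyadicVol d k).toReal⁻¹ • ∫ y in dyadicIndex k ⁻¹' {dyadicIndex k x}, f y

/-- The mean of `h ≥ 0` over the dyadic cube of side length `2 ^ k` containing `x`. -/
noncomputable def dyadicLAvg (h : EuclideanSpace ℝ (Fin d) → ℝ≥0∞) (k : ℤ)
    (x : EuclideanSpace ℝ (Fin d)) : ℝ≥0∞ :=
  (dyadicVol d k)⁻¹ * ∫⁻ y in dyadicIndex k ⁻¹' {dyadicIndex k x}, h y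

lemma dyadicAvg_congr (f : EuclideanSpace ℝ (Fin d) → B) {k : ℤ}
    {x y : EuclideanSpace ℝ (Fin d)} (h : dyadicIndex k x = dyadicIndex k y) :
    dyadicAvg f k x = dyadicAvg f k y := by rw [dyadicAvg, h, dyadicAvg]

lemma dyadicLAvg_congr (f : EuclideanSpace ℝ (Fin d) → ℝ≥0∞) {k : ℤ}
    {x y : EuclideanSpace ℝ (Fin d)} (h : dyadicIndex k x = dyadicIndex k y) :
    dyadicLAvg f k x = dyadicLAvg f k y := by rw [dyadicLAvg, h, dyadicLAvg]

lemma stronglyMeasurable_dyadicAvg (f : EuclideanSpace ℝ (Fin d) → B) (k : ℤ) :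
    StronglyMeasurable (dyadicAvg f k) :=
  (StronglyMeasurable.of_discrete (f := fun n : Fin d → ℤ =>
    (dyadicVol d k).toReal⁻¹ • ∫ y in dyadicIndex k ⁻¹' {n}, f y)).comp_measurable
    (measurable_dyadicIndex k)

lemma measurable_dyadicLAvg (h : EuclideanSpace ℝ (Fin d) → ℝ≥0∞) (k : ℤ) :
    Measurable (dyadicLAvg h k) :=
  (measurable_of_countable (fun n : Fin d → ℤ =>
    (dyadicVol d k)⁻¹ * ∫⁻ y in dyadicIndex k ⁻¹' {n}, h y)).comp (measurable_dyadicIndex k)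

lemma enorm_dyadicAvg_le (f : EuclideanSpace ℝ (Fin d) → B) (k : ℤ)
    (x : EuclideanSpace ℝ (Fin d)) :
    ‖dyadicAvg f k x‖ₑ ≤ dyadicLAvg (fun y => ‖f y‖ₑ) k x := by
  rw [dyadicAvg, dyadicLAvg, enorm_smul]
  gcongr
  · have h : 0 < (dyadicVol d k).toReal :=
      ENNReal.toReal_pos (dyadicVol_ne_zero k) (dyadicVol_ne_top k)
    rw [Real.enorm_of_nonneg (by positivity), ENNReal.ofReal_inv_of_pos h,
      ENNReal.ofReal_toReal (dyadicVol_ne_top k)]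
  · exact enorm_integral_le_lintegral_enorm _

lemma setLIntegral_congr_dyadicCube {k : ℤ} {n : Fin d → ℤ}
    {h : EuclideanSpace ℝ (Fin d) → ℝ≥0∞} {c : ℝ≥0∞}
    (hc : ∀ x, dyadicIndex k x = n → h x = c) :
    ∫⁻ x in dyadicIndex k ⁻¹' {n}, h x = c * dyadicVol d k := by
  rw [setLIntegral_congr_fun (measurableSet_dyadicIndex k _) (g := fun _ => c)
    (fun x hx => hc x (by simpa using hx)), setLIntegral_const, volume_dyadicCube]

lemma dyadicCube_nonempty (k : ℤ) (n : Fin d → ℤ) :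
    ∃ x : EuclideanSpace ℝ (Fin d), dyadicIndex k x = n := by
  have : (dyadicIndex (d := d) k ⁻¹' {n}).Nonempty := by
    apply nonempty_of_measure_ne_zero (μ := volume)
    rw [volume_dyadicCube]; exact dyadicVol_ne_zero k
  exact this

lemma dyadicVol_mul_dyadicLAvg (h : EuclideanSpace ℝ (Fin d) → ℝ≥0∞) (k : ℤ)
    (x : EuclideanSpace ℝ (Fin d)) :
    dyadicLAvg h k x * dyadicVol d k = ∫⁻ y in dyadicIndex k ⁻¹' {dyadicIndex k x}, h y := by
  rw [dyadicLAvg, mul_comm, ← mul_assoc,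
    ENNReal.mul_inv_cancel (dyadicVol_ne_zero k) (dyadicVol_ne_top k), one_mul]

lemma setLIntegral_dyadicLAvg (h : EuclideanSpace ℝ (Fin d) → ℝ≥0∞) (k : ℤ)
    (A : Set (Fin d → ℤ)) :
    ∫⁻ x in dyadicIndex k ⁻¹' A, dyadicLAvg h k x = ∫⁻ x in dyadicIndex k ⁻¹' A, h x := by
  rw [lintegral_dyadicIndex_preimage, lintegral_dyadicIndex_preimage]
  congr 1 with n
  obtain ⟨x, hx⟩ := dyadicCube_nonempty k n.1
  rw [setLIntegral_congr_dyadicCube (c := dyadicLAvg h k x)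
    (fun y hy => dyadicLAvg_congr h (hy.trans hx.symm)), dyadicVol_mul_dyadicLAvg, hx]

lemma lintegral_dyadicLAvg (h : EuclideanSpace ℝ (Fin d) → ℝ≥0∞) (k : ℤ) :
    ∫⁻ x, dyadicLAvg h k x = ∫⁻ x, h x := by
  simpa using setLIntegral_dyadicLAvg h k univ

/-- Doubling: a cube has 2^d times less volume than its parent. This is what bounds the means on
stopping cubes, whose parents are not stopped. -/
lemma dyadicLAvg_le_succ (h : EuclideanSpace ℝ (Fin d) → ℝ≥0∞) (k : ℤ)
    (x : EuclideanSpace ℝ (Fin d)) : dyadicLAvg h k x ≤ 2 ^ d * dyadicLAvg h (k + 1) x := by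
  rw [dyadicLAvg, dyadicLAvg, dyadicVol_succ, ENNReal.mul_inv (by simp) (by simp), ← mul_assoc,
    ← mul_assoc, ENNReal.mul_inv_cancel (by simp) (by simp), one_mul]
  gcongr _ * ?_
  apply lintegral_mono_set
  intro y hy
  exact dyadicIndex_eq_of_le (by omega) hy

/-- The points whose dyadic cube of side `2 ^ k` meets `S`. -/
lemma exists_saturation (k : ℤ) (S : Set (EuclideanSpace ℝ (Fin d))) :
    ∃ A : Set (Fin d → ℤ), S ⊆ dyadicIndex k ⁻¹' A ∧
      ∀ y ∈ dyadicIndex k ⁻¹' A, ∃ x ∈ S, dist y x ≤ d * 2 ^ k := by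
  refine ⟨dyadicIndex k '' S, subset_preimage_image _ _, ?_⟩
  rintro y ⟨x, hx, hxy⟩
  exact ⟨x, hx, dist_le_of_dyadicIndex_eq hxy.symm⟩

lemma setLIntegral_lt_top_of_isBounded {f : EuclideanSpace ℝ (Fin d) → B}
    (hf : LocallyIntegrable f volume) {S : Set (EuclideanSpace ℝ (Fin d))}
    (hS : Bornology.IsBounded S) : ∫⁻ x in S, ‖f x‖ₑ < ∞ :=
  lt_of_le_of_lt (lintegral_mono_set subset_closure)
    (hf.integrableOn_isCompact hS.isCompact_closure).2

lemma MeasureTheory.LocallyIntegrable.integrableOn_isBounded {f : EuclideanSpace ℝ (Fin d) → B}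
    (hf : LocallyIntegrable f volume) {S : Set (EuclideanSpace ℝ (Fin d))}
    (hS : Bornology.IsBounded S) : IntegrableOn f S volume :=
  (hf.integrableOn_isCompact hS.isCompact_closure).mono_set subset_closure

lemma isBounded_of_dist_le {S T : Set (EuclideanSpace ℝ (Fin d))} {c : ℝ}
    (hS : Bornology.IsBounded S) (h : ∀ y ∈ T, ∃ x ∈ S, dist y x ≤ c) :
    Bornology.IsBounded T :=
  (hS.cthickening (δ := c)).subset fun y hy => by
    obtain ⟨x, hx, hxy⟩ := h y hy
    exact Metric.mem_cthickening_of_dist_le y x _ _ hx hxy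

lemma locallyIntegrable_dyadicAvg {f : EuclideanSpace ℝ (Fin d) → B}
    (hf : LocallyIntegrable f volume) (k : ℤ) : LocallyIntegrable (dyadicAvg f k) volume := by
  rw [locallyIntegrable_iff]
  intro K hK
  refine ⟨(stronglyMeasurable_dyadicAvg f k).aestronglyMeasurable, ?_⟩
  obtain ⟨A, hKA, hA⟩ := exists_saturation k K
  calc ∫⁻ x in K, ‖dyadicAvg f k x‖ₑ
      ≤ ∫⁻ x in dyadicIndex k ⁻¹' A, dyadicLAvg (fun y => ‖f y‖ₑ) k x :=
        (lintegral_mono_set hKA).trans (lintegral_mono fun x => enorm_dyadicAvg_le f k x)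
    _ = ∫⁻ x in dyadicIndex k ⁻¹' A, ‖f x‖ₑ := setLIntegral_dyadicLAvg _ _ _
    _ < ∞ := setLIntegral_lt_top_of_isBounded hf (isBounded_of_dist_le hK.isBounded hA)

lemma setIntegral_dyadicAvg_cube [CompleteSpace B] (f : EuclideanSpace ℝ (Fin d) → B) (k : ℤ) (n : Fin d → ℤ) :
    ∫ x in dyadicIndex k ⁻¹' {n}, dyadicAvg f k x = ∫ x in dyadicIndex k ⁻¹' {n}, f x := by
  obtain ⟨z, hz⟩ := dyadicCube_nonempty k n
  rw [setIntegral_congr_fun (measurableSet_dyadicIndex k _) (g := fun _ => dyadicAvg f k z)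
    (fun x hx => dyadicAvg_congr f (by rw [hz]; exact hx)), setIntegral_const,
    Measure.real, volume_dyadicCube, dyadicAvg, smul_smul, mul_inv_cancel₀, one_smul, hz]
  exact (ENNReal.toReal_pos (dyadicVol_ne_zero k) (dyadicVol_ne_top k)).ne'

/-- The cube is a disjoint union of cubes of the smaller side 2^j, and the integral vanishes on each
of them. This is the source of the cancellation, both for martingale differences and for bad parts.
-/
lemma setIntegral_sub_dyadicAvg_eq_zero [CompleteSpace B] {f : EuclideanSpace ℝ (Fin d) → B}
    {j k : ℤ} (hjk : j ≤ k) (hf : LocallyIntegrable f volume) (n : Fin d → ℤ) :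
    ∫ x in dyadicIndex k ⁻¹' {n}, (f x - dyadicAvg f j x) = 0 := by
  have hb := isBounded_dyadicCube k n
  have hint : LocallyIntegrable (fun x => f x - dyadicAvg f j x) volume :=
    hf.sub (locallyIntegrable_dyadicAvg hf j)
  have : dyadicIndex (d := d) k ⁻¹' {n} =
      dyadicIndex j ⁻¹' (dyadicIndex j '' (dyadicIndex k ⁻¹' {n})) := by
    refine (subset_preimage_image _ _).antisymm ?_
    rintro y ⟨x, hx, hxy⟩
    rw [mem_preimage, mem_singleton_iff] at hx ⊢
    rw [← hx]
    exact dyadicIndex_eq_of_le hjk hxy.symm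
  rw [this] at hb ⊢
  refine setIntegral_dyadicIndex_preimage_eq_zero (hint.integrableOn_isBounded hb) fun m => ?_
  rw [integral_sub, setIntegral_dyadicAvg_cube, sub_self]
  · exact hf.integrableOn_isBounded (isBounded_dyadicCube _ _)
  · exact (locallyIntegrable_dyadicAvg hf j).integrableOn_isBounded (isBounded_dyadicCube _ _)

/-- Jensen's inequality in the form used throughout. -/
lemma lintegral_rpow_le_measure_rpow_mul {α : Type*} [MeasurableSpace α] (μ : Measure α)
    {q : ℝ} (hq : 1 ≤ q) {h : α → ℝ≥0∞} (hh : AEMeasurable h μ) :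
    (∫⁻ x, h x ∂μ) ^ q ≤ μ univ ^ (q - 1) * ∫⁻ x, h x ^ q ∂μ := by
  rcases hq.eq_or_lt with rfl | hq
  · simp
  have hc : (Real.conjExponent q).HolderConjugate q := (Real.HolderConjugate.conjExponent hq).symm
  have := ENNReal.lintegral_mul_le_Lp_mul_Lq μ hc (f := fun _ => 1) aemeasurable_const hh
  simp only [Pi.mul_apply, one_mul, ENNReal.one_rpow, lintegral_const] at this
  calc (∫⁻ x, h x ∂μ) ^ q
      ≤ (μ univ ^ (1 / Real.conjExponent q) * (∫⁻ x, h x ^ q ∂μ) ^ (1 / q)) ^ q := by gcongr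
    _ = _ := by
      rw [ENNReal.mul_rpow_of_nonneg _ _ (by linarith), ← ENNReal.rpow_mul, ← ENNReal.rpow_mul,
        one_div_mul_cancel (by linarith), ENNReal.rpow_one, Real.conjExponent]
      congr 2
      field_simp

lemma dyadicLAvg_rpow_le {q : ℝ} (hq : 1 ≤ q) {h : EuclideanSpace ℝ (Fin d) → ℝ≥0∞}
    (hh : AEMeasurable h volume) (k : ℤ) (x : EuclideanSpace ℝ (Fin d)) :
    dyadicLAvg h k x ^ q ≤ dyadicLAvg (fun y => h y ^ q) k x := by
  have := lintegral_rpow_le_measure_rpow_mul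
    (volume.restrict (dyadicIndex k ⁻¹' {dyadicIndex k x})) hq hh.restrict
  rw [Measure.restrict_apply_univ, volume_dyadicCube] at this
  rw [dyadicLAvg, dyadicLAvg, ENNReal.mul_rpow_of_nonneg _ _ (by linarith)]
  calc _ ≤ (dyadicVol d k)⁻¹ ^ q * (dyadicVol d k ^ (q - 1) *
        ∫⁻ y in dyadicIndex k ⁻¹' {dyadicIndex k x}, h y ^ q) := by gcongr
    _ = _ := by
      rw [← mul_assoc]
      congr 1
      rw [ENNReal.inv_rpow, ← ENNReal.rpow_neg, ← ENNReal.rpow_add _ _ (dyadicVol_ne_zero k)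
        (dyadicVol_ne_top k)]
      rw [show -q + (q - 1) = -1 by ring, ENNReal.rpow_neg_one]

lemma enorm_dyadicAvg_rpow_le {q : ℝ} (hq : 1 ≤ q) {f : EuclideanSpace ℝ (Fin d) → B}
    (hf : AEStronglyMeasurable f volume) (k : ℤ) (x : EuclideanSpace ℝ (Fin d)) :
    ‖dyadicAvg f k x‖ₑ ^ q ≤ dyadicLAvg (fun y => ‖f y‖ₑ ^ q) k x :=
  (ENNReal.rpow_le_rpow (enorm_dyadicAvg_le f k x) (by linarith)).trans
    (dyadicLAvg_rpow_le hq hf.enorm k x)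

end Dyadic

/-! ### Inequalities for sums of powers in `[0, ∞]` -/

section Sums

/-- Interpolation of ℓ^q between ℓ^∞ and ℓ^1. It turns a total variation bound together with
smallness of single jumps into smallness of the q-variation. -/
lemma ENNReal.tsum_rpow_le_mul_tsum {ι : Type*} {q : ℝ} (hq : 1 ≤ q) {e : ι → ℝ≥0∞} {M : ℝ≥0∞}
    (h : ∀ i, e i ≤ M) : ∑' i, e i ^ q ≤ M ^ (q - 1) * ∑' i, e i := by
  rw [← ENNReal.tsum_mul_left]
  refine ENNReal.tsum_le_tsum fun i => ?_
  calc e i ^ q = e i ^ (q - 1) * e i ^ (1 : ℝ) := by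
        rw [← ENNReal.rpow_add_of_nonneg _ _ (by linarith) zero_le_one, sub_add_cancel]
    _ ≤ M ^ (q - 1) * e i := by
        rw [ENNReal.rpow_one]
        gcongr
        exact h i

lemma ENNReal.tsum_rpow_le_rpow_tsum {ι : Type*} {q : ℝ} (hq : 1 ≤ q) (e : ι → ℝ≥0∞) :
    ∑' i, e i ^ q ≤ (∑' i, e i) ^ q := by
  refine (ENNReal.tsum_rpow_le_mul_tsum hq (fun i => ENNReal.le_tsum i)).trans_eq ?_
  conv_lhs => rw [← ENNReal.rpow_one (∑' i, e i)]
  rw [ENNReal.rpow_one, ← ENNReal.rpow_one (∑' i, e i), ← ENNReal.rpow_mul,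
    ← ENNReal.rpow_add_of_nonneg _ _ (by linarith) zero_le_one]
  simp

lemma ENNReal.add_rpow_le_two_rpow_mul {q : ℝ} (hq : 1 ≤ q) (a b : ℝ≥0∞) :
    (a + b) ^ q ≤ 2 ^ q * (a ^ q + b ^ q) := by
  have h : a + b ≤ 2 * max a b := by
    rw [two_mul]; exact add_le_add (le_max_left _ _) (le_max_right _ _)
  calc (a + b) ^ q ≤ (2 * max a b) ^ q := by gcongr
    _ = 2 ^ q * (max a b) ^ q := ENNReal.mul_rpow_of_nonneg _ _ (by linarith)
    _ ≤ _ := by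
      gcongr
      rcases le_total a b with h | h
      · rw [max_eq_right h]; exact le_add_self
      · rw [max_eq_left h]; exact le_self_add

/-- Variation sums split along a monotone grouping of the indices. -/
lemma ENNReal.tsum_rpow_le_of_monotone_grouping {q : ℝ} (hq : 1 ≤ q) (I : Set ℕ) {m : ℕ → ℕ}
    (hm : Monotone m) {e a : ℕ → ℝ≥0∞}
    (h1 : ∀ j, ∑' i : {i | i ∈ I ∧ m i = j ∧ m (i + 1) = j}, e i ≤ a j)
    (h2 : ∀ i ∈ I, m i ≠ m (i + 1) → e i ≤ a (m i) + a (m (i + 1))) :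
    ∑' i : I, e i ^ q ≤ (1 + 2 * 2 ^ q) * ∑' j, a j ^ q := by
  set J : ℕ → Set ℕ := fun j => {i | i ∈ I ∧ m i = j ∧ m (i + 1) = j}
  set X : Set ℕ := {i | i ∈ I ∧ m i ≠ m (i + 1)}
  have hI : I ⊆ (⋃ j, J j) ∪ X := by
    intro i hi
    by_cases h : m i = m (i + 1)
    · exact Or.inl (mem_iUnion.2 ⟨m i, hi, rfl, h.symm⟩)
    · exact Or.inr ⟨hi, h⟩
  -- A monotone map leaves each value at most once and arrives at each value at most once. Hence
  -- every `a j` is charged at most twice by the indices in `X`.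
  have hinj1 : Function.Injective fun i : X => m i := by
    have key : ∀ i i' : ℕ, i ∈ X → i < i' → m i ≠ m i' := fun i i' hi hlt heq =>
      hi.2 (le_antisymm (hm (Nat.le_succ i)) (heq ▸ hm hlt))
    rintro ⟨i, hi⟩ ⟨i', hi'⟩ h
    rcases lt_trichotomy i i' with hlt | rfl | hlt
    · exact absurd h (key _ _ hi hlt)
    · rfl
    · exact absurd h.symm (key _ _ hi' hlt)
  have hinj2 : Function.Injective fun i : X => m (i + 1) := by
    have key : ∀ i i' : ℕ, i' ∈ X → i < i' → m (i + 1) ≠ m (i' + 1) := fun i i' hi hlt heq =>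
      hi.2 (le_antisymm (hm (Nat.le_succ i')) (heq ▸ hm hlt))
    rintro ⟨i, hi⟩ ⟨i', hi'⟩ h
    rcases lt_trichotomy i i' with hlt | rfl | hlt
    · exact absurd h (key _ _ hi' hlt)
    · rfl
    · exact absurd h.symm (key _ _ hi hlt)
  have hX : ∑' i : X, e i ^ q ≤ 2 * 2 ^ q * ∑' j, a j ^ q := by
    calc ∑' i : X, e i ^ q ≤ ∑' i : X, 2 ^ q * (a (m i) ^ q + a (m (i + 1)) ^ q) :=
          ENNReal.tsum_le_tsum fun i => (ENNReal.rpow_le_rpow (h2 i i.2.1 i.2.2)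
            (by linarith)).trans (ENNReal.add_rpow_le_two_rpow_mul hq _ _)
      _ = 2 ^ q * (∑' i : X, a (m i) ^ q + ∑' i : X, a (m (i + 1)) ^ q) := by
          rw [ENNReal.tsum_mul_left, ENNReal.tsum_add]
      _ ≤ 2 ^ q * (∑' j, a j ^ q + ∑' j, a j ^ q) := by
          gcongr
          · exact ENNReal.tsum_comp_le_tsum_of_injective hinj1 fun j => a j ^ q
          · exact ENNReal.tsum_comp_le_tsum_of_injective hinj2 fun j => a j ^ q
      _ = _ := by ring
  calc ∑' i : I, e i ^ q ≤ ∑' i : ↥((⋃ j, J j) ∪ X), e i ^ q :=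
        ENNReal.tsum_mono_subtype (fun i => e i ^ q) hI
    _ ≤ ∑' i : ↥(⋃ j, J j), e i ^ q + ∑' i : X, e i ^ q :=
        ENNReal.tsum_union_le (fun i => e i ^ q) _ _
    _ ≤ ∑' j, ∑' i : J j, e i ^ q + ∑' i : X, e i ^ q := by
        gcongr
        exact ENNReal.tsum_iUnion_le_tsum (fun i => e i ^ q) J
    _ ≤ ∑' j, a j ^ q + 2 * 2 ^ q * ∑' j, a j ^ q := by
        gcongr with j
        exact (ENNReal.tsum_rpow_le_rpow_tsum hq _).trans
          (ENNReal.rpow_le_rpow (h1 j) (by linarith))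
    _ = _ := by ring

/-- Sums of two-sided geometric series in `[0, ∞]`. -/
lemma ENNReal.tsum_pow_natAbs_sub_le (r : ℝ≥0∞) (k : ℤ) :
    ∑' n : ℤ, r ^ (n - k).natAbs ≤ 2 * (1 - r)⁻¹ := by
  have hshift : ∑' n : ℤ, r ^ (n - k).natAbs = ∑' n : ℤ, r ^ n.natAbs :=
    (Equiv.subRight k).tsum_eq (fun n : ℤ => r ^ n.natAbs)
  rw [hshift, two_mul]
  have hsub : (univ : Set ℤ) ⊆ range (fun n : ℕ => (n : ℤ)) ∪ range (fun n : ℕ => -(n : ℤ)) := by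
    intro n _
    rcases Int.eq_nat_or_neg n with ⟨m, rfl | rfl⟩
    · exact Or.inl ⟨m, rfl⟩
    · exact Or.inr ⟨m, rfl⟩
  have h1 : Function.Injective (fun n : ℕ => (n : ℤ)) := Nat.cast_injective
  have h2 : Function.Injective (fun n : ℕ => -(n : ℤ)) := neg_injective.comp h1
  calc ∑' n : ℤ, r ^ n.natAbs = ∑' n : (univ : Set ℤ), r ^ (n : ℤ).natAbs :=
        (tsum_univ fun n : ℤ => r ^ n.natAbs).symm
    _ ≤ _ := ENNReal.tsum_mono_subtype (fun n : ℤ => r ^ n.natAbs) hsub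
    _ ≤ _ := ENNReal.tsum_union_le (fun n : ℤ => r ^ n.natAbs) _ _
    _ = (1 - r)⁻¹ + (1 - r)⁻¹ := by
      rw [tsum_range (fun n : ℤ => r ^ n.natAbs) h1, tsum_range (fun n : ℤ => r ^ n.natAbs) h2]
      simp [ENNReal.tsum_geometric]

/-- The square root of two in `[0, ∞]`. -/
noncomputable def ENNReal.sqrtTwo : ℝ≥0∞ := 2 ^ (1 / 2 : ℝ)

lemma ENNReal.sqrtTwo_mul_self : ENNReal.sqrtTwo * ENNReal.sqrtTwo = 2 := by
  rw [sqrtTwo, ← ENNReal.rpow_add _ _ (by simp) (by simp)]; norm_num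

lemma ENNReal.sqrtTwo_ne_zero : ENNReal.sqrtTwo ≠ 0 := by simp [sqrtTwo]

lemma ENNReal.sqrtTwo_ne_top : ENNReal.sqrtTwo ≠ ∞ := by simp [sqrtTwo]

lemma ENNReal.one_lt_sqrtTwo : 1 < ENNReal.sqrtTwo :=
  ENNReal.one_lt_rpow (by norm_num) (by norm_num)

lemma ENNReal.sqrtTwo_mul_inv_two : ENNReal.sqrtTwo * 2⁻¹ = ENNReal.sqrtTwo⁻¹ := by
  rw [← ENNReal.sqrtTwo_mul_self, ENNReal.mul_inv (Or.inl sqrtTwo_ne_zero)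
    (Or.inl sqrtTwo_ne_top), ← mul_assoc, ENNReal.mul_inv_cancel sqrtTwo_ne_zero sqrtTwo_ne_top,
    one_mul]

lemma ENNReal.two_mul_inv_one_sub_ne_top {r : ℝ≥0∞} (hr : r < 1) : 2 * (1 - r)⁻¹ ≠ ∞ :=
  ENNReal.mul_ne_top (by simp) (ENNReal.inv_ne_top.2 (tsub_pos_of_lt hr).ne')

lemma ENNReal.inv_sqrtTwo_lt_one : ENNReal.sqrtTwo⁻¹ < 1 := by
  simpa using ENNReal.one_lt_sqrtTwo

/-- A weighted convexity inequality replacing Minkowski's inequality. -/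
lemma ENNReal.exists_rpow_sum_le_sum_weight_mul {q : ℝ} (hq : 1 < q) :
    ∃ K : ℝ≥0∞, K ≠ ∞ ∧ ∀ (s : Finset ℤ) (k : ℤ) (u : ℤ → ℝ≥0∞),
      (∑ n ∈ s, u n) ^ q ≤ K * ∑ n ∈ s, ENNReal.sqrtTwo ^ (n - k).natAbs * u n ^ q := by
  set p := Real.conjExponent q
  have hc : q.HolderConjugate p := Real.HolderConjugate.conjExponent hq
  have hq0 : 0 < q := by linarith
  have hp0 : 0 < p := hc.symm.pos
  -- Hölder with weights ρ^|n-k|, where ρ^q = √2: the loss is √2^|n-k|, which a decay of 2^(-|n-k|)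
  -- still beats.
  set ρ : ℝ≥0∞ := ENNReal.sqrtTwo ^ (1 / q)
  have hρ0 : ρ ≠ 0 := by simp [ρ, sqrtTwo_ne_zero, sqrtTwo_ne_top]
  have hρt : ρ ≠ ∞ := by
    refine ENNReal.rpow_ne_top_of_nonneg (by positivity) sqrtTwo_ne_top
  have hρ1 : 1 < ρ := ENNReal.one_lt_rpow one_lt_sqrtTwo (by positivity)
  have hρq : ρ ^ q = ENNReal.sqrtTwo := by
    rw [← ENNReal.rpow_mul, one_div_mul_cancel hq0.ne', ENNReal.rpow_one]
  have hr : (ρ⁻¹) ^ p < 1 := ENNReal.rpow_lt_one (by simpa using hρ1) hp0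
  refine ⟨(2 * (1 - (ρ⁻¹) ^ p)⁻¹) ^ (q / p), ENNReal.rpow_ne_top_of_nonneg (by positivity)
    (two_mul_inv_one_sub_ne_top hr), fun s k u => ?_⟩
  have hpow : ∀ (c : ℝ≥0∞) (n : ℕ) (r : ℝ), (c ^ n) ^ r = (c ^ r) ^ n := by
    intro c n r
    rw [← ENNReal.rpow_natCast, ← ENNReal.rpow_natCast, ← ENNReal.rpow_mul, ← ENNReal.rpow_mul,
      mul_comm]
  calc (∑ n ∈ s, u n) ^ q
      = (∑ n ∈ s, (ρ ^ (n - k).natAbs * u n) * (ρ⁻¹) ^ (n - k).natAbs) ^ q := by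
        congr 2 with n
        rw [mul_right_comm, ← mul_pow, ENNReal.mul_inv_cancel hρ0 hρt, one_pow, one_mul]
    _ ≤ ((∑ n ∈ s, (ρ ^ (n - k).natAbs * u n) ^ q) ^ (1 / q) *
          (∑ n ∈ s, ((ρ⁻¹) ^ (n - k).natAbs) ^ p) ^ (1 / p)) ^ q := by
        gcongr
        exact ENNReal.inner_le_Lp_mul_Lq s _ _ hc
    _ = (∑ n ∈ s, ((ρ⁻¹) ^ p) ^ (n - k).natAbs) ^ (q / p) *
          ∑ n ∈ s, ENNReal.sqrtTwo ^ (n - k).natAbs * u n ^ q := by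
        rw [ENNReal.mul_rpow_of_nonneg _ _ hq0.le, ← ENNReal.rpow_mul, ← ENNReal.rpow_mul,
          one_div_mul_cancel hq0.ne', ENNReal.rpow_one, mul_comm]
        congr 1
        · rw [one_div_mul_eq_div]
          simp only [hpow]
        · refine Finset.sum_congr rfl fun n _ => ?_
          rw [ENNReal.mul_rpow_of_nonneg _ _ hq0.le, hpow, hρq]
    _ ≤ _ := by
        gcongr
        exact (ENNReal.sum_le_tsum s).trans (ENNReal.tsum_pow_natAbs_sub_le _ k)

end Sums

/-! ### Ball averages -/

section BallAverage

variable {d : ℕ} {B : Type*} [NormedAddCommGroup B] [NormedSpace ℝ B]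

/-- The volume of Euclidean balls of radius `r`. -/
noncomputable def ballVol (d : ℕ) (r : ℝ) : ℝ≥0∞ :=
  volume (Metric.ball (0 : EuclideanSpace ℝ (Fin d)) r)

lemma volume_ball_eq_ballVol (x : EuclideanSpace ℝ (Fin d)) (r : ℝ) :
    volume (Metric.ball x r) = ballVol d r := Measure.addHaar_ball_center _ x r

lemma ballVol_eq {r : ℝ} (hr : 0 < r) : ballVol d r = ENNReal.ofReal (r ^ d) * ballVol d 1 := by
  have := Measure.addHaar_ball_of_pos (volume : Measure (EuclideanSpace ℝ (Fin d))) 0 hr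
  simpa [ballVol] using this

lemma ballVol_ne_top (r : ℝ) : ballVol d r ≠ ∞ := measure_ball_lt_top.ne

lemma ballVol_ne_zero {r : ℝ} (hr : 0 < r) : ballVol d r ≠ 0 :=
  (Metric.measure_ball_pos _ _ hr).ne'

lemma ballVol_mono {r s : ℝ} (h : r ≤ s) : ballVol d r ≤ ballVol d s :=
  measure_mono (Metric.ball_subset_ball h)

lemma ballVol_mul {c r : ℝ} (hc : 0 < c) (hr : 0 < r) :
    ballVol d (c * r) = ENNReal.ofReal (c ^ d) * ballVol d r := by
  rw [ballVol_eq (mul_pos hc hr), ballVol_eq hr, mul_pow, ENNReal.ofReal_mul (by positivity),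
    mul_assoc]

lemma ballAverage_eq (f : EuclideanSpace ℝ (Fin d) → B) (t : ℝ) (x : EuclideanSpace ℝ (Fin d)) :
    ballAverage f t x = (ballVol d t).toReal⁻¹ • ∫ y in Metric.ball x t, f y := by
  rw [ballAverage, setAverage_eq]
  congr 1
  have h := (measurePreserving_add_left (volume : Measure (EuclideanSpace ℝ (Fin d))) x)
  rw [← h.setIntegral_preimage_emb (MeasurableEquiv.addLeft x).measurableEmbedding f]
  congr 2
  ext y
  simp [dist_eq_norm]

/-- Dominated convergence: spheres are null, and for y off the sphere around x₀ the indicator of the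
ball is constant in x near x₀. -/
lemma continuous_setIntegral_ball {f : EuclideanSpace ℝ (Fin d) → B}
    (hf : LocallyIntegrable f volume) {t : ℝ} (ht : 0 < t) :
    Continuous fun x => ∫ y in Metric.ball x t, f y := by
  rw [continuous_iff_continuousAt]
  intro x₀
  have hrw : (fun x => ∫ y in Metric.ball x t, f y) =
      fun x => ∫ y, (Metric.ball x t).indicator f y := by
    ext x; rw [integral_indicator measurableSet_ball]
  rw [hrw]
  refine continuousAt_of_dominated
    (bound := fun y => (Metric.ball x₀ (t + 1)).indicator (fun y => ‖f y‖) y) ?_ ?_ ?_ ?_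
  · exact Eventually.of_forall fun x => hf.aestronglyMeasurable.indicator measurableSet_ball
  · filter_upwards [Metric.ball_mem_nhds x₀ one_pos] with x hx
    refine Eventually.of_forall fun y => ?_
    rw [norm_indicator_eq_indicator_norm]
    refine indicator_le_indicator_of_subset ?_ (fun _ => norm_nonneg _) y
    refine Metric.ball_subset_ball' ?_
    rw [Metric.mem_ball] at hx
    linarith
  · rw [integrable_indicator_iff measurableSet_ball]
    exact (hf.integrableOn_isBounded Metric.isBounded_ball).norm
  · have hs : volume (Metric.sphere x₀ t) = 0 := Measure.addHaar_sphere_of_ne_zero _ _ ht.ne'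
    filter_upwards [measure_eq_zero_iff_ae_notMem.1 hs] with y hy
    rw [Metric.mem_sphere] at hy
    refine ContinuousAt.congr (f := fun _ => (Metric.ball x₀ t).indicator f y)
      continuousAt_const ?_
    have hcont : Continuous fun x => dist y x := by fun_prop
    rcases lt_or_gt_of_ne hy with h | h
    · filter_upwards [hcont.continuousAt.eventually_lt (x₀ := x₀) continuousAt_const h] with x hx
      rw [indicator_of_mem (Metric.mem_ball.2 h), indicator_of_mem (Metric.mem_ball.2 hx)]
    · filter_upwards [continuousAt_const.eventually_lt (x₀ := x₀) hcont.continuousAt h] with x hx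
      rw [indicator_of_notMem, indicator_of_notMem]
      · simpa using hx.le
      · simpa using h.le

lemma continuous_ballAverage {f : EuclideanSpace ℝ (Fin d) → B}
    (hf : LocallyIntegrable f volume) {t : ℝ} (ht : 0 < t) : Continuous (ballAverage f t) := by
  have : ballAverage f t = fun x => (ballVol d t).toReal⁻¹ • ∫ y in Metric.ball x t, f y :=
    funext fun x => ballAverage_eq f t x
  rw [this]
  exact (continuous_setIntegral_ball hf ht).const_smul _

/-- Split the difference into the integral over the shell, normalised by the larger ball, and the
change of normalisation times the integral over the inner ball. Both are additive over disjoint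
shells once 1/v - 1/v' is bounded by a multiple of the shell volume. The norm in the second term
stays outside the integral, so that cancellation of f on balls can be used later. -/
lemma ballAverage_sub_le_of_le {f : EuclideanSpace ℝ (Fin d) → B}
    (hf : LocallyIntegrable f volume) (x : EuclideanSpace ℝ (Fin d)) {a s s' : ℝ} (ha : 0 < a)
    (has : a ≤ s) (hs : s ≤ s') :
    ‖ballAverage f s' x - ballAverage f s x‖ₑ ≤
      (ballVol d a)⁻¹ * (∫⁻ y in Metric.ball x s' \ Metric.ball x s, ‖f y‖ₑ) +
      (ballVol d a)⁻¹ ^ 2 * ‖∫ y in Metric.ball x s, f y‖ₑ *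
        volume (Metric.ball x s' \ Metric.ball x s) := by
  set F := ∫ y in Metric.ball x s, f y
  set v := (ballVol d s).toReal
  set v' := (ballVol d s').toReal
  set va := (ballVol d a).toReal
  have hpos : ∀ r, a ≤ r → 0 < (ballVol d r).toReal := fun r hr =>
    ENNReal.toReal_pos (ballVol_ne_zero (ha.trans_le hr)) (ballVol_ne_top r)
  have hva : 0 < va := hpos a le_rfl
  have hv : va ≤ v := ENNReal.toReal_mono (ballVol_ne_top _) (ballVol_mono has)
  have hv' : v ≤ v' := ENNReal.toReal_mono (ballVol_ne_top _) (ballVol_mono hs)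
  have hinv : ∀ r, a ≤ r → ‖(ballVol d r).toReal⁻¹‖ₑ = (ballVol d r)⁻¹ := fun r hr => by
    rw [Real.enorm_of_nonneg (inv_nonneg.2 (hpos r hr).le), ENNReal.ofReal_inv_of_pos (hpos r hr),
      ENNReal.ofReal_toReal (ballVol_ne_top r)]
  have hdiff : ∫ y in Metric.ball x s' \ Metric.ball x s, f y =
      (∫ y in Metric.ball x s', f y) - F :=
    setIntegral_sdiff measurableSet_ball (hf.integrableOn_isBounded Metric.isBounded_ball)
      (Metric.ball_subset_ball hs)
  have hvol : volume (Metric.ball x s' \ Metric.ball x s) = ENNReal.ofReal (v' - v) := by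
    rw [measure_sdiff (Metric.ball_subset_ball hs) measurableSet_ball.nullMeasurableSet
      measure_ball_lt_top.ne, volume_ball_eq_ballVol, volume_ball_eq_ballVol,
      ENNReal.ofReal_sub _ (by positivity), ENNReal.ofReal_toReal (ballVol_ne_top _),
      ENNReal.ofReal_toReal (ballVol_ne_top _)]
  have hdec : ballAverage f s' x - ballAverage f s x =
      v'⁻¹ • (∫ y in Metric.ball x s' \ Metric.ball x s, f y) - (v⁻¹ - v'⁻¹) • F := by
    rw [ballAverage_eq, ballAverage_eq, hdiff, smul_sub, sub_smul]
    abel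
  rw [hdec]
  refine (enorm_sub_le).trans ?_
  rw [enorm_smul, enorm_smul, hinv s' (has.trans hs), hvol]
  gcongr ?_ * ?_ + ?_
  · exact ENNReal.inv_le_inv.2 (ballVol_mono (has.trans hs))
  · exact enorm_integral_le_lintegral_enorm _
  · rw [mul_right_comm]
    gcongr
    have hva' : (ballVol d a)⁻¹ = ENNReal.ofReal va⁻¹ := by
      rw [ENNReal.ofReal_inv_of_pos hva, ENNReal.ofReal_toReal (ballVol_ne_top a)]
    have hle : v⁻¹ - v'⁻¹ ≤ va⁻¹ ^ 2 * (v' - v) := by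
      have h1 : v⁻¹ - v'⁻¹ = v⁻¹ * v'⁻¹ * (v' - v) := by
        have : v ≠ 0 := by linarith
        have : v' ≠ 0 := by linarith
        field_simp
      rw [h1, sq]
      have := inv_anti₀ hva hv
      have := inv_anti₀ hva (hv.trans hv')
      have : 0 ≤ v'⁻¹ := by rw [inv_nonneg]; linarith
      gcongr
    rw [Real.enorm_of_nonneg, hva', ← ENNReal.ofReal_pow (by positivity),
      ← ENNReal.ofReal_mul (by positivity)]
    · exact ENNReal.ofReal_le_ofReal hle
    · exact sub_nonneg.2 (inv_anti₀ (hva.trans_le hv) hv')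

/-- The total variation of `t ↦ A_t f(x)` over `a ≤ t ≤ b`. -/
lemma tsum_enorm_ballAverage_sub_le {f : EuclideanSpace ℝ (Fin d) → B}
    (hf : LocallyIntegrable f volume) (x : EuclideanSpace ℝ (Fin d)) {a : ℝ} (ha : 0 < a)
    {t : ℕ → ℝ} (ht : StrictMono t) {I : Set ℕ} {S : Set (EuclideanSpace ℝ (Fin d))}
    (hI : ∀ i ∈ I, a ≤ t i)
    (hS : ∀ i ∈ I, Metric.ball x (t (i + 1)) \ Metric.ball x (t i) ⊆ S) {Φ : ℝ≥0∞}
    (hΦ : ∀ i ∈ I, ‖∫ y in Metric.ball x (t i), f y‖ₑ ≤ Φ) :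
    ∑' i : I, ‖ballAverage f (t (i + 1)) x - ballAverage f (t i) x‖ₑ ≤
      (ballVol d a)⁻¹ * (∫⁻ y in S, ‖f y‖ₑ) + (ballVol d a)⁻¹ ^ 2 * Φ * volume S := by
  set R : ℕ → Set (EuclideanSpace ℝ (Fin d)) :=
    fun i => Metric.ball x (t (i + 1)) \ Metric.ball x (t i)
  have hRm : ∀ i, MeasurableSet (R i) := fun i => measurableSet_ball.diff measurableSet_ball
  have hkey : ∀ i j, i < j → Disjoint (R i) (R j) := fun i j hij => by
    rw [Set.disjoint_left]
    rintro y ⟨h1, -⟩ ⟨-, h2⟩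
    exact h2 (Metric.ball_subset_ball (ht.monotone hij) h1)
  have hdisj : Pairwise (Function.onFun Disjoint fun i : I => R i) := by
    rintro ⟨i, hi⟩ ⟨j, hj⟩ hij
    rcases lt_or_gt_of_ne (fun h => hij (Subtype.ext h)) with h | h
    · exact hkey i j h
    · exact (hkey j i h).symm
  have hsub : (⋃ i : I, R i) ⊆ S := iUnion_subset fun i => hS i i.2
  calc ∑' i : I, ‖ballAverage f (t (i + 1)) x - ballAverage f (t i) x‖ₑ
      ≤ ∑' i : I, ((ballVol d a)⁻¹ * (∫⁻ y in R i, ‖f y‖ₑ) +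
          (ballVol d a)⁻¹ ^ 2 * Φ * volume (R i)) := by
        refine ENNReal.tsum_le_tsum fun i => ?_
        refine (ballAverage_sub_le_of_le hf x ha (hI i i.2) (ht (Nat.lt_succ_self _)).le).trans ?_
        gcongr
        exact hΦ i i.2
    _ = (ballVol d a)⁻¹ * (∑' i : I, ∫⁻ y in R i, ‖f y‖ₑ) +
          (ballVol d a)⁻¹ ^ 2 * Φ * ∑' i : I, volume (R i) := by
        rw [ENNReal.tsum_add, ENNReal.tsum_mul_left, ENNReal.tsum_mul_left]
    _ = (ballVol d a)⁻¹ * (∫⁻ y in ⋃ i : I, R i, ‖f y‖ₑ) +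
          (ballVol d a)⁻¹ ^ 2 * Φ * volume (⋃ i : I, R i) := by
        rw [lintegral_iUnion (s := fun i : I => R i) (fun i => hRm i) hdisj,
          measure_iUnion hdisj (fun i => hRm i)]
    _ ≤ _ := by gcongr

end BallAverage

/-! ### The variation over a single dyadic range of radii -/

section ScaleVariation

variable {d : ℕ} {B : Type*} [NormedAddCommGroup B] [NormedSpace ℝ B]

/-- The indices `i` for which `(t_i, t_{i+1}]` lies in `(2 ^ k, 2 ^ (k + 1)]`. -/
def scaleIndices (k : ℤ) (t : ℕ → ℝ) : Set ℕ :=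
  {i | Ioc (t i) (t (i + 1)) ⊆ Ioc ((2 : ℝ) ^ k) ((2 : ℝ) ^ (k + 1))}

lemma le_of_mem_scaleIndices {k : ℤ} {t : ℕ → ℝ} (ht : StrictMono t) {i : ℕ}
    (hi : i ∈ scaleIndices k t) : (2 : ℝ) ^ k ≤ t i ∧ t (i + 1) ≤ 2 ^ (k + 1) :=
  ((Ioc_subset_Ioc_iff (ht (Nat.lt_succ_self i))).1 hi).symm

/-- The `q`-th power of the variation along `t` at the scale `2 ^ k`. -/
noncomputable def scaleVariation (q : ℝ) (f : EuclideanSpace ℝ (Fin d) → B) (k : ℤ) (t : ℕ → ℝ)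
    (x : EuclideanSpace ℝ (Fin d)) : ℝ≥0∞ :=
  ∑' i : scaleIndices k t, ‖ballAverage f (t (i.1 + 1)) x - ballAverage f (t i.1) x‖ₑ ^ q

/-- The `q`-th power of the variation at the scale `2 ^ k`. -/
noncomputable def scaleSup (q : ℝ) (f : EuclideanSpace ℝ (Fin d) → B) (k : ℤ)
    (x : EuclideanSpace ℝ (Fin d)) : ℝ≥0∞ :=
  ⨆ (t : ℕ → ℝ) (_ : StrictMono t) (_ : ∀ i, 0 < t i), scaleVariation q f k t x

lemma scaleVariation_le_scaleSup (q : ℝ) (f : EuclideanSpace ℝ (Fin d) → B) (k : ℤ) {t : ℕ → ℝ}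
    (ht : StrictMono t) (ht0 : ∀ i, 0 < t i) (x : EuclideanSpace ℝ (Fin d)) :
    scaleVariation q f k t x ≤ scaleSup q f k x :=
  le_iSup₂_of_le t ht (le_iSup_of_le ht0 le_rfl)

lemma scaleSup_le {q : ℝ} {f : EuclideanSpace ℝ (Fin d) → B} {k : ℤ}
    {x : EuclideanSpace ℝ (Fin d)} {C : ℝ≥0∞}
    (h : ∀ t, StrictMono t → (∀ i, 0 < t i) → scaleVariation q f k t x ≤ C) :
    scaleSup q f k x ≤ C :=
  iSup_le fun t => iSup₂_le fun ht ht0 => h t ht ht0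

lemma shortVariation_eq (q : ℝ) (f : EuclideanSpace ℝ (Fin d) → B)
    (x : EuclideanSpace ℝ (Fin d)) :
    shortVariation q f x = ⨆ (t : ℕ → ℝ) (_ : StrictMono t) (_ : ∀ i, 0 < t i),
      (∑' k : ℤ, scaleVariation q f k t x) ^ (1 / q) := rfl

lemma le_shortVariation (q : ℝ) (f : EuclideanSpace ℝ (Fin d) → B) {t : ℕ → ℝ}
    (ht : StrictMono t) (ht0 : ∀ i, 0 < t i) (x : EuclideanSpace ℝ (Fin d)) :
    (∑' k : ℤ, scaleVariation q f k t x) ^ (1 / q) ≤ shortVariation q f x :=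
  le_iSup₂_of_le (f := fun t (_ : StrictMono t) => ⨆ (_ : ∀ i, 0 < t i),
    (∑' k : ℤ, scaleVariation q f k t x) ^ (1 / q)) t ht (le_iSup_of_le ht0 le_rfl)

lemma shortVariation_le {q : ℝ} {f : EuclideanSpace ℝ (Fin d) → B}
    {x : EuclideanSpace ℝ (Fin d)} {C : ℝ≥0∞}
    (h : ∀ t, StrictMono t → (∀ i, 0 < t i) →
      (∑' k : ℤ, scaleVariation q f k t x) ^ (1 / q) ≤ C) :
    shortVariation q f x ≤ C :=
  iSup_le fun t => iSup₂_le fun ht ht0 => h t ht ht0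

/-- Letting each scale choose its own sequence of radii only enlarges the sum. The scales become
independent, at no cost for L^q bounds. -/
lemma shortVariation_rpow_le {q : ℝ} (hq : 0 < q) (f : EuclideanSpace ℝ (Fin d) → B)
    (x : EuclideanSpace ℝ (Fin d)) : shortVariation q f x ^ q ≤ ∑' k : ℤ, scaleSup q f k x := by
  rw [← ENNReal.le_rpow_inv_iff hq, ← one_div]
  refine shortVariation_le fun t ht ht0 => ?_
  gcongr
  exact scaleVariation_le_scaleSup q f _ ht ht0 x

/-- The suprema run over uncountably many sequences, so measurability is obtained from lower
semicontinuity, which survives sums and arbitrary suprema of continuous functions of x. -/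
lemma lowerSemicontinuous_scaleVariation {q : ℝ} {f : EuclideanSpace ℝ (Fin d) → B}
    (hf : LocallyIntegrable f volume) (k : ℤ) {t : ℕ → ℝ} (ht0 : ∀ i, 0 < t i) :
    LowerSemicontinuous (scaleVariation q f k t) := by
  refine lowerSemicontinuous_tsum fun i => Continuous.lowerSemicontinuous ?_
  exact ENNReal.continuous_rpow_const.comp
    (((continuous_ballAverage hf (ht0 _)).sub (continuous_ballAverage hf (ht0 _))).enorm)

lemma measurable_scaleSup (q : ℝ) {f : EuclideanSpace ℝ (Fin d) → B}
    (hf : LocallyIntegrable f volume) (k : ℤ) : Measurable (scaleSup q f k) := by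
  refine LowerSemicontinuous.measurable ?_
  refine lowerSemicontinuous_iSup fun t => lowerSemicontinuous_iSup fun ht =>
    lowerSemicontinuous_iSup fun ht0 => lowerSemicontinuous_scaleVariation hf k ht0

lemma lowerSemicontinuous_shortVariation {q : ℝ} (hq : 0 < q) {f : EuclideanSpace ℝ (Fin d) → B}
    (hf : LocallyIntegrable f volume) : LowerSemicontinuous (shortVariation q f) := by
  refine lowerSemicontinuous_iSup fun t => lowerSemicontinuous_iSup fun ht =>
    lowerSemicontinuous_iSup fun ht0 => ?_
  refine Continuous.comp_lowerSemicontinuous (g := fun c : ℝ≥0∞ => c ^ (1 / q))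
    ENNReal.continuous_rpow_const (lowerSemicontinuous_tsum fun k =>
      lowerSemicontinuous_scaleVariation hf k ht0) ?_
  exact ENNReal.monotone_rpow_of_nonneg (by positivity)

lemma measurable_shortVariation {q : ℝ} (hq : 0 < q) {f : EuclideanSpace ℝ (Fin d) → B}
    (hf : LocallyIntegrable f volume) : Measurable (shortVariation q f) :=
  (lowerSemicontinuous_shortVariation hq hf).measurable

lemma ballAverage_congr {f g : EuclideanSpace ℝ (Fin d) → B} {t : ℝ}
    {x : EuclideanSpace ℝ (Fin d)} (h : ∀ y ∈ Metric.ball x t, f y = g y) :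
    ballAverage f t x = ballAverage g t x := by
  rw [ballAverage_eq, ballAverage_eq, setIntegral_congr_fun measurableSet_ball h]

lemma scaleVariation_congr (q : ℝ) {f g : EuclideanSpace ℝ (Fin d) → B} {k : ℤ} {t : ℕ → ℝ}
    (ht : StrictMono t) {x : EuclideanSpace ℝ (Fin d)}
    (h : ∀ y ∈ Metric.ball x (2 ^ (k + 1)), f y = g y) :
    scaleVariation q f k t x = scaleVariation q g k t x := by
  refine tsum_congr fun i => ?_
  have h2 := (le_of_mem_scaleIndices ht i.2).2
  have h1 := (ht (Nat.lt_succ_self i.1)).le.trans h2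
  rw [ballAverage_congr fun y hy => h y (Metric.ball_subset_ball h1 hy),
    ballAverage_congr fun y hy => h y (Metric.ball_subset_ball h2 hy)]

lemma scaleSup_congr (q : ℝ) {f g : EuclideanSpace ℝ (Fin d) → B} {k : ℤ}
    {x : EuclideanSpace ℝ (Fin d)} (h : ∀ y ∈ Metric.ball x (2 ^ (k + 1)), f y = g y) :
    scaleSup q f k x = scaleSup q g k x := by
  simp only [scaleSup]
  congr! 4 with t ht ht0
  exact scaleVariation_congr q ht h

lemma scaleSup_const {q : ℝ} (hq : 0 < q) [CompleteSpace B] (c : B) (k : ℤ)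
    (x : EuclideanSpace ℝ (Fin d)) :
    scaleSup q (fun _ : EuclideanSpace ℝ (Fin d) => c) k x = 0 := by
  refine le_antisymm (scaleSup_le fun t ht ht0 => ?_) zero_le
  rw [scaleVariation]
  refine (ENNReal.tsum_eq_zero.2 fun i => ?_).le
  have key : ∀ j, ballAverage (fun _ : EuclideanSpace ℝ (Fin d) => c) (t j) x = c := fun j => by
    rw [ballAverage_eq, setIntegral_const, Measure.real, volume_ball_eq_ballVol, smul_smul,
      inv_mul_cancel₀, one_smul]
    exact (ENNReal.toReal_pos (ballVol_ne_zero (ht0 j)) (ballVol_ne_top _)).ne'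
  simp [key, hq]

lemma ballAverage_finset_sum {ι : Type*} (s : Finset ι) {F : ι → EuclideanSpace ℝ (Fin d) → B}
    (hF : ∀ n ∈ s, LocallyIntegrable (F n) volume) (t : ℝ) (x : EuclideanSpace ℝ (Fin d)) :
    ballAverage (fun y => ∑ n ∈ s, F n y) t x = ∑ n ∈ s, ballAverage (F n) t x := by
  simp only [ballAverage_eq]
  rw [integral_finsetSum s fun n hn => (hF n hn).integrableOn_isBounded Metric.isBounded_ball,
    Finset.smul_sum]

/-- A substitute for the triangle inequality in a form linear in the q-th powers. The weight
√2^|n-k| is affordable because the n-th piece will decay like 2^(-|n-k|) at scale 2^k. -/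
lemma exists_scaleSup_sum_le {q : ℝ} (hq : 1 < q) :
    ∃ K : ℝ≥0∞, K ≠ ∞ ∧ ∀ (s : Finset ℤ) (k : ℤ) (F : ℤ → EuclideanSpace ℝ (Fin d) → B),
      (∀ n ∈ s, LocallyIntegrable (F n) volume) → ∀ x,
      scaleSup q (fun y => ∑ n ∈ s, F n y) k x ≤
        K * ∑ n ∈ s, ENNReal.sqrtTwo ^ (n - k).natAbs * scaleSup q (F n) k x := by
  obtain ⟨K, hK, h⟩ := ENNReal.exists_rpow_sum_le_sum_weight_mul hq
  refine ⟨K, hK, fun s k F hF x => scaleSup_le fun t ht ht0 => ?_⟩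
  calc scaleVariation q (fun y => ∑ n ∈ s, F n y) k t x
      ≤ ∑' i : scaleIndices k t, K * ∑ n ∈ s, ENNReal.sqrtTwo ^ (n - k).natAbs *
          ‖ballAverage (F n) (t (i.1 + 1)) x - ballAverage (F n) (t i.1) x‖ₑ ^ q := by
        refine ENNReal.tsum_le_tsum fun i => ?_
        rw [ballAverage_finset_sum s hF, ballAverage_finset_sum s hF, ← Finset.sum_sub_distrib]
        refine le_trans ?_ (h s k _)
        gcongr
        exact enorm_sum_le _ _
    _ = K * ∑ n ∈ s, ENNReal.sqrtTwo ^ (n - k).natAbs * scaleVariation q (F n) k t x := by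
        rw [ENNReal.tsum_mul_left, Summable.tsum_finsetSum fun _ _ => ENNReal.summable]
        simp only [ENNReal.tsum_mul_left, scaleVariation]
    _ ≤ _ := by
        gcongr
        exact scaleVariation_le_scaleSup q _ k ht ht0 x

lemma two_zpow_pos (k : ℤ) : (0 : ℝ) < 2 ^ k := by positivity

/-- The q-variation is at most the total variation, and the total variation over one dyadic range of
radii is at most a multiple of the mean of ‖f‖. -/
lemma scaleSup_le_lintegral {q : ℝ} (hq : 1 ≤ q) {f : EuclideanSpace ℝ (Fin d) → B}
    (hf : LocallyIntegrable f volume) (k : ℤ) (x : EuclideanSpace ℝ (Fin d)) :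
    scaleSup q f k x ≤ ((1 + 2 ^ d) * ((ballVol d (2 ^ k))⁻¹ *
      ∫⁻ y in Metric.ball x (2 ^ (k + 1)), ‖f y‖ₑ)) ^ q := by
  refine scaleSup_le fun t ht ht0 => (ENNReal.tsum_rpow_le_rpow_tsum hq _).trans ?_
  gcongr
  refine (tsum_enorm_ballAverage_sub_le hf x (two_zpow_pos k) ht
    (S := Metric.ball x (2 ^ (k + 1))) (Φ := ∫⁻ y in Metric.ball x (2 ^ (k + 1)), ‖f y‖ₑ)
    (fun i hi => (le_of_mem_scaleIndices ht hi).1)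
    (fun i hi => sdiff_subset.trans (Metric.ball_subset_ball (le_of_mem_scaleIndices ht hi).2))
    (fun i hi => ?_)).trans ?_
  · refine (enorm_integral_le_lintegral_enorm _).trans (lintegral_mono_set ?_)
    exact Metric.ball_subset_ball
      ((ht (Nat.lt_succ_self i)).le.trans (le_of_mem_scaleIndices ht hi).2)
  · have h2 : volume (Metric.ball x ((2 : ℝ) ^ (k + 1))) = 2 ^ d * ballVol d (2 ^ k) := by
      rw [volume_ball_eq_ballVol, zpow_add_one₀ two_ne_zero, mul_comm,
        ballVol_mul two_pos (two_zpow_pos k), ENNReal.ofReal_pow (by positivity)]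
      simp
    rw [h2]
    set v := ballVol d ((2 : ℝ) ^ k)
    set J := ∫⁻ y in Metric.ball x (2 ^ (k + 1)), ‖f y‖ₑ
    have hv0 : v ≠ 0 := ballVol_ne_zero (two_zpow_pos k)
    have hvt : v ≠ ∞ := ballVol_ne_top _
    have : v⁻¹ ^ 2 * J * (2 ^ d * v) = 2 ^ d * (v⁻¹ * J) := by
      calc v⁻¹ ^ 2 * J * (2 ^ d * v) = 2 ^ d * (v⁻¹ * J) * (v⁻¹ * v) := by ring
        _ = _ := by rw [ENNReal.inv_mul_cancel hv0 hvt, mul_one]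
    rw [this, add_mul, one_mul]

/-- The crude bound by the mean of `‖f‖ ^ q` over a ball. -/
lemma exists_scaleSup_le_lintegral_rpow (d : ℕ) {q : ℝ} (hq : 1 ≤ q) :
    ∃ C : ℝ≥0∞, C ≠ ∞ ∧ ∀ (f : EuclideanSpace ℝ (Fin d) → B), LocallyIntegrable f volume →
      ∀ (k : ℤ) (x : EuclideanSpace ℝ (Fin d)), scaleSup q f k x ≤
        C * ((ballVol d (2 ^ k))⁻¹ * ∫⁻ y in Metric.ball x (2 ^ (k + 1)), ‖f y‖ₑ ^ q) := by
  refine ⟨(1 + 2 ^ d) ^ q * (2 ^ d) ^ (q - 1), ?_, fun f hf k x => ?_⟩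
  · exact ENNReal.mul_ne_top (ENNReal.rpow_ne_top_of_nonneg (by linarith) (by simp))
      (ENNReal.rpow_ne_top_of_nonneg (by linarith) (by simp))
  refine (scaleSup_le_lintegral hq hf k x).trans ?_
  have h2 : volume (Metric.ball x ((2 : ℝ) ^ (k + 1))) = 2 ^ d * ballVol d (2 ^ k) := by
    rw [volume_ball_eq_ballVol, zpow_add_one₀ two_ne_zero, mul_comm,
      ballVol_mul two_pos (two_zpow_pos k), ENNReal.ofReal_pow (by positivity)]
    simp
  have hJ := lintegral_rpow_le_measure_rpow_mul
    (volume.restrict (Metric.ball x ((2 : ℝ) ^ (k + 1)))) hq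
    hf.aestronglyMeasurable.enorm.restrict
  rw [Measure.restrict_apply_univ, h2] at hJ
  set v := ballVol d ((2 : ℝ) ^ k)
  have hv0 : v ≠ 0 := ballVol_ne_zero (two_zpow_pos k)
  have hvt : v ≠ ∞ := ballVol_ne_top _
  rw [ENNReal.mul_rpow_of_nonneg _ _ (by linarith), ENNReal.mul_rpow_of_nonneg _ _ (by linarith),
    mul_assoc]
  gcongr (1 + 2 ^ d) ^ q * ?_
  calc v⁻¹ ^ q * (∫⁻ y in Metric.ball x (2 ^ (k + 1)), ‖f y‖ₑ) ^ q
      ≤ v⁻¹ ^ q * ((2 ^ d * v) ^ (q - 1) * ∫⁻ y in Metric.ball x (2 ^ (k + 1)), ‖f y‖ₑ ^ q) := by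
        gcongr
    _ = (2 ^ d) ^ (q - 1) * ((v⁻¹ ^ q * v ^ (q - 1)) *
          ∫⁻ y in Metric.ball x (2 ^ (k + 1)), ‖f y‖ₑ ^ q) := by
        rw [ENNReal.mul_rpow_of_nonneg _ _ (by linarith)]; ring
    _ = _ := by
        rw [ENNReal.inv_rpow, ← ENNReal.rpow_neg, ← ENNReal.rpow_add _ _ hv0 hvt,
          show -q + (q - 1) = -1 by ring, ENNReal.rpow_neg_one]

lemma lintegral_lintegral_ball {h : EuclideanSpace ℝ (Fin d) → ℝ≥0∞} (hh : AEMeasurable h volume)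
    (r : ℝ) : ∫⁻ x, ∫⁻ y in Metric.ball x r, h y = ballVol d r * ∫⁻ y, h y := by
  have hs : MeasurableSet {p : EuclideanSpace ℝ (Fin d) × EuclideanSpace ℝ (Fin d) |
      dist p.2 p.1 < r} := measurableSet_lt (by fun_prop) measurable_const
  have h1 : ∀ x, ∫⁻ y in Metric.ball x r, h y = ∫⁻ y, {p : EuclideanSpace ℝ (Fin d) ×
      EuclideanSpace ℝ (Fin d) | dist p.2 p.1 < r}.indicator (fun p => h p.2) (x, y) := by
    intro x
    rw [← lintegral_indicator measurableSet_ball]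
    rfl
  simp only [h1]
  rw [lintegral_lintegral_swap]
  · rw [← lintegral_const_mul'' _ hh]
    congr 1 with y
    calc ∫⁻ x, {p : EuclideanSpace ℝ (Fin d) ×
          EuclideanSpace ℝ (Fin d) | dist p.2 p.1 < r}.indicator (fun p => h p.2) (x, y)
        = ∫⁻ x, (Metric.ball y r).indicator (fun _ => h y) x := by
          congr 1 with x
          simp only [indicator, mem_ofPred_eq, Metric.mem_ball, dist_comm]
      _ = _ := by
          rw [lintegral_indicator measurableSet_ball, setLIntegral_const, volume_ball_eq_ballVol,
            mul_comm]
  · exact (hh.comp_snd).indicator hs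

end ScaleVariation

/-! ### Thin annuli and functions with mean zero on small cubes -/

section SmallScale

variable {d : ℕ} {B : Type*} [NormedAddCommGroup B] [NormedSpace ℝ B]

/-- The half-open annulus `a ≤ |y - x| < b`. -/
def annulus (x : EuclideanSpace ℝ (Fin d)) (a b : ℝ) : Set (EuclideanSpace ℝ (Fin d)) :=
  Metric.ball x b \ Metric.ball x a

lemma measurableSet_annulus (x : EuclideanSpace ℝ (Fin d)) (a b : ℝ) :
    MeasurableSet (annulus x a b) := measurableSet_ball.diff measurableSet_ball

lemma mem_annulus {x y : EuclideanSpace ℝ (Fin d)} {a b : ℝ} :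
    y ∈ annulus x a b ↔ dist y x < b ∧ a ≤ dist y x := by
  simp [annulus, Metric.mem_ball]

lemma annulus_mono {x : EuclideanSpace ℝ (Fin d)} {a b a' b' : ℝ} (ha : a' ≤ a) (hb : b ≤ b') :
    annulus x a b ⊆ annulus x a' b' := fun y hy => by
  rw [mem_annulus] at hy ⊢
  exact ⟨hy.1.trans_le hb, ha.trans hy.2⟩

lemma pow_sub_pow_le_mul {a b : ℝ} (ha : 0 ≤ a) (hab : a ≤ b) (n : ℕ) :
    b ^ n - a ^ n ≤ n * b ^ (n - 1) * (b - a) := by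
  induction n with
  | zero => simp
  | succ n ih =>
    rcases n with _ | n
    · simp
    · have hb : 0 ≤ b := ha.trans hab
      have h1 : a ^ (n + 1) ≤ b ^ (n + 1) := by gcongr
      simp only [Nat.add_sub_cancel] at ih ⊢
      push_cast at ih ⊢
      calc b ^ (n + 1 + 1) - a ^ (n + 1 + 1)
          = b * (b ^ (n + 1) - a ^ (n + 1)) + a ^ (n + 1) * (b - a) := by ring
        _ ≤ b * ((n + 1) * b ^ n * (b - a)) + b ^ (n + 1) * (b - a) := by
            gcongr
        _ = _ := by ring

/-- Linear in the thickness. A non-positive inner radius is allowed: the annulus is then a full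
ball, and b ≤ b - a. -/
lemma volume_annulus_le [NeZero d] (x : EuclideanSpace ℝ (Fin d)) {a b β : ℝ} (hab : a ≤ b)
    (hβ : b ≤ β) (hβ0 : 0 ≤ β) :
    volume (annulus x a b) ≤ ENNReal.ofReal (d * β ^ (d - 1) * (b - a)) * ballVol d 1 := by
  have hd : 1 ≤ d := Nat.one_le_iff_ne_zero.2 (NeZero.ne d)
  rcases le_or_gt b 0 with hb | hb
  · rw [annulus, Metric.ball_eq_empty.2 hb]; simp
  have hβ' : b ^ (d - 1) ≤ β ^ (d - 1) := by gcongr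
  rcases le_or_gt a 0 with ha | ha
  · rw [annulus, Metric.ball_eq_empty.2 ha, sdiff_empty, volume_ball_eq_ballVol, ballVol_eq hb]
    gcongr
    have hd' : (1 : ℝ) ≤ d := by exact_mod_cast hd
    calc b ^ d = 1 * b ^ (d - 1) * b := by rw [one_mul, ← pow_succ, Nat.sub_add_cancel hd]
      _ ≤ d * β ^ (d - 1) * (b - a) := by
        gcongr
        linarith
  · rw [annulus, measure_sdiff (Metric.ball_subset_ball hab) measurableSet_ball.nullMeasurableSet
      measure_ball_lt_top.ne, volume_ball_eq_ballVol, volume_ball_eq_ballVol, ballVol_eq hb,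
      ballVol_eq ha, ← ENNReal.sub_mul fun _ _ => ballVol_ne_top 1,
      ← ENNReal.ofReal_sub _ (by positivity)]
    gcongr
    refine (pow_sub_pow_le_mul ha.le hab d).trans ?_
    gcongr

/-- For `g` with vanishing means over the cubes of side `2 ^ l`, only the cubes meeting the
boundary of a ball contribute to its integral over the ball. -/
lemma enorm_setIntegral_ball_le {g : EuclideanSpace ℝ (Fin d) → B}
    (hg : LocallyIntegrable g volume) {l : ℤ}
    (h0 : ∀ n, ∫ x in dyadicIndex l ⁻¹' {n}, g x = 0) (x : EuclideanSpace ℝ (Fin d)) (t : ℝ) :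
    ‖∫ y in Metric.ball x t, g y‖ₑ ≤ ∫⁻ y in annulus x (t - d * 2 ^ l) t, ‖g y‖ₑ := by
  set A : Set (Fin d → ℤ) := {n | dyadicIndex l ⁻¹' {n} ⊆ Metric.ball x t}
  have hA : dyadicIndex l ⁻¹' A ⊆ Metric.ball x t := fun y hy => hy rfl
  have hz := setIntegral_dyadicIndex_preimage_eq_zero (A := A)
    (hg.integrableOn_isBounded (Metric.isBounded_ball.subset hA)) h0
  have := setIntegral_sdiff (measurableSet_dyadicIndex l A)
    (hg.integrableOn_isBounded Metric.isBounded_ball) hA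
  rw [hz, sub_zero] at this
  rw [← this]
  refine (enorm_integral_le_lintegral_enorm _).trans (lintegral_mono_set ?_)
  rintro y ⟨hy1, hy2⟩
  refine ⟨hy1, fun hy3 => hy2 fun z hz => ?_⟩
  rw [Metric.mem_ball] at hy3 ⊢
  have h1 : dist z y ≤ d * 2 ^ l := dist_le_of_dyadicIndex_eq hz
  linarith [dist_triangle z y x]

lemma enorm_ballAverage_le {f : EuclideanSpace ℝ (Fin d) → B} {a t : ℝ} (ha : 0 < a) (hat : a ≤ t)
    (x : EuclideanSpace ℝ (Fin d)) :
    ‖ballAverage f t x‖ₑ ≤ (ballVol d a)⁻¹ * ‖∫ y in Metric.ball x t, f y‖ₑ := by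
  have hpos : 0 < (ballVol d t).toReal :=
    ENNReal.toReal_pos (ballVol_ne_zero (ha.trans_le hat)) (ballVol_ne_top t)
  rw [ballAverage_eq, enorm_smul, Real.enorm_of_nonneg (inv_nonneg.2 hpos.le),
    ENNReal.ofReal_inv_of_pos hpos, ENNReal.ofReal_toReal (ballVol_ne_top t)]
  gcongr
  exact ballVol_mono hat

/-- Annuli of width 2δ centred at multiples of δ overlap at most twice: cut each at its middle
radius into two annuli of width δ, which gives two disjoint families (c = 0 and c = 1). -/
lemma tsum_lintegral_annulus_le (x : EuclideanSpace ℝ (Fin d)) {δ : ℝ}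
    {J : Set ℕ} {b : ℝ} (hJ : ∀ m ∈ J, (m + 1) * δ ≤ b) (hδ : 0 ≤ δ)
    (h : EuclideanSpace ℝ (Fin d) → ℝ≥0∞) :
    ∑' m : J, ∫⁻ y in annulus x ((m - 1) * δ) ((m + 1) * δ), h y ≤
      2 * ∫⁻ y in Metric.ball x b, h y := by
  have key : ∀ c : ℝ, c ≤ 1 → ∑' m : J, ∫⁻ y in annulus x ((m + c - 1) * δ) ((m + c) * δ), h y ≤
      ∫⁻ y in Metric.ball x b, h y := by
    intro c hc
    rw [← lintegral_iUnion (s := fun m : J => annulus x ((m + c - 1) * δ) ((m + c) * δ))]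
    · refine lintegral_mono_set (iUnion_subset fun m => sdiff_subset.trans
        (Metric.ball_subset_ball (le_trans ?_ (hJ m m.2))))
      gcongr
    · exact fun m => measurableSet_annulus _ _ _
    · have hkey : ∀ i j : ℕ, i < j → Disjoint (annulus x ((i + c - 1) * δ) ((i + c) * δ))
          (annulus x ((j + c - 1) * δ) ((j + c) * δ)) := fun i j hij => by
        rw [Set.disjoint_left]
        intro y h1 h2
        rw [mem_annulus] at h1 h2
        have h3 : ((i : ℝ) + 1) ≤ j := by exact_mod_cast hij
        have : ((i : ℝ) + c) * δ ≤ (j + c - 1) * δ := by gcongr; linarith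
        linarith [h1.1, h2.2]
      rintro ⟨i, hi⟩ ⟨j, hj⟩ hij
      rcases lt_or_gt_of_ne (fun h => hij (Subtype.ext h)) with h | h
      · exact hkey i j h
      · exact (hkey j i h).symm
  have h1 : ∀ m : J, ∫⁻ y in annulus x ((m - 1) * δ) ((m + 1) * δ), h y ≤
      (∫⁻ y in annulus x ((m + 0 - 1) * δ) ((m + 0) * δ), h y) +
        ∫⁻ y in annulus x ((m + 1 - 1) * δ) ((m + 1) * δ), h y := by
    intro m
    refine le_trans (lintegral_mono_set ?_) (lintegral_union_le _ _ _)
    intro y hy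
    rw [mem_annulus] at hy
    simp only [mem_union, mem_annulus, add_zero, add_sub_cancel_right]
    rcases lt_or_ge (dist y x) (m * δ) with h | h
    · exact Or.inl ⟨h, hy.2⟩
    · exact Or.inr ⟨hy.1, h⟩
  calc _ ≤ _ := ENNReal.tsum_le_tsum h1
    _ ≤ _ := by
      rw [ENNReal.tsum_add, two_mul]
      exact add_le_add (key 0 (by norm_num)) (key 1 le_rfl)

/-- The variation at scale `2 ^ k` of a function with vanishing means over the cubes of side
`2 ^ l`, `l ≤ k`, in terms of its integrals over thin annuli. -/
lemma scaleSup_le_tsum_annulus [NeZero d] {q : ℝ} (hq : 1 ≤ q) {g : EuclideanSpace ℝ (Fin d) → B}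
    (hg : LocallyIntegrable g volume) {k l : ℤ} (hlk : l ≤ k)
    (h0 : ∀ n, ∫ x in dyadicIndex l ⁻¹' {n}, g x = 0) (x : EuclideanSpace ℝ (Fin d)) :
    scaleSup q g k x ≤ (1 + 2 * 2 ^ q) * ∑' m : {m : ℕ | m * (d * (2 : ℝ) ^ l) ≤ 2 ^ (k + 1)},
      ((1 + ENNReal.ofReal ((2 + d : ℝ) ^ d)) * ((ballVol d (2 ^ k))⁻¹ *
        ∫⁻ y in annulus x ((m - 1) * (d * 2 ^ l)) ((m + 1) * (d * 2 ^ l)), ‖g y‖ₑ)) ^ q := by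
  set δ : ℝ := d * 2 ^ l
  set v := ballVol d ((2 : ℝ) ^ k)
  have hv0 : v ≠ 0 := ballVol_ne_zero (two_zpow_pos k)
  have hvt : v ≠ ∞ := ballVol_ne_top _
  have hd1 : (1 : ℝ) ≤ d := by exact_mod_cast Nat.one_le_iff_ne_zero.2 (NeZero.ne d)
  have hδ : 0 < δ := mul_pos (by linarith) (two_zpow_pos l)
  have hδk : δ ≤ d * 2 ^ k := by
    have : (2 : ℝ) ^ l ≤ 2 ^ k := zpow_le_zpow_right₀ one_le_two hlk
    exact mul_le_mul_of_nonneg_left this (by linarith)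
  refine scaleSup_le fun t ht ht0 => ?_
  set D : ℝ≥0∞ := 1 + ENNReal.ofReal ((2 + d : ℝ) ^ d)
  set J : Set ℕ := {m : ℕ | m * δ ≤ 2 ^ (k + 1)}
  set R : ℕ → ℝ≥0∞ := fun m => ∫⁻ y in annulus x ((m - 1) * δ) ((m + 1) * δ), ‖g y‖ₑ
  set a : ℕ → ℝ≥0∞ := J.indicator fun m => D * (v⁻¹ * R m)
  -- Radii are grouped in windows of length δ = d 2^l, a bound for the diameter of the cubes. Jumps
  -- inside one window are bounded by the total variation over an annulus; at a jump between windows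
  -- the two averages are bounded separately. In both cases cancellation leaves only integrals over
  -- thin annuli.
  set m : ℕ → ℕ := fun i => ⌊t i / δ⌋₊
  have hm1 : ∀ i, m i * δ ≤ t i := fun i => by
    rw [← le_div_iff₀ hδ]; exact Nat.floor_le (div_nonneg (ht0 i).le hδ.le)
  have hm2 : ∀ i, t i < (m i + 1) * δ := fun i => by
    rw [← div_lt_iff₀ hδ]; exact Nat.lt_floor_add_one _
  have hmm : Monotone m := fun i j hij => by
    have := ht.monotone hij
    exact Nat.floor_mono (div_le_div_of_nonneg_right this hδ.le)
  have hF : ∀ i, ‖∫ y in Metric.ball x (t i), g y‖ₑ ≤ R (m i) := fun i => by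
    refine (enorm_setIntegral_ball_le hg h0 x (t i)).trans (lintegral_mono_set ?_)
    apply annulus_mono _ (hm2 i).le
    have := hm1 i
    simp only [δ] at this ⊢
    linarith
  have hD : 1 ≤ D := le_self_add
  have hfin : ∑' i : scaleIndices k t, ‖ballAverage g (t (i.1 + 1)) x -
      ballAverage g (t i.1) x‖ₑ ^ q ≤ (1 + 2 * 2 ^ q) * ∑' j, a j ^ q := by
    refine ENNReal.tsum_rpow_le_of_monotone_grouping hq (scaleIndices k t) hmm
      (e := fun i => ‖ballAverage g (t (i + 1)) x - ballAverage g (t i) x‖ₑ) ?_ ?_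
    · intro j
      set I : Set ℕ := {i | i ∈ scaleIndices k t ∧ m i = j ∧ m (i + 1) = j}
      rcases I.eq_empty_or_nonempty with hI | ⟨i₀, hi₀, hi₀', -⟩
      · rw [hI]; simp
      have h1 := le_of_mem_scaleIndices ht hi₀
      have hjJ : (j : ℝ) * δ ≤ 2 ^ (k + 1) := by
        rw [← hi₀']; exact (hm1 i₀).trans ((ht (Nat.lt_succ_self _)).le.trans h1.2)
      have hvol : volume (annulus x ((j - 1) * δ) ((j + 1) * δ)) ≤
          ENNReal.ofReal ((2 + d : ℝ) ^ d) * v := by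
        rw [← ballVol_mul (by positivity) (two_zpow_pos k), ← volume_ball_eq_ballVol x]
        refine measure_mono (sdiff_subset.trans (Metric.ball_subset_ball ?_))
        rw [zpow_add_one₀ two_ne_zero] at hjJ
        nlinarith
      have haj : a j = D * (v⁻¹ * R j) := indicator_of_mem (s := J) hjJ _
      rw [haj]
      refine (tsum_enorm_ballAverage_sub_le hg x (two_zpow_pos k) ht
        (S := annulus x ((j - 1) * δ) ((j + 1) * δ)) (Φ := R j)
        (fun i hi => (le_of_mem_scaleIndices ht hi.1).1) (fun i hi => ?_)
        (fun i hi => hi.2.1 ▸ hF i)).trans ?_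
      · apply annulus_mono
        · have := hm1 i
          rw [hi.2.1] at this
          linarith
        · have := hm2 (i + 1)
          rw [hi.2.2] at this
          exact this.le
      · calc v⁻¹ * R j + v⁻¹ ^ 2 * R j * volume (annulus x ((j - 1) * δ) ((j + 1) * δ))
            ≤ v⁻¹ * R j + v⁻¹ ^ 2 * R j * (ENNReal.ofReal ((2 + d : ℝ) ^ d) * v) := by gcongr
          _ = v⁻¹ * R j + ENNReal.ofReal ((2 + d : ℝ) ^ d) * (v⁻¹ * R j) * (v⁻¹ * v) := by ring
          _ = D * (v⁻¹ * R j) := by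
            rw [ENNReal.inv_mul_cancel hv0 hvt, mul_one, add_mul, one_mul]
    · intro i hi hne
      have h1 := le_of_mem_scaleIndices ht hi
      have hlt := (ht (Nat.lt_succ_self i)).le
      have hav : ∀ i', 2 ^ k ≤ t i' → t i' ≤ 2 ^ (k + 1) →
          ‖ballAverage g (t i') x‖ₑ ≤ a (m i') := fun i' h2 h3 => by
        have : a (m i') = D * (v⁻¹ * R (m i')) :=
          indicator_of_mem (s := J) (show (m i' : ℝ) * δ ≤ _ from (hm1 i').trans h3) _
        rw [this]
        refine (enorm_ballAverage_le (two_zpow_pos k) h2 x).trans ?_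
        calc v⁻¹ * ‖∫ y in Metric.ball x (t i'), g y‖ₑ ≤ 1 * (v⁻¹ * R (m i')) := by
              rw [one_mul]; gcongr; exact hF i'
          _ ≤ _ := by gcongr
      refine enorm_sub_le.trans ?_
      rw [add_comm]
      exact add_le_add (hav i h1.1 (hlt.trans h1.2)) (hav (i + 1) (h1.1.trans hlt) h1.2)
  refine hfin.trans_eq ?_
  congr 1
  rw [tsum_subtype (s := J) (f := fun m : ℕ => (D * (v⁻¹ * R m)) ^ q)]
  congr 1 with j
  by_cases hj : j ∈ J
  · simp only [a, indicator_of_mem hj]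
  · simp only [a, indicator_of_notMem hj]
    exact ENNReal.zero_rpow_of_pos (by linarith)

end SmallScale

/-! ### Almost orthogonality: decay away from the diagonal -/

section ScaleEstimates

variable {d : ℕ} {B : Type*} [NormedAddCommGroup B] [NormedSpace ℝ B]

/-- The widened annulus has thickness 4 d 2^l and radius at most a multiple of 2^(l+n), so it
occupies a fraction of order 2^(-n) of the ball. All decay in n comes from here. -/
lemma volume_annulus_dyadic_le [NeZero d] (x : EuclideanSpace ℝ (Fin d)) (l : ℤ) (n : ℕ) {m : ℕ}
    (hm : m * (d * (2 : ℝ) ^ l) ≤ 2 ^ (l + n + 1)) :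
    volume (annulus x ((m - 1) * (d * 2 ^ l) - d * 2 ^ l) ((m + 1) * (d * 2 ^ l) + d * 2 ^ l)) ≤
      ENNReal.ofReal (4 * d ^ 2 * (2 + 2 * d) ^ (d - 1)) * (2⁻¹ ^ n * ballVol d (2 ^ (l + n))) := by
  have hd : 1 ≤ d := Nat.one_le_iff_ne_zero.2 (NeZero.ne d)
  have hl := two_zpow_pos l
  have hn : (1 : ℝ) ≤ 2 ^ n := one_le_pow₀ one_le_two
  have e1 : (2 : ℝ) ^ (l + n) = 2 ^ l * 2 ^ n := by
    rw [zpow_add₀ two_ne_zero, zpow_natCast]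
  have e2 : (2 : ℝ) ^ (l + n + 1) = 2 * 2 ^ (l + n) := by
    rw [zpow_add_one₀ two_ne_zero, mul_comm]
  have hle : (2 : ℝ) ^ l ≤ 2 ^ (l + n) := by rw [e1]; nlinarith
  have hδ : (d : ℝ) * 2 ^ l ≤ d * 2 ^ (l + n) := by gcongr
  have hδ0 : 0 ≤ (d : ℝ) * 2 ^ l := by positivity
  refine (volume_annulus_le x (β := (2 + 2 * d) * 2 ^ (l + n)) ?_ ?_ (by positivity)).trans_eq ?_
  · linarith
  · rw [e2] at hm
    linarith
  · have e3 : (2⁻¹ : ℝ≥0∞) ^ n = ENNReal.ofReal ((2⁻¹ : ℝ) ^ n) := by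
      rw [ENNReal.ofReal_pow (by positivity), ENNReal.ofReal_inv_of_pos two_pos]
      simp
    rw [ballVol_eq (two_zpow_pos (l + n)), e3, ← mul_assoc (ENNReal.ofReal ((2⁻¹ : ℝ) ^ n)),
      ← ENNReal.ofReal_mul (by positivity),
      ← mul_assoc (ENNReal.ofReal _) (ENNReal.ofReal _) (ballVol d 1), ← ENNReal.ofReal_mul (by positivity)]
    congr 2
    obtain ⟨d', rfl⟩ : ∃ d', d = d' + 1 := ⟨d - 1, by omega⟩
    simp only [Nat.add_sub_cancel, mul_pow, pow_succ, e1, inv_pow]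
    field_simp
    ring

/-- Decay of the variation at scale `2 ^ (l + n)` of functions with vanishing means over the cubes
of side `2 ^ l`. -/
lemma exists_lintegral_scaleSup_le_of_mean_zero (d : ℕ) [NeZero d] {q : ℝ} (hq : 2 ≤ q) :
    ∃ C : ℝ≥0∞, C ≠ ∞ ∧ ∀ (g : EuclideanSpace ℝ (Fin d) → B), LocallyIntegrable g volume →
      ∀ (l : ℤ) (n : ℕ), (∀ j, ∫ x in dyadicIndex l ⁻¹' {j}, g x = 0) →
      ∀ h : EuclideanSpace ℝ (Fin d) → ℝ≥0∞, AEMeasurable h volume →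
      (∀ x a b, (∫⁻ y in annulus x a b, ‖g y‖ₑ) ^ q ≤
        volume (annulus x (a - d * 2 ^ l) (b + d * 2 ^ l)) ^ (q - 1) *
          ∫⁻ y in annulus x a b, h y) →
      ∫⁻ x, scaleSup q g (l + n) x ≤ C * 2⁻¹ ^ n * ∫⁻ x, h x := by
  set D : ℝ≥0∞ := 1 + ENNReal.ofReal ((2 + d : ℝ) ^ d)
  set E : ℝ≥0∞ := ENNReal.ofReal (4 * d ^ 2 * (2 + 2 * d) ^ (d - 1))
  set G : ℝ≥0∞ := ENNReal.ofReal ((2 + d : ℝ) ^ d)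
  refine ⟨(1 + 2 * 2 ^ q) * (D ^ q * (E ^ (q - 1) * (2 * G))), ?_, ?_⟩
  · have : (2 : ℝ≥0∞) ^ q ≠ ∞ := ENNReal.rpow_ne_top_of_nonneg (by linarith) (by simp)
    have : D ^ q ≠ ∞ := ENNReal.rpow_ne_top_of_nonneg (by linarith) (by simp [D])
    have : E ^ (q - 1) ≠ ∞ := ENNReal.rpow_ne_top_of_nonneg (by linarith) ENNReal.ofReal_ne_top
    have : G ≠ ∞ := by simp [G]
    finiteness
  -- The majorant `h` is left open because it is used twice: as ‖g‖^q for martingale differences,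
  -- and as a multiple of ‖g‖ for the bad parts, where only L^1 control is available.
  intro g hg l n h0 h hh Hh
  set v := ballVol d ((2 : ℝ) ^ (l + n))
  have hv0 : v ≠ 0 := ballVol_ne_zero (two_zpow_pos _)
  have hvt : v ≠ ∞ := ballVol_ne_top _
  set c : ℝ≥0∞ := (1 + 2 * 2 ^ q) * (D ^ q * (E ^ (q - 1) * 2))
  have hpt : ∀ x, scaleSup q g (l + n) x ≤
      c * 2⁻¹ ^ n * v⁻¹ * ∫⁻ y in Metric.ball x ((2 + d) * 2 ^ (l + n)), h y := by
    intro x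
    refine (scaleSup_le_tsum_annulus (by linarith) hg (by omega) h0 x).trans ?_
    have hterm : ∀ m : {m : ℕ | m * (d * (2 : ℝ) ^ l) ≤ 2 ^ (l + n + 1)},
        (D * (v⁻¹ * ∫⁻ y in annulus x ((m - 1) * (d * 2 ^ l)) ((m + 1) * (d * 2 ^ l)),
          ‖g y‖ₑ)) ^ q ≤ D ^ q * (E ^ (q - 1) * (2⁻¹ ^ n * (v⁻¹ *
          ∫⁻ y in annulus x ((m - 1) * (d * 2 ^ l)) ((m + 1) * (d * 2 ^ l)), h y))) := by
      intro m
      rw [ENNReal.mul_rpow_of_nonneg _ _ (by linarith),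
        ENNReal.mul_rpow_of_nonneg _ _ (by linarith)]
      gcongr D ^ q * ?_
      refine (mul_le_mul_right (Hh x _ _) _).trans ?_
      -- Here q ≥ 2 is used: the volume factor enters with exponent q - 1, and q - 1 ≥ 1 preserves
      -- the full decay 2^(-n).
      have hp : ((2⁻¹ : ℝ≥0∞) ^ n) ^ (q - 1) ≤ 2⁻¹ ^ n := by
        conv_rhs => rw [← ENNReal.rpow_one (2⁻¹ ^ n)]
        exact ENNReal.rpow_le_rpow_of_exponent_ge
          (pow_le_one₀ zero_le (by simp)) (by linarith)
      calc v⁻¹ ^ q * (volume (annulus x ((m - 1) * (d * 2 ^ l) - d * 2 ^ l)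
            ((m + 1) * (d * 2 ^ l) + d * 2 ^ l)) ^ (q - 1) *
            ∫⁻ y in annulus x ((m - 1) * (d * 2 ^ l)) ((m + 1) * (d * 2 ^ l)), h y)
          ≤ v⁻¹ ^ q * ((E * (2⁻¹ ^ n * v)) ^ (q - 1) *
            ∫⁻ y in annulus x ((m - 1) * (d * 2 ^ l)) ((m + 1) * (d * 2 ^ l)), h y) := by
            gcongr
            · linarith
            · exact volume_annulus_dyadic_le x l n m.2
        _ = E ^ (q - 1) * ((2⁻¹ ^ n) ^ (q - 1) * ((v⁻¹ ^ q * v ^ (q - 1)) *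
            ∫⁻ y in annulus x ((m - 1) * (d * 2 ^ l)) ((m + 1) * (d * 2 ^ l)), h y)) := by
            rw [ENNReal.mul_rpow_of_nonneg _ _ (by linarith),
              ENNReal.mul_rpow_of_nonneg _ _ (by linarith)]
            ring
        _ ≤ _ := by
            rw [ENNReal.inv_rpow, ← ENNReal.rpow_neg, ← ENNReal.rpow_add _ _ hv0 hvt,
              show -q + (q - 1) = -1 by ring, ENNReal.rpow_neg_one]
            gcongr
    refine (mul_le_mul_right (ENNReal.tsum_le_tsum hterm) _).trans ?_
    simp only [ENNReal.tsum_mul_left]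
    have hδ0 : 0 ≤ (d : ℝ) * 2 ^ l := by positivity
    have := tsum_lintegral_annulus_le x (J := {m : ℕ | m * (d * (2 : ℝ) ^ l) ≤ 2 ^ (l + n + 1)})
      (b := (2 + d) * 2 ^ (l + n)) (δ := d * 2 ^ l) (fun m hm => ?_) hδ0 h
    · calc (1 + 2 * 2 ^ q) * (D ^ q * (E ^ (q - 1) * (2⁻¹ ^ n * (v⁻¹ *
          ∑' m : {m : ℕ | m * (d * (2 : ℝ) ^ l) ≤ 2 ^ (l + n + 1)},
            ∫⁻ y in annulus x ((m - 1) * (d * 2 ^ l)) ((m + 1) * (d * 2 ^ l)), h y))))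
          ≤ (1 + 2 * 2 ^ q) * (D ^ q * (E ^ (q - 1) * (2⁻¹ ^ n * (v⁻¹ *
            (2 * ∫⁻ y in Metric.ball x ((2 + d) * 2 ^ (l + n)), h y))))) := by gcongr
        _ = _ := by simp only [c]; ring
    · have hm' : m * (d * (2 : ℝ) ^ l) ≤ 2 ^ (l + n + 1) := hm
      have hle : (2 : ℝ) ^ l ≤ 2 ^ (l + n) := zpow_le_zpow_right₀ one_le_two (by omega)
      rw [zpow_add_one₀ two_ne_zero] at hm'
      have : (d : ℝ) * 2 ^ l ≤ d * 2 ^ (l + n) := by gcongr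
      linarith
  calc ∫⁻ x, scaleSup q g (l + n) x
      ≤ ∫⁻ x, c * 2⁻¹ ^ n * v⁻¹ * ∫⁻ y in Metric.ball x ((2 + d) * 2 ^ (l + n)), h y :=
        lintegral_mono hpt
    _ = c * 2⁻¹ ^ n * v⁻¹ * (ballVol d ((2 + d) * 2 ^ (l + n)) * ∫⁻ x, h x) := by
        rw [lintegral_const_mul', lintegral_lintegral_ball hh]
        have : c ≠ ∞ := by
          have : (2 : ℝ≥0∞) ^ q ≠ ∞ := ENNReal.rpow_ne_top_of_nonneg (by linarith) (by simp)
          have : D ^ q ≠ ∞ := ENNReal.rpow_ne_top_of_nonneg (by linarith) (by simp [D])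
          have : E ^ (q - 1) ≠ ∞ := ENNReal.rpow_ne_top_of_nonneg (by linarith) ENNReal.ofReal_ne_top
          finiteness
        have : (2⁻¹ : ℝ≥0∞) ^ n ≠ ∞ := by simp
        finiteness
    _ = (1 + 2 * 2 ^ q) * (D ^ q * (E ^ (q - 1) * (2 * G))) * 2⁻¹ ^ n * (v⁻¹ * v) *
          ∫⁻ x, h x := by
        rw [ballVol_mul (by positivity) (two_zpow_pos _)]
        simp only [c]
        ring
    _ = _ := by rw [ENNReal.inv_mul_cancel hv0 hvt, mul_one]

/-- The L^q choice of majorant in `exists_lintegral_scaleSup_le_of_mean_zero`, by Jensen's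
inequality; the widening of the annulus is not needed for it. -/
lemma lintegral_annulus_rpow_le {q : ℝ} (hq : 1 ≤ q) {g : EuclideanSpace ℝ (Fin d) → B}
    (hg : AEStronglyMeasurable g volume) (l : ℤ) (x : EuclideanSpace ℝ (Fin d)) (a b : ℝ) :
    (∫⁻ y in annulus x a b, ‖g y‖ₑ) ^ q ≤
      volume (annulus x (a - d * 2 ^ l) (b + d * 2 ^ l)) ^ (q - 1) *
        ∫⁻ y in annulus x a b, ‖g y‖ₑ ^ q := by
  refine (lintegral_rpow_le_measure_rpow_mul _ hq hg.enorm.restrict).trans ?_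
  rw [Measure.restrict_apply_univ]
  gcongr
  exact annulus_mono (by simp; positivity) (by simp; positivity)

/-- The L^1 choice of majorant. The cubes of side 2^l meeting the annulus lie in the widened
annulus, and each has mean at most c, so the integral is at most c times that volume. This is
applied to q - 1 of the q factors. -/
lemma lintegral_annulus_rpow_le_of_dyadic {q : ℝ} (hq : 1 ≤ q)
    {g : EuclideanSpace ℝ (Fin d) → B} {l : ℤ} {c : ℝ≥0∞}
    (hc : ∀ x, dyadicLAvg (fun y => ‖g y‖ₑ) l x ≤ c) (x : EuclideanSpace ℝ (Fin d)) (a b : ℝ) :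
    (∫⁻ y in annulus x a b, ‖g y‖ₑ) ^ q ≤
      volume (annulus x (a - d * 2 ^ l) (b + d * 2 ^ l)) ^ (q - 1) *
        ∫⁻ y in annulus x a b, c ^ (q - 1) * ‖g y‖ₑ := by
  obtain ⟨A, hA1, hA2⟩ := exists_saturation l (annulus x a b)
  have hsub : dyadicIndex l ⁻¹' A ⊆ annulus x (a - d * 2 ^ l) (b + d * 2 ^ l) := by
    intro y hy
    obtain ⟨z, hz, hyz⟩ := hA2 y hy
    rw [mem_annulus] at hz ⊢
    have h1 := dist_triangle y z x
    have h2 := dist_triangle z y x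
    rw [dist_comm z y] at h2
    constructor <;> linarith
  have h1 : ∫⁻ y in annulus x a b, ‖g y‖ₑ ≤
      c * volume (annulus x (a - d * 2 ^ l) (b + d * 2 ^ l)) :=
    calc ∫⁻ y in annulus x a b, ‖g y‖ₑ ≤ ∫⁻ y in dyadicIndex l ⁻¹' A, ‖g y‖ₑ :=
          lintegral_mono_set hA1
      _ = ∫⁻ y in dyadicIndex l ⁻¹' A, dyadicLAvg (fun y => ‖g y‖ₑ) l y :=
          (setLIntegral_dyadicLAvg _ l A).symm
      _ ≤ ∫⁻ y in dyadicIndex l ⁻¹' A, c := lintegral_mono hc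
      _ = c * volume (dyadicIndex l ⁻¹' A) := setLIntegral_const _ _
      _ ≤ _ := by gcongr
  have h2 : c ^ (q - 1) * ∫⁻ y in annulus x a b, ‖g y‖ₑ ≤
      ∫⁻ y in annulus x a b, c ^ (q - 1) * ‖g y‖ₑ := lintegral_const_mul_le _ _
  calc (∫⁻ y in annulus x a b, ‖g y‖ₑ) ^ q
      = (∫⁻ y in annulus x a b, ‖g y‖ₑ) ^ (q - 1) * ∫⁻ y in annulus x a b, ‖g y‖ₑ := by
        conv_rhs => rw [← ENNReal.rpow_one (∫⁻ y in annulus x a b, ‖g y‖ₑ)]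
        rw [ENNReal.rpow_one, ← ENNReal.rpow_one (∫⁻ y in annulus x a b, ‖g y‖ₑ),
          ← ENNReal.rpow_mul, ← ENNReal.rpow_mul, ← ENNReal.rpow_add_of_nonneg _ _ (by linarith)
          zero_le_one]
        simp
    _ ≤ (c * volume (annulus x (a - d * 2 ^ l) (b + d * 2 ^ l))) ^ (q - 1) *
          ∫⁻ y in annulus x a b, ‖g y‖ₑ := by
        gcongr
    _ = volume (annulus x (a - d * 2 ^ l) (b + d * 2 ^ l)) ^ (q - 1) *
          (c ^ (q - 1) * ∫⁻ y in annulus x a b, ‖g y‖ₑ) := by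
        rw [ENNReal.mul_rpow_of_nonneg _ _ (by linarith)]; ring
    _ ≤ _ := by gcongr

/-! ### Functions constant on large cubes -/

/-- The points within `2 ^ k` (in some coordinate) of the boundary of a cube of side `2 ^ j`. -/
def dyadicBoundary (d : ℕ) (j : ℤ) (r : ℝ) : Set (EuclideanSpace ℝ (Fin d)) :=
  {y | ∃ i, y i ∈ Ico (⌊y i / 2 ^ j⌋ * (2 : ℝ) ^ j) (⌊y i / 2 ^ j⌋ * (2 : ℝ) ^ j + r) ∨
    y i ∈ Ico ((⌊y i / 2 ^ j⌋ + 1) * (2 : ℝ) ^ j - r) ((⌊y i / 2 ^ j⌋ + 1) * (2 : ℝ) ^ j)}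

/-- Some coordinate has different indices for y and z, so a face of the cube of y separates them in
that coordinate, at distance less than r from y. -/
lemma mem_dyadicBoundary {j : ℤ} {r : ℝ} {y z : EuclideanSpace ℝ (Fin d)} (hyz : dist y z < r)
    (h : dyadicIndex j y ≠ dyadicIndex j z) : y ∈ dyadicBoundary d j r := by
  obtain ⟨i, hi⟩ := Function.ne_iff.1 h
  refine ⟨i, ?_⟩
  have h2 := two_zpow_pos j
  have hd := (EuclideanSpace.abs_coord_sub_le_dist y z i).trans_lt hyz
  rw [abs_lt] at hd
  have hy1 : ⌊y i / 2 ^ j⌋ * (2 : ℝ) ^ j ≤ y i := by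
    rw [← le_div_iff₀ h2]; exact Int.floor_le _
  have hy2 : y i < (⌊y i / 2 ^ j⌋ + 1) * (2 : ℝ) ^ j := by
    rw [← div_lt_iff₀ h2]; exact Int.lt_floor_add_one _
  have hz1 : ⌊z i / 2 ^ j⌋ * (2 : ℝ) ^ j ≤ z i := by
    rw [← le_div_iff₀ h2]; exact Int.floor_le _
  have hz2 : z i < (⌊z i / 2 ^ j⌋ + 1) * (2 : ℝ) ^ j := by
    rw [← div_lt_iff₀ h2]; exact Int.lt_floor_add_one _
  rcases lt_or_gt_of_ne hi with hlt | hlt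
  · right
    have : ((⌊y i / 2 ^ j⌋ : ℝ) + 1) ≤ ⌊z i / 2 ^ j⌋ := by exact_mod_cast hlt
    have : ((⌊y i / 2 ^ j⌋ : ℝ) + 1) * 2 ^ j ≤ ⌊z i / 2 ^ j⌋ * 2 ^ j := by gcongr
    constructor <;> linarith
  · left
    have : ((⌊z i / 2 ^ j⌋ : ℝ) + 1) ≤ ⌊y i / 2 ^ j⌋ := by exact_mod_cast hlt
    have : ((⌊z i / 2 ^ j⌋ : ℝ) + 1) * 2 ^ j ≤ ⌊y i / 2 ^ j⌋ * 2 ^ j := by gcongr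
    constructor <;> linarith

lemma measurableSet_dyadicBoundary (j : ℤ) (r : ℝ) : MeasurableSet (dyadicBoundary d j r) := by
  have hf : ∀ i : Fin d, Measurable fun y : EuclideanSpace ℝ (Fin d) =>
      ((⌊y i / (2 : ℝ) ^ j⌋ : ℤ) : ℝ) := fun i => by
    have : Measurable fun x : EuclideanSpace ℝ (Fin d) => x i / (2 : ℝ) ^ j := by fun_prop
    exact (measurable_from_top (f := fun n : ℤ => (n : ℝ))).comp this.floor
  have hc : ∀ i : Fin d, Measurable fun y : EuclideanSpace ℝ (Fin d) => y i := fun i => by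
    fun_prop
  rw [dyadicBoundary, ofPred_exists]
  refine MeasurableSet.iUnion fun i => ?_
  have h1 := hf i
  have h2 := hc i
  refine MeasurableSet.union (MeasurableSet.inter ?_ ?_) (MeasurableSet.inter ?_ ?_)
  · exact measurableSet_le (h1.mul_const _) h2
  · exact measurableSet_lt h2 ((h1.mul_const _).add_const _)
  · exact measurableSet_le (((h1.add_const _).mul_const _).sub_const _) h2
  · exact measurableSet_lt h2 ((h1.add_const _).mul_const _)

lemma volume_dyadicSlab (j : ℤ) (n : Fin d → ℤ) (i : Fin d) (a r : ℝ) (hr : 0 ≤ r) :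
    volume {y : EuclideanSpace ℝ (Fin d) | dyadicIndex j y = n ∧ y i ∈ Ico a (a + r)} ≤
      ENNReal.ofReal (r / 2 ^ j) * dyadicVol d j := by
  have h2 := two_zpow_pos j
  have hsub : {y : EuclideanSpace ℝ (Fin d) | dyadicIndex j y = n ∧ y i ∈ Ico a (a + r)} ⊆
      {y | ∀ i', y i' ∈ Function.update
        (fun i' => Ico (n i' * (2 : ℝ) ^ j) ((n i' + 1) * 2 ^ j)) i (Ico a (a + r)) i'} := by
    rintro y ⟨hy1, hy2⟩ i'
    rw [dyadicIndex_eq_iff] at hy1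
    rcases eq_or_ne i' i with rfl | h
    · simpa using hy2
    · rw [Function.update_of_ne h]; exact hy1 i'
  refine (measure_mono hsub).trans ?_
  rw [EuclideanSpace.volume_setOf_forall_mem, ← Finset.mul_prod_erase _ _ (Finset.mem_univ i)]
  · rw [Function.update_self, Real.volume_Ico, Finset.prod_congr rfl
      (g := fun _ => ENNReal.ofReal (2 ^ j))]
    · rw [Finset.prod_const, Finset.card_erase_of_mem (Finset.mem_univ i), Finset.card_fin,
        ← ENNReal.ofReal_pow (by positivity), dyadicVol, ← ENNReal.ofReal_mul (by linarith),
        ← ENNReal.ofReal_mul (by positivity)]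
      refine ENNReal.ofReal_le_ofReal (le_of_eq ?_)
      obtain ⟨d', rfl⟩ : ∃ d', d = d' + 1 := ⟨d - 1, by have := i.pos; omega⟩
      rw [Nat.add_sub_cancel, pow_succ]
      field_simp
      ring
    · intro i' hi'
      rw [Function.update_of_ne (Finset.ne_of_mem_erase hi'), Real.volume_Ico]
      congr 1
      ring
  · intro i'
    rcases eq_or_ne i' i with rfl | h
    · simp
    · rw [Function.update_of_ne h]; exact measurableSet_Ico

lemma volume_dyadicBoundary_inter_le (j : ℤ) {r : ℝ} (hr : 0 ≤ r) (n : Fin d → ℤ) :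
    volume (dyadicBoundary d j r ∩ dyadicIndex j ⁻¹' {n}) ≤
      2 * d * ENNReal.ofReal (r / 2 ^ j) * dyadicVol d j := by
  have hsub : dyadicBoundary d j r ∩ dyadicIndex j ⁻¹' {n} ⊆
      ⋃ i : Fin d, ({y | dyadicIndex j y = n ∧ y i ∈ Ico (n i * (2 : ℝ) ^ j)
          (n i * (2 : ℝ) ^ j + r)} ∪
        {y | dyadicIndex j y = n ∧ y i ∈ Ico ((n i + 1) * (2 : ℝ) ^ j - r)
          ((n i + 1) * (2 : ℝ) ^ j - r + r)}) := by
    rintro y ⟨⟨i, hi⟩, hy⟩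
    have hy' : dyadicIndex j y = n := hy
    refine mem_iUnion.2 ⟨i, ?_⟩
    have : ⌊y i / 2 ^ j⌋ = n i := congrFun hy' i
    rw [this] at hi
    rcases hi with hi | hi
    · exact Or.inl ⟨hy', hi⟩
    · exact Or.inr ⟨hy', by rwa [sub_add_cancel]⟩
  refine (measure_mono hsub).trans ((measure_iUnion_le _).trans ?_)
  rw [tsum_fintype]
  refine (Finset.sum_le_sum fun i _ => (measure_union_le _ _).trans
    (add_le_add (volume_dyadicSlab j n i _ r hr) (volume_dyadicSlab j n i _ r hr))).trans_eq ?_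
  rw [Finset.sum_const, Finset.card_fin, nsmul_eq_mul]
  ring

/-- As h is constant on each cube, its integral over the layer is its integral over the cube times
the fraction of volume in the layer. -/
lemma setLIntegral_dyadicBoundary_le {j : ℤ} {r : ℝ} (hr : 0 ≤ r)
    {h : EuclideanSpace ℝ (Fin d) → ℝ≥0∞}
    (hc : ∀ x y, dyadicIndex j x = dyadicIndex j y → h x = h y) :
    ∫⁻ y in dyadicBoundary d j r, h y ≤ 2 * d * ENNReal.ofReal (r / 2 ^ j) * ∫⁻ y, h y := by
  have hm := measurableSet_dyadicBoundary (d := d) j r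
  rw [← lintegral_indicator hm, lintegral_eq_tsum_dyadicCube j,
    lintegral_eq_tsum_dyadicCube j h, ← ENNReal.tsum_mul_left]
  refine ENNReal.tsum_le_tsum fun n => ?_
  obtain ⟨z, hz⟩ := dyadicCube_nonempty j n
  rw [setLIntegral_indicator hm, setLIntegral_congr_dyadicCube (c := h z)
    fun x hx => hc x z (hx.trans hz.symm), setLIntegral_congr_fun
      (hm.inter (measurableSet_dyadicIndex j _)) (g := fun _ => h z), setLIntegral_const]
  · calc h z * volume (dyadicBoundary d j r ∩ dyadicIndex j ⁻¹' {n})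
        ≤ h z * (2 * d * ENNReal.ofReal (r / 2 ^ j) * dyadicVol d j) := by
          gcongr; exact volume_dyadicBoundary_inter_le j hr n
      _ = _ := by ring
  · intro x hx
    have hx' : dyadicIndex j x = n := hx.2
    exact hc x z (hx'.trans hz.symm)

/-- Decay of the variation at scale `2 ^ k` of functions that are constant on the cubes of side
`2 ^ (k + n)`. -/
lemma exists_lintegral_scaleSup_le_of_const (d : ℕ) [CompleteSpace B] {q : ℝ} (hq : 1 ≤ q) :
    ∃ C : ℝ≥0∞, C ≠ ∞ ∧ ∀ (g : EuclideanSpace ℝ (Fin d) → B), LocallyIntegrable g volume →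
      ∀ (k : ℤ) (n : ℕ), (∀ x y, dyadicIndex (k + n) x = dyadicIndex (k + n) y → g x = g y) →
      ∫⁻ x, scaleSup q g k x ≤ C * 2⁻¹ ^ n * ∫⁻ x, ‖g x‖ₑ ^ q := by
  obtain ⟨C, hC, h⟩ := exists_scaleSup_le_lintegral_rpow (B := B) d hq
  refine ⟨C * (2 ^ d * (2 * d * 4)), by finiteness, fun g hg k n hconst => ?_⟩
  -- The width is the diameter of the balls of radius 2^(k+1). If such a ball lies in one cube, g is
  -- constant on it and the variation vanishes; otherwise each of its points has a point of another
  -- cube within 2^(k+2), so the whole ball lies in T.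
  set T := dyadicBoundary d (k + n) (2 ^ (k + 2))
  have hT : MeasurableSet T := measurableSet_dyadicBoundary _ _
  set v := ballVol d ((2 : ℝ) ^ k)
  have hv0 : v ≠ 0 := ballVol_ne_zero (two_zpow_pos _)
  have hvt : v ≠ ∞ := ballVol_ne_top _
  have e2 : (2 : ℝ) ^ (k + 2) = 2 ^ (k + 1) + 2 ^ (k + 1) := by
    rw [show k + 2 = k + 1 + 1 by ring, zpow_add_one₀ two_ne_zero (k + 1)]; ring
  have hmeas : AEMeasurable (T.indicator fun y => ‖g y‖ₑ ^ q) volume :=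
    (hg.aestronglyMeasurable.enorm.pow_const q).indicator hT
  have hpt : ∀ x, scaleSup q g k x ≤ C * v⁻¹ *
      ∫⁻ y in Metric.ball x (2 ^ (k + 1)), T.indicator (fun y => ‖g y‖ₑ ^ q) y := by
    intro x
    by_cases hx : ∀ y ∈ Metric.ball x ((2 : ℝ) ^ (k + 1)),
        dyadicIndex (k + n) y = dyadicIndex (k + n) x
    · rw [scaleSup_congr q (g := fun _ => g x) fun y hy => hconst _ _ (hx y hy),
        scaleSup_const (by linarith)]
      exact zero_le
    · push Not at hx
      obtain ⟨z, hz, hzx⟩ := hx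
      refine (h g hg k x).trans_eq ?_
      rw [mul_assoc]
      congr 2
      refine setLIntegral_congr_fun measurableSet_ball fun y hy => ?_
      have hyT : y ∈ T := by
        rw [Metric.mem_ball] at hy hz
        by_cases hyx : dyadicIndex (k + n) y = dyadicIndex (k + n) x
        · refine mem_dyadicBoundary (z := z) ?_ (fun h => hzx (h.symm.trans hyx))
          rw [e2]
          linarith [dist_triangle_right y z x]
        · refine mem_dyadicBoundary (z := x) ?_ hyx
          have := two_zpow_pos (k + 1)
          linarith
      simp only [indicator_of_mem hyT]
  calc ∫⁻ x, scaleSup q g k x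
      ≤ ∫⁻ x, C * v⁻¹ * ∫⁻ y in Metric.ball x (2 ^ (k + 1)),
          T.indicator (fun y => ‖g y‖ₑ ^ q) y := lintegral_mono hpt
    _ = C * v⁻¹ * (ballVol d (2 * 2 ^ k) * ∫⁻ y in T, ‖g y‖ₑ ^ q) := by
        rw [lintegral_const_mul' _ _ (by finiteness), lintegral_lintegral_ball hmeas,
          lintegral_indicator hT, zpow_add_one₀ two_ne_zero, mul_comm (2 ^ k) (2 : ℝ)]
    _ ≤ C * v⁻¹ * (ballVol d (2 * 2 ^ k) * (2 * d * ENNReal.ofReal (2 ^ (k + 2) / 2 ^ (k + n)) *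
          ∫⁻ y, ‖g y‖ₑ ^ q)) := by
        gcongr
        exact setLIntegral_dyadicBoundary_le (by positivity) fun x y hxy => by rw [hconst x y hxy]
    _ = C * (2 ^ d * (2 * d * 4)) * 2⁻¹ ^ n * (v⁻¹ * v) * ∫⁻ y, ‖g y‖ₑ ^ q := by
        have e3 : ENNReal.ofReal ((2 : ℝ) ^ (k + 2) / 2 ^ (k + n)) = 4 * 2⁻¹ ^ n := by
          rw [zpow_add₀ two_ne_zero, zpow_add₀ two_ne_zero, mul_div_mul_left _ _ (by positivity),
            ENNReal.ofReal_div_of_pos (by positivity), zpow_natCast,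
            ENNReal.ofReal_pow (by positivity), div_eq_mul_inv, ENNReal.inv_pow]
          norm_num
        rw [e3, ballVol_mul two_pos (two_zpow_pos k), ENNReal.ofReal_pow (by positivity)]
        simp only [ENNReal.ofReal_ofNat]
        ring
    _ = _ := by rw [ENNReal.inv_mul_cancel hv0 hvt, mul_one]

end ScaleEstimates

/-! ### Martingale cotype on the dyadic filtration -/

section Cotype

variable {d : ℕ} {B : Type*} [NormedAddCommGroup B] [NormedSpace ℝ B] [CompleteSpace B]

/-- The filtration generated by the dyadic cubes of side `2 ^ (M - i)`, `i = 0, 1, …`. -/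
noncomputable def dyadicFiltration (d : ℕ) (M : ℤ) :
    Filtration ℕ (inferInstance : MeasurableSpace (EuclideanSpace ℝ (Fin d))) where
  seq i := MeasurableSpace.comap (dyadicIndex (M - i)) ⊤
  mono' := by
    intro i j hij s hs
    obtain ⟨A, -, rfl⟩ := hs
    refine ⟨dyadicIndex (M - j) '' (dyadicIndex (M - i) ⁻¹' A), trivial, ?_⟩
    refine Subset.antisymm ?_ (subset_preimage_image _ _)
    rintro y ⟨x, hx, hxy⟩
    have : dyadicIndex (M - i) x = dyadicIndex (M - i) y :=
      dyadicIndex_eq_of_le (by omega) hxy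
    rw [mem_preimage] at hx ⊢
    rwa [← this]
  le' i := by
    rintro s ⟨A, -, rfl⟩
    exact measurableSet_dyadicIndex _ A

lemma isProbabilityMeasure_dyadicCube (M : ℤ) (n : Fin d → ℤ) :
    IsProbabilityMeasure ((dyadicVol d M)⁻¹ • volume.restrict (dyadicIndex (d := d) M ⁻¹' {n})) :=
  ⟨by rw [Measure.smul_apply, Measure.restrict_apply_univ, volume_dyadicCube, smul_eq_mul,
    ENNReal.inv_mul_cancel (dyadicVol_ne_zero M) (dyadicVol_ne_top M)]⟩

/-- A top cube of side 2^M carries a probability measure. Sets of the i-th σ-algebra inside it are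
bounded unions of cubes of side 2^(M-i), over which f and its average have equal integrals. -/
lemma dyadicAvg_ae_eq_condExp {f : EuclideanSpace ℝ (Fin d) → B} (hf : LocallyIntegrable f volume)
    (M : ℤ) (n : Fin d → ℤ) (i : ℕ) :
    dyadicAvg f (M - i) =ᵐ[(dyadicVol d M)⁻¹ • volume.restrict (dyadicIndex M ⁻¹' {n})]
      ((dyadicVol d M)⁻¹ • volume.restrict (dyadicIndex M ⁻¹' {n}))[f | dyadicFiltration d M i] := by
  have := isProbabilityMeasure_dyadicCube M n
  have hvi : (dyadicVol d M)⁻¹ ≠ ∞ := ENNReal.inv_ne_top.2 (dyadicVol_ne_zero M)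
  have hint : ∀ g : EuclideanSpace ℝ (Fin d) → B, LocallyIntegrable g volume →
      Integrable g ((dyadicVol d M)⁻¹ • volume.restrict (dyadicIndex M ⁻¹' {n})) := fun g hg =>
    Integrable.smul_measure (hg.integrableOn_isBounded (isBounded_dyadicCube M n)) hvi
  refine ae_eq_condExp_of_forall_setIntegral_eq ((dyadicFiltration d M).le i) (hint f hf)
    (fun s _ _ => (hint _ (locallyIntegrable_dyadicAvg hf _)).integrableOn) ?_ ?_
  · rintro s ⟨A, -, rfl⟩ -
    rw [Measure.restrict_smul, Measure.restrict_restrict (measurableSet_dyadicIndex _ A),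
      integral_smul_measure, integral_smul_measure]
    congr 1
    set A' : Set (Fin d → ℤ) := A ∩ dyadicIndex (M - i) '' (dyadicIndex M ⁻¹' {n})
    have hA' : dyadicIndex (M - i) ⁻¹' A ∩ dyadicIndex M ⁻¹' {n} = dyadicIndex (M - i) ⁻¹' A' := by
      ext y
      refine ⟨fun hy => ⟨hy.1, y, hy.2, rfl⟩, fun hy => ⟨hy.1, ?_⟩⟩
      obtain ⟨x, hx, hxy⟩ := hy.2
      rw [mem_preimage, mem_singleton_iff] at hx ⊢
      rw [← hx]
      exact (dyadicIndex_eq_of_le (by omega) hxy).symm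
    have hb : Bornology.IsBounded (dyadicIndex (d := d) (M - i) ⁻¹' A') := by
      rw [← hA']
      exact (isBounded_dyadicCube M n).subset inter_subset_right
    rw [hA']
    have h0 := setIntegral_dyadicIndex_preimage_eq_zero (A := A')
      ((hf.sub (locallyIntegrable_dyadicAvg hf (M - i))).integrableOn_isBounded hb)
      (fun m => setIntegral_sub_dyadicAvg_eq_zero le_rfl hf m)
    have h1 := integral_sub (hf.integrableOn_isBounded hb)
      ((locallyIntegrable_dyadicAvg hf (M - i)).integrableOn_isBounded hb)
    exact (sub_eq_zero.1 (h1.symm.trans h0)).symm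
  · refine StronglyMeasurable.aestronglyMeasurable ?_
    exact (StronglyMeasurable.of_discrete (f := fun n : Fin d → ℤ =>
      (dyadicVol d (M - i)).toReal⁻¹ • ∫ y in dyadicIndex (M - i) ⁻¹' {n}, f y)).comp_measurable
      (fun s _ => ⟨s, trivial, rfl⟩)

/-- Cotype is applied to the normalised measure of the cube. The normalisation cancels from both
sides, so the constant depends neither on the cube nor on M, and the term of index zero is dropped.
-/
lemma exists_tsum_lintegral_dyadicAvg_sub_cube_le (d : ℕ) {q : ℝ} (hq : 1 ≤ q)
    (hB : MartingaleCotype q B) :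
    ∃ C : ℝ≥0, ∀ f : EuclideanSpace ℝ (Fin d) → B, MemLp f (ENNReal.ofReal q) volume →
      ∀ (M : ℤ) (n : Fin d → ℤ),
      ∑' i : ℕ, ∫⁻ x in dyadicIndex M ⁻¹' {n},
        ‖dyadicAvg f (M - (i + 1)) x - dyadicAvg f (M - i) x‖ₑ ^ q ≤
      C * ∫⁻ x in dyadicIndex M ⁻¹' {n}, ‖f x‖ₑ ^ q := by
  obtain ⟨C, hC⟩ := hB
  refine ⟨C, fun f hf M n => ?_⟩
  have := isProbabilityMeasure_dyadicCube M n
  have hfl : LocallyIntegrable f volume := hf.locallyIntegrable (by simpa using hq)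
  have hvi : (dyadicVol d M)⁻¹ ≠ ∞ := ENNReal.inv_ne_top.2 (dyadicVol_ne_zero M)
  have h := hC (EuclideanSpace ℝ (Fin d))
    ((dyadicVol d M)⁻¹ • volume.restrict (dyadicIndex M ⁻¹' {n})) (dyadicFiltration d M) f
    ((hf.restrict _).smul_measure hvi)
  have h2 : ∀ i : ℕ, ∫⁻ x, ‖dyadicAvg f (M - (i + 1)) x - dyadicAvg f (M - i) x‖ₑ ^ q
        ∂((dyadicVol d M)⁻¹ • volume.restrict (dyadicIndex M ⁻¹' {n})) =
      ∫⁻ ω, ‖(((dyadicVol d M)⁻¹ • volume.restrict (dyadicIndex M ⁻¹' {n}))[f |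
          dyadicFiltration d M (i + 1)]) ω -
        (((dyadicVol d M)⁻¹ • volume.restrict (dyadicIndex M ⁻¹' {n}))[f |
          dyadicFiltration d M i]) ω‖ₑ ^ q
        ∂((dyadicVol d M)⁻¹ • volume.restrict (dyadicIndex M ⁻¹' {n})) := fun i => by
    refine lintegral_congr_ae ?_
    filter_upwards [dyadicAvg_ae_eq_condExp hfl M n i, dyadicAvg_ae_eq_condExp hfl M n (i + 1)]
      with x h1 h2
    rw [← h1, ← h2]
    push_cast
    rfl
  have h3 := le_add_self.trans h
  simp only [← h2, lintegral_smul_measure, smul_eq_mul, ENNReal.tsum_mul_left] at h3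
  rw [mul_left_comm] at h3
  exact (ENNReal.mul_le_mul_iff_right (ENNReal.inv_ne_zero.2 (dyadicVol_ne_top M)) hvi).1 h3

/-- Martingale cotype on the dyadic filtration of Euclidean space. -/
lemma exists_tsum_lintegral_dyadicAvg_sub_le (d : ℕ) {q : ℝ} (hq : 1 ≤ q)
    (hB : MartingaleCotype q B) :
    ∃ C : ℝ≥0, ∀ f : EuclideanSpace ℝ (Fin d) → B, MemLp f (ENNReal.ofReal q) volume →
      ∑' j : ℤ, ∫⁻ x, ‖dyadicAvg f j x - dyadicAvg f (j + 1) x‖ₑ ^ q ≤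
        C * ∫⁻ x, ‖f x‖ₑ ^ q := by
  obtain ⟨C, hC⟩ := exists_tsum_lintegral_dyadicAvg_sub_cube_le d hq hB
  refine ⟨C, fun f hf => ?_⟩
  set a : ℤ → ℝ≥0∞ := fun j => ∫⁻ x, ‖dyadicAvg f j x - dyadicAvg f (j + 1) x‖ₑ ^ q
  have h1 : ∀ M : ℤ, ∑' i : ℕ, a (M - (i + 1)) ≤ C * ∫⁻ x, ‖f x‖ₑ ^ q := fun M => by
    have : ∀ i : ℕ, a (M - (i + 1)) = ∑' n : Fin d → ℤ, ∫⁻ x in dyadicIndex M ⁻¹' {n},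
        ‖dyadicAvg f (M - (i + 1)) x - dyadicAvg f (M - i) x‖ₑ ^ q := fun i => by
      simp only [a]
      rw [lintegral_eq_tsum_dyadicCube M]
      simp only [show M - ((i : ℤ) + 1) + 1 = M - i by ring]
    simp only [this]
    rw [ENNReal.tsum_comm, lintegral_eq_tsum_dyadicCube M, ← ENNReal.tsum_mul_left]
    exact ENNReal.tsum_le_tsum fun n => hC f hf M n
  -- The filtration starts at a top scale, so only differences below some M are controlled at once.
  -- The bound is uniform in M, and any finite set of scales lies below some M.
  rw [ENNReal.tsum_eq_iSup_sum]
  refine iSup_le fun s => ?_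
  obtain ⟨M, hM⟩ : ∃ M : ℤ, ∀ j ∈ s, j < M := by
    obtain ⟨M, hM⟩ := s.bddAbove
    exact ⟨M + 1, fun j hj => by have := hM hj; omega⟩
  have hinj : Function.Injective fun j : s => (M - 1 - j.1).toNat := by
    rintro ⟨i, hi⟩ ⟨j, hj⟩ hij
    have := hM i hi
    have := hM j hj
    simp only at hij
    apply Subtype.ext
    simp only
    omega
  rw [← Finset.tsum_subtype]
  refine le_trans (le_of_eq ?_) ((ENNReal.tsum_comp_le_tsum_of_injective hinj
    fun i : ℕ => a (M - (i + 1))).trans (h1 M))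
  refine tsum_congr fun j => ?_
  have := hM j.1 j.2
  have e : (j : ℤ) = M - (((M - 1 - j).toNat : ℤ) + 1) := by omega
  exact congrArg a e

lemma lintegral_enorm_dyadicAvg_rpow_le {q : ℝ} (hq : 1 ≤ q) {f : EuclideanSpace ℝ (Fin d) → B}
    (hf : AEStronglyMeasurable f volume) (k : ℤ) :
    ∫⁻ x, ‖dyadicAvg f k x‖ₑ ^ q ≤ ∫⁻ x, ‖f x‖ₑ ^ q :=
  (lintegral_mono fun x => enorm_dyadicAvg_rpow_le hq hf k x).trans_eq (lintegral_dyadicLAvg _ k)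

lemma lintegral_enorm_sub_dyadicAvg_rpow_le {q : ℝ} (hq : 1 ≤ q)
    {f : EuclideanSpace ℝ (Fin d) → B} (hf : AEStronglyMeasurable f volume) (k : ℤ) :
    ∫⁻ x, ‖f x - dyadicAvg f k x‖ₑ ^ q ≤ 2 ^ q * 2 * ∫⁻ x, ‖f x‖ₑ ^ q := by
  calc ∫⁻ x, ‖f x - dyadicAvg f k x‖ₑ ^ q
      ≤ ∫⁻ x, 2 ^ q * (‖f x‖ₑ ^ q + ‖dyadicAvg f k x‖ₑ ^ q) := by
        refine lintegral_mono fun x => le_trans ?_ (ENNReal.add_rpow_le_two_rpow_mul hq _ _)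
        gcongr
        exact enorm_sub_le
    _ = 2 ^ q * ((∫⁻ x, ‖f x‖ₑ ^ q) + ∫⁻ x, ‖dyadicAvg f k x‖ₑ ^ q) := by
        rw [lintegral_const_mul' _ _ (ENNReal.rpow_ne_top_of_nonneg (by linarith) (by simp)),
          lintegral_add_right' _ ((stronglyMeasurable_dyadicAvg f k).enorm.pow_const
            q).aemeasurable]
    _ ≤ 2 ^ q * ((∫⁻ x, ‖f x‖ₑ ^ q) + ∫⁻ x, ‖f x‖ₑ ^ q) := by
        exact mul_le_mul_right (add_le_add le_rfl (lintegral_enorm_dyadicAvg_rpow_le hq hf k)) _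
    _ = _ := by ring

end Cotype

/-! ### The strong type estimate at the cotype exponent -/

section StrongType

variable {d : ℕ} {B : Type*} [NormedAddCommGroup B] [NormedSpace ℝ B] [CompleteSpace B]

lemma ENNReal.sqrtTwo_pow_mul_inv_two_pow (n : ℕ) :
    ENNReal.sqrtTwo ^ n * 2⁻¹ ^ n = ENNReal.sqrtTwo⁻¹ ^ n := by
  rw [← mul_pow, ENNReal.sqrtTwo_mul_inv_two]

/-- The combined decay estimate: `g` has vanishing means over the cubes of side `2 ^ (j + 1)` if
`j < k`, and is constant on the cubes of side `2 ^ j` if `k ≤ j`. -/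
lemma exists_lintegral_scaleSup_le_two_sided (d : ℕ) [NeZero d] {q : ℝ} (hq : 2 ≤ q) :
    ∃ C : ℝ≥0∞, C ≠ ∞ ∧ ∀ (g : EuclideanSpace ℝ (Fin d) → B), LocallyIntegrable g volume →
      ∀ (j k : ℤ), (j < k → ∀ n, ∫ x in dyadicIndex (j + 1) ⁻¹' {n}, g x = 0) →
      (k ≤ j → ∀ x y, dyadicIndex j x = dyadicIndex j y → g x = g y) →
      ∫⁻ x, scaleSup q g k x ≤ C * 2⁻¹ ^ (j - k).natAbs * ∫⁻ x, ‖g x‖ₑ ^ q := by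
  obtain ⟨C₁, hC₁, h₁⟩ := exists_lintegral_scaleSup_le_of_mean_zero (B := B) d hq
  obtain ⟨C₂, hC₂, h₂⟩ := exists_lintegral_scaleSup_le_of_const (B := B) d (q := q) (by linarith)
  refine ⟨2 * C₁ + C₂, by finiteness, fun g hg j k hs hl => ?_⟩
  rcases lt_or_ge j k with hjk | hjk
  · obtain ⟨n, hn⟩ := Int.le.dest (show j + 1 ≤ k by omega)
    have e : (j - k).natAbs = n + 1 := by omega
    have := h₁ g hg (j + 1) n (hs hjk) (fun y => ‖g y‖ₑ ^ q)
      (hg.aestronglyMeasurable.enorm.pow_const q)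
      (fun x a b => lintegral_annulus_rpow_le (by linarith) hg.aestronglyMeasurable _ x a b)
    rw [hn] at this
    refine this.trans ?_
    rw [e]
    gcongr ?_ * _
    -- The means vanish at side 2^(j+1), so there are only n = |j - k| - 1 powers of 1/2; the
    -- constant 2 * C₁ makes up for the missing one.
    calc C₁ * 2⁻¹ ^ n = 2 * C₁ * 2⁻¹ ^ (n + 1) := by
          rw [pow_succ, mul_comm 2 C₁, mul_assoc, mul_left_comm 2, ENNReal.mul_inv_cancel
            two_ne_zero ENNReal.ofNat_ne_top, mul_one]
      _ ≤ _ := by gcongr; exact le_self_add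
  · obtain ⟨n, rfl⟩ := Int.le.dest hjk
    have e : (k + n - k).natAbs = n := by omega
    refine (h₂ g hg k n (hl hjk)).trans ?_
    rw [e]
    gcongr
    exact le_add_self

/-- The embedding `i ↦ a + i` of the natural numbers into the integers. -/
def Int.addNatEmbedding (a : ℤ) : ℕ ↪ ℤ where
  toFun i := a + i
  inj' i j h := by simpa using h

lemma Int.addNatEmbedding_apply (a : ℤ) (i : ℕ) : Int.addNatEmbedding a i = a + i := rfl

/-- The contribution of the scale `2 ^ k`. -/
lemma exists_lintegral_scaleSup_le_tsum (d : ℕ) [NeZero d] {q : ℝ} (hq : 2 ≤ q) :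
    ∃ C : ℝ≥0∞, C ≠ ∞ ∧ ∀ f : EuclideanSpace ℝ (Fin d) → B, MemLp f (ENNReal.ofReal q) volume →
      ∀ k : ℤ, ∫⁻ x, scaleSup q f k x ≤ C * ∑' j : ℤ, ENNReal.sqrtTwo⁻¹ ^ (j - k).natAbs *
        ∫⁻ x, ‖dyadicAvg f j x - dyadicAvg f (j + 1) x‖ₑ ^ q := by
  have hq1 : 1 ≤ q := by linarith
  obtain ⟨K, hK, hsum⟩ := exists_scaleSup_sum_le (d := d) (B := B) (q := q) (by linarith)
  obtain ⟨C, hC, hdecay⟩ := exists_lintegral_scaleSup_le_two_sided (B := B) d hq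
  refine ⟨K * C, by finiteness, fun f hf k => ?_⟩
  have hfl : LocallyIntegrable f volume := hf.locallyIntegrable (by simpa using hq1)
  have hE := fun j => locallyIntegrable_dyadicAvg hfl j
  set r := ENNReal.sqrtTwo⁻¹
  set a : ℤ → ℝ≥0∞ := fun j => ∫⁻ x, ‖dyadicAvg f j x - dyadicAvg f (j + 1) x‖ₑ ^ q
  set P : ℝ≥0∞ := ∫⁻ x, ‖f x‖ₑ ^ q
  have hP : P ≠ ∞ := by
    have := lintegral_rpow_enorm_lt_top_of_eLpNorm_lt_top (μ := volume) (f := f)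
      (p := ENNReal.ofReal q) (by simp; linarith) ENNReal.ofReal_ne_top hf.2
    rw [ENNReal.toReal_ofReal (by linarith)] at this
    exact this.ne
  have hN : ∀ N : ℕ, ∫⁻ x, scaleSup q f k x ≤
      K * C * (∑' j : ℤ, r ^ (j - k).natAbs * a j + r ^ N * (2 ^ q * 2 * P + P)) := by
    intro N
    -- A truncated telescoping: `u` passes from f through the averages to 0, so the finitely many
    -- differences add up to f exactly and convergence of the full expansion is never needed. The
    -- end pieces are f - E_{k-N} f and E_{k+N} f.
    set u : ℤ → EuclideanSpace ℝ (Fin d) → B := fun j => if j < k - N then f else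
      if j ≤ k + N then dyadicAvg f j else 0
    set F : ℤ → EuclideanSpace ℝ (Fin d) → B := fun j y => u j y - u (j + 1) y
    have hu : ∀ j, LocallyIntegrable (u j) volume := fun j => by
      simp only [u]
      split_ifs
      exacts [hfl, hE j, locallyIntegrable_zero]
    have hF : ∀ j, LocallyIntegrable (F j) volume := fun j => (hu j).sub (hu (j + 1))
    set s : Finset ℤ := (Finset.range (2 * N + 2)).map (Int.addNatEmbedding (k - N - 1))
    have hfF : f = fun y => ∑ j ∈ s, F j y := by
      funext y
      rw [Finset.sum_map]
      simp only [Int.addNatEmbedding_apply]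
      have := Finset.sum_range_sub' (fun i : ℕ => u (k - N - 1 + i) y) (2 * N + 2)
      have e1 : u (k - N - 1 + (0 : ℕ)) y = f y := by
        simp only [u, Nat.cast_zero, add_zero]
        rw [if_pos (by omega)]
      have e2 : u (k - N - 1 + (2 * N + 2 : ℕ)) y = 0 := by
        simp only [u]
        rw [if_neg (by push_cast; omega), if_neg (by push_cast; omega)]
        rfl
      rw [e1, e2, sub_zero] at this
      rw [← this]
      refine Finset.sum_congr rfl fun i _ => ?_
      simp only [F]
      rw [show k - N - 1 + ((i + 1 : ℕ) : ℤ) = k - N - 1 + i + 1 by push_cast; ring]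
    have hcases : ∀ j ∈ s, (F j = fun y => f y - dyadicAvg f (j + 1) y) ∧ j = k - N - 1 ∨
        (F j = fun y => dyadicAvg f j y - dyadicAvg f (j + 1) y) ∨
        (F j = dyadicAvg f j) ∧ j = k + N := by
      intro j hj
      obtain ⟨i, hi, rfl⟩ := Finset.mem_map.1 hj
      rw [Finset.mem_range] at hi
      simp only [Int.addNatEmbedding_apply]
      rcases Nat.eq_zero_or_pos i with rfl | hi0
      · left
        refine ⟨?_, by simp⟩
        simp only [F, u]
        rw [if_pos (by push_cast; omega), if_neg (by push_cast; omega),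
          if_pos (by push_cast; omega)]
      · right
        rcases (show i ≤ 2 * N ∨ i = 2 * N + 1 by omega) with hi1 | rfl
        · left
          simp only [F, u]
          rw [if_neg (by omega), if_pos (by omega),
            if_neg (by omega), if_pos (by omega)]
        · right
          refine ⟨?_, by push_cast; ring⟩
          simp only [F, u]
          rw [if_neg (by push_cast; omega), if_pos (by push_cast; omega),
            if_neg (by push_cast; omega), if_neg (by push_cast; omega)]
          simp
    have hFint : ∀ j ∈ s, ∫⁻ x, scaleSup q (F j) k x ≤
        C * 2⁻¹ ^ (j - k).natAbs * ∫⁻ x, ‖F j x‖ₑ ^ q := by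
      intro j hj
      have hconst : ∀ i ≤ j, ∀ x y, dyadicIndex i x = dyadicIndex i y →
          dyadicAvg f j x = dyadicAvg f j y := fun i hi x y hxy =>
        dyadicAvg_congr f (dyadicIndex_eq_of_le hi hxy)
      refine hdecay (F j) (hF j) j k (fun hjk n => ?_) (fun hjk x y hxy => ?_)
      · rcases hcases j hj with ⟨h, -⟩ | h | ⟨-, h⟩
        · rw [h]; exact setIntegral_sub_dyadicAvg_eq_zero le_rfl hfl n
        · have h1 := setIntegral_sub_dyadicAvg_eq_zero (le_refl (j + 1)) hfl n
          have h2 := setIntegral_sub_dyadicAvg_eq_zero (show j ≤ j + 1 by omega) hfl n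
          have hb := isBounded_dyadicCube (j + 1) n
          rw [integral_sub (hfl.integrableOn_isBounded hb) ((hE _).integrableOn_isBounded hb)]
            at h1 h2
          rw [h, integral_sub ((hE _).integrableOn_isBounded hb)
            ((hE _).integrableOn_isBounded hb), ← sub_eq_zero.1 h1, ← sub_eq_zero.1 h2, sub_self]
        · omega
      · rcases hcases j hj with ⟨-, h⟩ | h | ⟨h, -⟩
        · omega
        · rw [h]
          simp only
          rw [dyadicAvg_congr f hxy, dyadicAvg_congr f (dyadicIndex_eq_of_le
            (show j ≤ j + 1 by omega) hxy)]
        · rw [h]; exact dyadicAvg_congr f hxy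
    have hr1 : r ≤ 1 := ENNReal.inv_sqrtTwo_lt_one.le
    set A : ℤ → ℝ≥0∞ := fun j => r ^ (j - k).natAbs * a j +
      (if j = k - N - 1 then r ^ N * (2 ^ q * 2 * P) else 0) + (if j = k + N then r ^ N * P else 0)
    have hA : ∀ j ∈ s, r ^ (j - k).natAbs * ∫⁻ x, ‖F j x‖ₑ ^ q ≤ A j := by
      intro j hj
      rcases hcases j hj with ⟨h, h'⟩ | h | ⟨h, h'⟩
      · refine le_trans ?_ le_self_add
        refine le_trans ?_ le_add_self
        rw [if_pos h', h]
        gcongr ?_ * ?_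
        · exact pow_le_pow_right_of_le_one' hr1 (by omega)
        · exact lintegral_enorm_sub_dyadicAvg_rpow_le hq1 hfl.aestronglyMeasurable _
      · refine le_trans ?_ le_self_add
        refine le_trans ?_ le_self_add
        rw [h]
      · refine le_trans ?_ le_add_self
        rw [if_pos h', h]
        gcongr ?_ * ?_
        · exact pow_le_pow_right_of_le_one' hr1 (by omega)
        · exact lintegral_enorm_dyadicAvg_rpow_le hq1 hfl.aestronglyMeasurable _
    calc ∫⁻ x, scaleSup q f k x
        = ∫⁻ x, scaleSup q (fun y => ∑ j ∈ s, F j y) k x := by rw [← hfF]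
      _ ≤ ∫⁻ x, K * ∑ j ∈ s, ENNReal.sqrtTwo ^ (j - k).natAbs * scaleSup q (F j) k x :=
          lintegral_mono fun x => hsum s k F (fun j _ => hF j) x
      _ = K * ∑ j ∈ s, ENNReal.sqrtTwo ^ (j - k).natAbs * ∫⁻ x, scaleSup q (F j) k x := by
          rw [lintegral_const_mul' _ _ hK, lintegral_finsetSum]
          · congr 1
            refine Finset.sum_congr rfl fun j _ => ?_
            rw [lintegral_const_mul' _ _ (ENNReal.pow_ne_top ENNReal.sqrtTwo_ne_top)]
          · exact fun j _ => (measurable_scaleSup q (hF j) k).const_mul _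
      _ ≤ K * ∑ j ∈ s, C * A j := by
          refine mul_le_mul_right (Finset.sum_le_sum fun j hj => ?_) _
          calc ENNReal.sqrtTwo ^ (j - k).natAbs * ∫⁻ x, scaleSup q (F j) k x
              ≤ ENNReal.sqrtTwo ^ (j - k).natAbs *
                (C * 2⁻¹ ^ (j - k).natAbs * ∫⁻ x, ‖F j x‖ₑ ^ q) := by
                gcongr; exact hFint j hj
            _ = C * ((ENNReal.sqrtTwo ^ (j - k).natAbs * 2⁻¹ ^ (j - k).natAbs) *
                ∫⁻ x, ‖F j x‖ₑ ^ q) := by ring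
            _ ≤ C * A j := by
                rw [ENNReal.sqrtTwo_pow_mul_inv_two_pow]
                gcongr
                exact hA j hj
      _ ≤ K * C * ∑' j, A j := by
          rw [← Finset.mul_sum, mul_assoc]
          gcongr
          exact ENNReal.sum_le_tsum s
      _ = _ := by
          simp only [A]
          rw [ENNReal.tsum_add, ENNReal.tsum_add, tsum_ite_eq, tsum_ite_eq, add_assoc, ← mul_add]
  -- The end pieces have L^q norms bounded independently of N and carry the weight r^N with r =
  -- 1/√2, so they disappear in the limit.
  have hlim : Tendsto (fun N : ℕ => K * C * (∑' j : ℤ, r ^ (j - k).natAbs * a j +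
      r ^ N * (2 ^ q * 2 * P + P))) atTop
      (𝓝 (K * C * (∑' j : ℤ, r ^ (j - k).natAbs * a j + 0 * (2 ^ q * 2 * P + P)))) := by
    have hPfin : 2 ^ q * 2 * P + P ≠ ∞ := by
      have : (2 : ℝ≥0∞) ^ q ≠ ∞ := ENNReal.rpow_ne_top_of_nonneg (by linarith) (by simp)
      finiteness
    refine ENNReal.Tendsto.const_mul (Tendsto.const_add _ ?_) (Or.inr (by finiteness))
    exact ENNReal.Tendsto.mul_const
      (ENNReal.tendsto_pow_atTop_nhds_zero_of_lt_one ENNReal.inv_sqrtTwo_lt_one) (Or.inr hPfin)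
  rw [zero_mul, add_zero] at hlim
  exact ge_of_tendsto' hlim hN

/-- The square function estimate at the exponent `q`. -/
lemma exists_tsum_lintegral_scaleSup_le (d : ℕ) [NeZero d] {q : ℝ} (hq : 2 ≤ q)
    (hB : MartingaleCotype q B) :
    ∃ C : ℝ≥0∞, C ≠ ∞ ∧ ∀ f : EuclideanSpace ℝ (Fin d) → B, MemLp f (ENNReal.ofReal q) volume →
      ∑' k : ℤ, ∫⁻ x, scaleSup q f k x ≤ C * ∫⁻ x, ‖f x‖ₑ ^ q := by
  obtain ⟨C₁, hC₁, h₁⟩ := exists_lintegral_scaleSup_le_tsum (B := B) d hq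
  obtain ⟨C₂, h₂⟩ := exists_tsum_lintegral_dyadicAvg_sub_le (B := B) d (by linarith) hB
  have hr := ENNReal.two_mul_inv_one_sub_ne_top ENNReal.inv_sqrtTwo_lt_one
  refine ⟨C₁ * (2 * (1 - ENNReal.sqrtTwo⁻¹)⁻¹ * C₂), by finiteness, fun f hf => ?_⟩
  calc ∑' k : ℤ, ∫⁻ x, scaleSup q f k x
      ≤ ∑' k : ℤ, C₁ * ∑' j : ℤ, ENNReal.sqrtTwo⁻¹ ^ (j - k).natAbs *
        ∫⁻ x, ‖dyadicAvg f j x - dyadicAvg f (j + 1) x‖ₑ ^ q := ENNReal.tsum_le_tsum (h₁ f hf)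
    _ = C₁ * ∑' j : ℤ, (∑' k : ℤ, ENNReal.sqrtTwo⁻¹ ^ (k - j).natAbs) *
        ∫⁻ x, ‖dyadicAvg f j x - dyadicAvg f (j + 1) x‖ₑ ^ q := by
        rw [ENNReal.tsum_mul_left, ENNReal.tsum_comm]
        simp only [ENNReal.tsum_mul_right, show ∀ j k : ℤ, (k - j).natAbs = (j - k).natAbs by omega]
    _ ≤ C₁ * ∑' j : ℤ, (2 * (1 - ENNReal.sqrtTwo⁻¹)⁻¹) *
        ∫⁻ x, ‖dyadicAvg f j x - dyadicAvg f (j + 1) x‖ₑ ^ q := by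
        gcongr with j
        exact ENNReal.tsum_pow_natAbs_sub_le _ j
    _ ≤ C₁ * ((2 * (1 - ENNReal.sqrtTwo⁻¹)⁻¹) * (C₂ * ∫⁻ x, ‖f x‖ₑ ^ q)) := by
        rw [ENNReal.tsum_mul_left]
        gcongr
        exact h₂ f hf
    _ = _ := by ring

/-- The strong type estimate at the exponent `q`. -/
lemma exists_lintegral_shortVariation_rpow_le (d : ℕ) [NeZero d] {q : ℝ} (hq : 2 ≤ q)
    (hB : MartingaleCotype q B) :
    ∃ C : ℝ≥0∞, C ≠ ∞ ∧ ∀ f : EuclideanSpace ℝ (Fin d) → B, MemLp f (ENNReal.ofReal q) volume →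
      ∫⁻ x, shortVariation q f x ^ q ≤ C * ∫⁻ x, ‖f x‖ₑ ^ q := by
  obtain ⟨C, hC, h⟩ := exists_tsum_lintegral_scaleSup_le (B := B) d hq hB
  refine ⟨C, hC, fun f hf => le_trans ?_ (h f hf)⟩
  have hfl : LocallyIntegrable f volume := hf.locallyIntegrable (by simp; linarith)
  rw [← lintegral_tsum fun k => (measurable_scaleSup q hfl k).aemeasurable]
  exact lintegral_mono fun x => shortVariation_rpow_le (by linarith) f x

end StrongType

/-! ### Stopping cubes -/

section Stopping

variable {d : ℕ} {B : Type*} [NormedAddCommGroup B] [NormedSpace ℝ B]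

/-- The union of the maximal dyadic cubes with mean of `h` larger than `c` that have side `2 ^ l`. -/
def stopLevel (h : EuclideanSpace ℝ (Fin d) → ℝ≥0∞) (c : ℝ≥0∞) (l : ℤ) :
    Set (EuclideanSpace ℝ (Fin d)) :=
  {x | c < dyadicLAvg h l x ∧ ∀ k, l < k → dyadicLAvg h k x ≤ c}

/-- The set of points near a maximal dyadic cube with mean of `h` larger than `c`. -/
def stopNbhd (h : EuclideanSpace ℝ (Fin d) → ℝ≥0∞) (c : ℝ≥0∞) :
    Set (EuclideanSpace ℝ (Fin d)) :=
  ⋃ (l : ℤ), ⋃ m ∈ Fintype.piFinset fun _ : Fin d => Finset.Icc (-2 : ℤ) 2,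
    (fun x => x + WithLp.toLp 2 fun i => (2 : ℝ) ^ l * m i) ⁻¹' stopLevel h c l

variable {h : EuclideanSpace ℝ (Fin d) → ℝ≥0∞} {c : ℝ≥0∞} {l : ℤ}

lemma mem_stopLevel_congr {x y : EuclideanSpace ℝ (Fin d)} (hxy : dyadicIndex l x = dyadicIndex l y)
    (hx : x ∈ stopLevel h c l) : y ∈ stopLevel h c l := by
  refine ⟨by rw [← dyadicLAvg_congr h hxy]; exact hx.1, fun k hk => ?_⟩
  rw [← dyadicLAvg_congr h (dyadicIndex_eq_of_le hk.le hxy)]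
  exact hx.2 k hk

lemma eq_preimage_image_dyadicIndex {S : Set (EuclideanSpace ℝ (Fin d))}
    (hS : ∀ x y, dyadicIndex l x = dyadicIndex l y → x ∈ S → y ∈ S) :
    S = dyadicIndex l ⁻¹' (dyadicIndex l '' S) := by
  refine (subset_preimage_image _ _).antisymm ?_
  rintro y ⟨x, hx, hxy⟩
  exact hS x y hxy hx

lemma measurableSet_of_dyadicIndex {S : Set (EuclideanSpace ℝ (Fin d))}
    (hS : ∀ x y, dyadicIndex l x = dyadicIndex l y → x ∈ S → y ∈ S) : MeasurableSet S := by
  rw [eq_preimage_image_dyadicIndex hS]; exact measurableSet_dyadicIndex _ _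

lemma measurableSet_stopLevel : MeasurableSet (stopLevel h c l) :=
  measurableSet_of_dyadicIndex fun _ _ => mem_stopLevel_congr

lemma setLIntegral_dyadicLAvg_of_dyadicIndex {S : Set (EuclideanSpace ℝ (Fin d))}
    (hS : ∀ x y, dyadicIndex l x = dyadicIndex l y → x ∈ S → y ∈ S) :
    ∫⁻ x in S, dyadicLAvg h l x = ∫⁻ x in S, h x := by
  rw [eq_preimage_image_dyadicIndex hS, setLIntegral_dyadicLAvg]

lemma disjoint_stopLevel {l' : ℤ} (hl : l ≠ l') :
    Disjoint (stopLevel h c l) (stopLevel h c l') := by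
  rw [Set.disjoint_left]
  intro x hx hx'
  rcases lt_or_gt_of_ne hl with hlt | hlt
  · exact absurd (hx.2 l' hlt) (not_le.2 hx'.1)
  · exact absurd (hx'.2 l hlt) (not_le.2 hx.1)

/-- The set is a union of whole cubes of side 2^l, so h may be replaced by its mean over them, which
exceeds c there. -/
lemma mul_volume_stopLevel_le : c * volume (stopLevel h c l) ≤ ∫⁻ x in stopLevel h c l, h x := by
  rw [← setLIntegral_dyadicLAvg_of_dyadicIndex (l := l) fun _ _ => mem_stopLevel_congr,
    ← setLIntegral_const]
  exact setLIntegral_mono' measurableSet_stopLevel fun x hx => hx.1.le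

lemma tsum_setLIntegral_stopLevel_le :
    ∑' l : ℤ, ∫⁻ x in stopLevel h c l, h x ≤ ∫⁻ x, h x := by
  rw [← lintegral_iUnion (fun l => measurableSet_stopLevel)
    (fun _ _ hne => disjoint_stopLevel hne)]
  exact setLIntegral_le_lintegral _ _

lemma measurableSet_stopNbhd : MeasurableSet (stopNbhd h c) := by
  refine MeasurableSet.iUnion fun l => Finset.measurableSet_biUnion _ fun m _ => ?_
  exact measurableSet_stopLevel.preimage (measurable_add_const _)

/-- At each level the neighbourhood is a union of 5^d translates of the stopping set, and the
stopping sets of different levels are disjoint. -/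
lemma mul_volume_stopNbhd_le : c * volume (stopNbhd h c) ≤ 5 ^ d * ∫⁻ x, h x := by
  have h1 : ∀ l : ℤ, volume (⋃ m ∈ Fintype.piFinset fun _ : Fin d => Finset.Icc (-2 : ℤ) 2,
      (fun x => x + WithLp.toLp 2 fun i => (2 : ℝ) ^ l * m i) ⁻¹' stopLevel h c l) ≤
      5 ^ d * volume (stopLevel h c l) := fun l => by
    refine (measure_biUnion_finset_le _ _).trans ?_
    simp only [measure_preimage_add_right, Finset.sum_const, Fintype.card_piFinset_const,
      Int.card_Icc, nsmul_eq_mul]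
    simp
  calc c * volume (stopNbhd h c) ≤ c * ∑' l : ℤ, 5 ^ d * volume (stopLevel h c l) := by
        gcongr
        exact (measure_iUnion_le _).trans (ENNReal.tsum_le_tsum h1)
    _ = 5 ^ d * ∑' l : ℤ, c * volume (stopLevel h c l) := by
        rw [ENNReal.tsum_mul_left, ENNReal.tsum_mul_left]; ring
    _ ≤ _ := by
        gcongr
        exact (ENNReal.tsum_le_tsum fun l => mul_volume_stopLevel_le).trans
          tsum_setLIntegral_stopLevel_le

/-- Translates by -2, …, 2 cubes in each coordinate suffice: the indices of points at distance less
than 2 · 2^l differ by less than 3. -/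
lemma mem_stopNbhd {x y : EuclideanSpace ℝ (Fin d)} (hy : y ∈ stopLevel h c l)
    (hxy : dist x y < 2 * 2 ^ l) : x ∈ stopNbhd h c := by
  set m : Fin d → ℤ := dyadicIndex l y - dyadicIndex l x
  have hl := two_zpow_pos l
  refine mem_iUnion.2 ⟨l, mem_iUnion₂.2 ⟨m, ?_, ?_⟩⟩
  · rw [Fintype.mem_piFinset]
    intro i
    have h1 := (EuclideanSpace.abs_coord_sub_le_dist x y i).trans_lt hxy
    have h2 : |x i / 2 ^ l - y i / 2 ^ l| < 2 := by
      rw [← sub_div, abs_div, abs_of_pos hl, div_lt_iff₀ hl]; exact h1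
    rw [abs_lt] at h2
    have e1 := Int.floor_le (x i / 2 ^ l)
    have e2 := Int.lt_floor_add_one (x i / 2 ^ l)
    have e3 := Int.floor_le (y i / 2 ^ l)
    have e4 := Int.lt_floor_add_one (y i / 2 ^ l)
    have h3 : (⌊y i / 2 ^ l⌋ : ℝ) - ⌊x i / 2 ^ l⌋ < 3 := by linarith
    have h4 : -3 < (⌊y i / 2 ^ l⌋ : ℝ) - ⌊x i / 2 ^ l⌋ := by linarith
    have h5 : ⌊y i / 2 ^ l⌋ - ⌊x i / 2 ^ l⌋ < 3 := by exact_mod_cast h3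
    have h6 : -3 < ⌊y i / 2 ^ l⌋ - ⌊x i / 2 ^ l⌋ := by exact_mod_cast h4
    simp only [m, Pi.sub_apply, dyadicIndex, Finset.mem_Icc]
    omega
  · refine mem_stopLevel_congr ?_ hy
    refine ((dyadicIndex_add_zsmul l x _ m fun i => ?_).trans ?_).symm
    · simp only [PiLp.add_apply]
    · simp [m]

lemma dyadicLAvg_le_of_dyadicVol (k : ℤ) (x : EuclideanSpace ℝ (Fin d)) :
    dyadicLAvg h k x ≤ (dyadicVol d k)⁻¹ * ∫⁻ y, h y := by
  rw [dyadicLAvg]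
  gcongr
  exact Measure.restrict_le_self

/-- The volumes 2^(kd) tend to infinity with k because d ≥ 1. Means over large cubes therefore fall
below any level, and maximal cubes exist. -/
lemma exists_dyadicVol_inv_mul_le [NeZero d] {I c : ℝ≥0∞} (hI : I ≠ ∞) (hc : c ≠ 0) :
    ∃ L : ℤ, ∀ k, L ≤ k → (dyadicVol d k)⁻¹ * I ≤ c := by
  obtain ⟨n, hn⟩ := ENNReal.exists_nat_mul_gt hc hI
  refine ⟨n, fun k hk => ?_⟩
  rw [mul_comm, ← div_eq_mul_inv]
  refine ENNReal.div_le_of_le_mul (hn.le.trans ?_)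
  rw [mul_comm]
  gcongr
  have h1 : (n : ℝ) ≤ (2 ^ k) ^ d := by
    calc (n : ℝ) ≤ 2 ^ n := by exact_mod_cast Nat.lt_two_pow_self.le
      _ = (2 : ℝ) ^ (n : ℤ) := (zpow_natCast _ _).symm
      _ ≤ 2 ^ k := zpow_le_zpow_right₀ one_le_two hk
      _ ≤ (2 ^ k) ^ d := le_self_pow₀ (one_le_zpow₀ one_le_two (by omega)) (NeZero.ne d)
  rw [dyadicVol, ← ENNReal.ofReal_natCast]
  exact ENNReal.ofReal_le_ofReal h1

lemma exists_mem_stopLevel_of_forall_le {x : EuclideanSpace ℝ (Fin d)} {L : ℤ}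
    (hL : ∀ k, L ≤ k → dyadicLAvg h k x ≤ c) {k : ℤ} (hx : c < dyadicLAvg h k x) :
    ∃ l, k ≤ l ∧ x ∈ stopLevel h c l := by
  obtain ⟨l, hl1, hl2⟩ := Int.exists_greatest_of_bdd (P := fun l => c < dyadicLAvg h l x)
    ⟨L, fun l hl => by
      by_contra hlt
      exact absurd (hL l (by omega)) (not_le.2 hl)⟩
    ⟨k, hx⟩
  refine ⟨l, hl2 k hx, hl1, fun k' hk' => ?_⟩
  by_contra hlt
  exact absurd (hl2 k' (not_le.1 hlt)) (by omega)

lemma exists_mem_stopLevel [NeZero d] (hI : ∫⁻ x, h x ≠ ∞) (hc : c ≠ 0) {k : ℤ}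
    {x : EuclideanSpace ℝ (Fin d)} (hx : c < dyadicLAvg h k x) :
    ∃ l, k ≤ l ∧ x ∈ stopLevel h c l := by
  obtain ⟨L, hL⟩ := exists_dyadicVol_inv_mul_le (d := d) hI hc
  exact exists_mem_stopLevel_of_forall_le
    (fun l hl => (dyadicLAvg_le_of_dyadicVol l x).trans (hL l hl)) hx

/-- The maximal function is controlled off the neighbourhood of the stopping cubes. -/
lemma setLIntegral_ball_le_of_notMem_stopNbhd [NeZero d] (hI : ∫⁻ x, h x ≠ ∞) (hc : c ≠ 0)
    {x : EuclideanSpace ℝ (Fin d)} (hx : x ∉ stopNbhd h c) {r : ℝ} (hr : 0 < r) :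
    ∫⁻ y in Metric.ball x r, h y ≤ ENNReal.ofReal ((1 + 2 * d) ^ d) * c * ballVol d r := by
  obtain ⟨n, hn1, hn2⟩ := exists_mem_Ioc_zpow hr one_lt_two
  set j := n + 1
  have e : (2 : ℝ) ^ j = 2 * 2 ^ n := by rw [zpow_add_one₀ two_ne_zero]; ring
  -- The side 2^j is comparable with r: r ≤ 2^j < 2r. If a cube of this side meeting the ball had
  -- mean larger than c, the stopping cube containing it would be close enough to put x into the
  -- neighbourhood.
  set S := dyadicIndex j ⁻¹' (dyadicIndex j '' Metric.ball x r)
  have hS : S ⊆ Metric.ball x ((1 + 2 * d) * r) := by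
    rintro y ⟨z, hz, hyz⟩
    have h1 := dist_le_of_dyadicIndex_eq hyz
    rw [Metric.mem_ball] at hz ⊢
    have h2 := dist_triangle_left y x z
    have h3 : (d : ℝ) * 2 ^ j ≤ d * (2 * r) := by gcongr; linarith
    linarith
  calc ∫⁻ y in Metric.ball x r, h y ≤ ∫⁻ y in S, h y :=
        lintegral_mono_set (subset_preimage_image _ _)
    _ = ∫⁻ y in S, dyadicLAvg h j y := (setLIntegral_dyadicLAvg _ _ _).symm
    _ ≤ ∫⁻ y in S, c := by
        refine setLIntegral_mono' (measurableSet_dyadicIndex _ _) ?_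
        rintro y ⟨z, hz, hyz⟩
        rw [← dyadicLAvg_congr h hyz]
        by_contra hlt
        obtain ⟨l, hjl, hl⟩ := exists_mem_stopLevel hI hc (not_le.1 hlt)
        refine hx (mem_stopNbhd hl ?_)
        rw [Metric.mem_ball, dist_comm] at hz
        have : (2 : ℝ) ^ j ≤ 2 ^ l := zpow_le_zpow_right₀ one_le_two hjl
        have := two_zpow_pos l
        linarith
    _ = c * volume S := setLIntegral_const _ _
    _ ≤ c * ballVol d ((1 + 2 * d) * r) := by
        gcongr
        rw [← volume_ball_eq_ballVol x]
        exact measure_mono hS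
    _ = _ := by rw [ballVol_mul (by positivity) hr]; ring

end Stopping

/-! ### Calderón–Zygmund decomposition by cube size -/

section WeakType

variable {d : ℕ} {B : Type*} [NormedAddCommGroup B] [NormedSpace ℝ B]

lemma ballAverage_add {f g : EuclideanSpace ℝ (Fin d) → B} (hf : LocallyIntegrable f volume)
    (hg : LocallyIntegrable g volume) (t : ℝ) (x : EuclideanSpace ℝ (Fin d)) :
    ballAverage (fun y => f y + g y) t x = ballAverage f t x + ballAverage g t x := by
  simp only [ballAverage_eq]
  rw [integral_add (hf.integrableOn_isBounded Metric.isBounded_ball)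
    (hg.integrableOn_isBounded Metric.isBounded_ball), smul_add]

lemma scaleSup_add_le {q : ℝ} (hq : 1 ≤ q) {f g : EuclideanSpace ℝ (Fin d) → B}
    (hf : LocallyIntegrable f volume) (hg : LocallyIntegrable g volume) (k : ℤ)
    (x : EuclideanSpace ℝ (Fin d)) :
    scaleSup q (fun y => f y + g y) k x ≤ 2 ^ q * (scaleSup q f k x + scaleSup q g k x) := by
  refine scaleSup_le fun t ht ht0 => ?_
  calc scaleVariation q (fun y => f y + g y) k t x
      ≤ ∑' i : scaleIndices k t, 2 ^ q *
          (‖ballAverage f (t (i.1 + 1)) x - ballAverage f (t i.1) x‖ₑ ^ q +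
            ‖ballAverage g (t (i.1 + 1)) x - ballAverage g (t i.1) x‖ₑ ^ q) := by
        refine ENNReal.tsum_le_tsum fun i => ?_
        refine le_trans ?_ (ENNReal.add_rpow_le_two_rpow_mul hq _ _)
        gcongr
        rw [ballAverage_add hf hg, ballAverage_add hf hg, add_sub_add_comm]
        exact enorm_add_le _ _
    _ = 2 ^ q * (scaleVariation q f k t x + scaleVariation q g k t x) := by
        rw [ENNReal.tsum_mul_left, ENNReal.tsum_add]; rfl
    _ ≤ _ := by
        gcongr <;> exact scaleVariation_le_scaleSup q _ k ht ht0 x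

lemma MeasureTheory.LocallyIntegrable.indicator' {f : EuclideanSpace ℝ (Fin d) → B}
    (hf : LocallyIntegrable f volume) {S : Set (EuclideanSpace ℝ (Fin d))} (hS : MeasurableSet S) :
    LocallyIntegrable (S.indicator f) volume := hf.indicator hS

/-- The stopping sets truncated below at the scale `2 ^ n₀`. -/
def truncStop (h : EuclideanSpace ℝ (Fin d) → ℝ≥0∞) (c : ℝ≥0∞) (n₀ l : ℤ) :
    Set (EuclideanSpace ℝ (Fin d)) :=
  {x | n₀ ≤ l ∧ (n₀ < l → c < dyadicLAvg h l x) ∧ ∀ k, l < k → dyadicLAvg h k x ≤ c}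

variable {h : EuclideanSpace ℝ (Fin d) → ℝ≥0∞} {c : ℝ≥0∞} {n₀ l : ℤ}

lemma mem_truncStop_congr {x y : EuclideanSpace ℝ (Fin d)}
    (hxy : dyadicIndex l x = dyadicIndex l y) (hx : x ∈ truncStop h c n₀ l) :
    y ∈ truncStop h c n₀ l := by
  refine ⟨hx.1, fun hl => by rw [← dyadicLAvg_congr h hxy]; exact hx.2.1 hl, fun k hk => ?_⟩
  rw [← dyadicLAvg_congr h (dyadicIndex_eq_of_le hk.le hxy)]
  exact hx.2.2 k hk

lemma measurableSet_truncStop : MeasurableSet (truncStop h c n₀ l) :=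
  measurableSet_of_dyadicIndex fun _ _ => mem_truncStop_congr

lemma disjoint_truncStop {l' : ℤ} (hl : l ≠ l') :
    Disjoint (truncStop h c n₀ l) (truncStop h c n₀ l') := by
  have key : ∀ {l l' : ℤ} {x}, l < l' → x ∈ truncStop h c n₀ l → x ∉ truncStop h c n₀ l' :=
    fun {l l' x} hlt hx hx' =>
      absurd (hx.2.2 l' hlt) (not_le.2 (hx'.2.1 (hx.1.trans_lt hlt)))
  rw [Set.disjoint_left]
  intro x hx hx'
  rcases lt_or_gt_of_ne hl with hlt | hlt
  · exact key hlt hx hx'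
  · exact key hlt hx' hx

/-- Either the largest cube with mean above c is larger than 2^n₀ and gives the level, or the point
is assigned the floor level n₀. -/
lemma exists_mem_truncStop [NeZero d] (hI : ∫⁻ x, h x ≠ ∞) (hc : c ≠ 0) (n₀ : ℤ)
    (x : EuclideanSpace ℝ (Fin d)) : ∃ l, x ∈ truncStop h c n₀ l := by
  by_cases H : ∃ k, n₀ < k ∧ c < dyadicLAvg h k x
  · obtain ⟨k, hk, hx⟩ := H
    obtain ⟨l, hl, hxl⟩ := exists_mem_stopLevel hI hc hx
    exact ⟨l, by omega, fun _ => hxl.1, hxl.2⟩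
  · push Not at H
    exact ⟨n₀, le_rfl, fun h => absurd h (lt_irrefl _), H⟩

/-- Means of an integrable function over very large cubes are at most c, so only levels between n₀
and some L occur. This makes the decomposition a finite sum. -/
lemma exists_finset_truncStop [NeZero d] (hI : ∫⁻ x, h x ≠ ∞) (hc : c ≠ 0) (n₀ : ℤ) :
    ∃ s : Finset ℤ, (∀ l ∈ s, n₀ ≤ l) ∧ ∀ x, ∃ l ∈ s, x ∈ truncStop h c n₀ l := by
  obtain ⟨L, hL⟩ := exists_dyadicVol_inv_mul_le (d := d) hI hc
  refine ⟨Finset.Icc n₀ (max L n₀), fun l hl => (Finset.mem_Icc.1 hl).1, fun x => ?_⟩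
  obtain ⟨l, hl⟩ := exists_mem_truncStop hI hc n₀ x
  refine ⟨l, Finset.mem_Icc.2 ⟨hl.1, ?_⟩, hl⟩
  by_contra hlt
  rw [not_le, max_lt_iff] at hlt
  exact absurd ((dyadicLAvg_le_of_dyadicVol l x).trans (hL l hlt.1.le))
    (not_le.2 (hl.2.1 hlt.2))

lemma dyadicLAvg_le_of_mem_truncStop {x : EuclideanSpace ℝ (Fin d)}
    (hx : x ∈ truncStop h c n₀ l) : dyadicLAvg h l x ≤ 2 ^ d * c :=
  (dyadicLAvg_le_succ h l x).trans (by gcongr; exact hx.2.2 _ (by omega))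

lemma tsum_setLIntegral_truncStop_le (s : Finset ℤ) :
    ∑ l ∈ s, ∫⁻ x in truncStop h c n₀ l, h x ≤ ∫⁻ x, h x := by
  rw [← lintegral_biUnion_finset (fun _ _ _ _ hne => disjoint_truncStop hne)
    (fun _ _ => measurableSet_truncStop)]
  exact setLIntegral_le_lintegral _ _

lemma sum_indicator_truncStop {M : Type*} [AddCommMonoid M] {s : Finset ℤ}
    {x : EuclideanSpace ℝ (Fin d)} (hl : l ∈ s) (hx : x ∈ truncStop h c n₀ l)
    (F : ℤ → EuclideanSpace ℝ (Fin d) → M) :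
    ∑ i ∈ s, (truncStop h c n₀ i).indicator (F i) x = F l x := by
  rw [Finset.sum_eq_single l, indicator_of_mem hx]
  · intro i _ hi
    refine indicator_of_notMem (fun hxi => ?_) _
    exact Set.disjoint_left.1 (disjoint_truncStop hi) hxi hx
  · exact fun h => absurd hl h

lemma MeasureTheory.LocallyIntegrable.finset_sum' {s : Finset ℤ}
    {F : ℤ → EuclideanSpace ℝ (Fin d) → B} (hF : ∀ l ∈ s, LocallyIntegrable (F l) volume) :
    LocallyIntegrable (fun x => ∑ l ∈ s, F l x) volume := locallyIntegrable_finsetSum s hF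

/-- The Calderón–Zygmund decomposition with bad parts sorted by the size of their cubes. -/
lemma exists_calderonZygmund_decomposition [NeZero d] [CompleteSpace B]
    {f : EuclideanSpace ℝ (Fin d) → B} (hf : Integrable f volume) {c : ℝ≥0∞} (hc : c ≠ 0) (n₀ : ℤ) :
    ∃ (s : Finset ℤ) (g : EuclideanSpace ℝ (Fin d) → B) (b : ℤ → EuclideanSpace ℝ (Fin d) → B),
      (∀ l ∈ s, n₀ ≤ l) ∧ (f = fun x => g x + ∑ l ∈ s, b l x) ∧
      LocallyIntegrable g volume ∧ (∀ x, ‖g x‖ₑ ≤ 2 ^ d * c) ∧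
      ∫⁻ x, ‖g x‖ₑ ≤ ∫⁻ x, ‖f x‖ₑ ∧
      (∀ l, LocallyIntegrable (b l) volume) ∧
      (∀ l n, ∫ x in dyadicIndex l ⁻¹' {n}, b l x = 0) ∧
      (∀ l x, dyadicLAvg (fun y => ‖b l y‖ₑ) l x ≤ 2 * (2 ^ d * c)) ∧
      ∑ l ∈ s, ∫⁻ x, ‖b l x‖ₑ ≤ 2 * ∫⁻ x, ‖f x‖ₑ ∧
      (∀ l k x, n₀ < k → k ≤ l → x ∉ stopNbhd (fun y => ‖f y‖ₑ) c →
        ∀ y ∈ Metric.ball x (2 ^ (k + 1)), b l y = 0) := by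
  set h : EuclideanSpace ℝ (Fin d) → ℝ≥0∞ := fun y => ‖f y‖ₑ
  have hI : ∫⁻ x, h x ≠ ∞ := hf.2.ne
  have hfl : LocallyIntegrable f volume := hf.locallyIntegrable
  obtain ⟨s, hs1, hs2⟩ := exists_finset_truncStop hI hc n₀
  set S : ℤ → Set (EuclideanSpace ℝ (Fin d)) := truncStop h c n₀
  have hSm : ∀ l, MeasurableSet (S l) := fun l => measurableSet_truncStop
  have hScongr : ∀ l x y, dyadicIndex l x = dyadicIndex l y → x ∈ S l → y ∈ S l :=
    fun l x y => mem_truncStop_congr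
  -- The sets `S l` with l in s partition the space, so f is averaged everywhere, also on the
  -- unstopped cubes of side 2^n₀. Hence g is bounded at every point without a differentiation
  -- theorem.
  set g : EuclideanSpace ℝ (Fin d) → B := fun x => ∑ l ∈ s, (S l).indicator (dyadicAvg f l) x
  set b : ℤ → EuclideanSpace ℝ (Fin d) → B := fun l =>
    (S l).indicator fun x => f x - dyadicAvg f l x
  have hsub : ∀ l, LocallyIntegrable (fun x => f x - dyadicAvg f l x) volume :=
    fun l => hfl.sub (locallyIntegrable_dyadicAvg hfl l)
  have hbE : ∀ l, ∫⁻ x in S l, ‖dyadicAvg f l x‖ₑ ≤ ∫⁻ x in S l, h x := fun l => by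
    rw [← setLIntegral_dyadicLAvg_of_dyadicIndex (h := h) (hScongr l)]
    exact lintegral_mono fun x => enorm_dyadicAvg_le f l x
  have hb1 : ∀ l (A : Set (Fin d → ℤ)), ∫⁻ x in dyadicIndex l ⁻¹' A, ‖b l x‖ₑ ≤
      2 * ∫⁻ x in dyadicIndex l ⁻¹' A, h x := by
    intro l A
    calc ∫⁻ x in dyadicIndex l ⁻¹' A, ‖b l x‖ₑ
        ≤ ∫⁻ x in dyadicIndex l ⁻¹' A, (h x + dyadicLAvg h l x) := by
          refine lintegral_mono fun x => ?_
          simp only [b]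
          rw [enorm_indicator_eq_indicator_enorm]
          refine (indicator_le_self' (fun _ _ => zero_le) x).trans ?_
          exact enorm_sub_le.trans (add_le_add le_rfl (enorm_dyadicAvg_le f l x))
      _ = 2 * ∫⁻ x in dyadicIndex l ⁻¹' A, h x := by
          rw [lintegral_add_right _ (measurable_dyadicLAvg h l), setLIntegral_dyadicLAvg, two_mul]
  refine ⟨s, g, b, hs1, ?_, ?_, ?_, ?_, ?_, ?_, ?_, ?_, ?_⟩
  · funext x
    obtain ⟨l, hl, hx⟩ := hs2 x
    simp only [g, b, S]
    rw [sum_indicator_truncStop hl hx, sum_indicator_truncStop hl hx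
      (fun l x => f x - dyadicAvg f l x), add_sub_cancel]
  · exact LocallyIntegrable.finset_sum' fun l _ =>
      (locallyIntegrable_dyadicAvg hfl l).indicator' (hSm l)
  · intro x
    obtain ⟨l, hl, hx⟩ := hs2 x
    simp only [g, S]
    rw [sum_indicator_truncStop hl hx]
    exact (enorm_dyadicAvg_le f l x).trans (dyadicLAvg_le_of_mem_truncStop hx)
  · calc ∫⁻ x, ‖g x‖ₑ ≤ ∫⁻ x, ∑ l ∈ s, (S l).indicator (fun x => ‖dyadicAvg f l x‖ₑ) x := by
          refine lintegral_mono fun x => (enorm_sum_le _ _).trans_eq ?_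
          simp only [enorm_indicator_eq_indicator_enorm]
      _ = ∑ l ∈ s, ∫⁻ x in S l, ‖dyadicAvg f l x‖ₑ := by
          rw [lintegral_finsetSum _ fun l _ =>
            ((stronglyMeasurable_dyadicAvg f l).enorm.indicator (hSm l))]
          simp only [lintegral_indicator (hSm _)]
      _ ≤ ∑ l ∈ s, ∫⁻ x in S l, h x := Finset.sum_le_sum fun l _ => hbE l
      _ ≤ _ := tsum_setLIntegral_truncStop_le s
  · exact fun l => (hsub l).indicator' (hSm l)
  · intro l n
    simp only [b]
    rw [setIntegral_indicator (hSm l), inter_comm]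
    have : S l ∩ dyadicIndex l ⁻¹' {n} =
        dyadicIndex l ⁻¹' ((dyadicIndex l '' S l) ∩ {n}) := by
      rw [preimage_inter, ← eq_preimage_image_dyadicIndex (hScongr l)]
    rw [this]
    refine setIntegral_dyadicIndex_preimage_eq_zero ((hsub l).integrableOn_isBounded ?_)
      fun m => setIntegral_sub_dyadicAvg_eq_zero le_rfl hfl m
    rw [← this]
    exact (isBounded_dyadicCube l n).subset inter_subset_right
  · intro l x
    by_cases hx : x ∈ S l
    · calc dyadicLAvg (fun y => ‖b l y‖ₑ) l x
          ≤ (dyadicVol d l)⁻¹ * (2 * ∫⁻ y in dyadicIndex l ⁻¹' {dyadicIndex l x}, h y) := by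
            rw [dyadicLAvg]; gcongr; exact hb1 l _
        _ = 2 * dyadicLAvg h l x := by rw [dyadicLAvg]; ring
        _ ≤ _ := by gcongr; exact dyadicLAvg_le_of_mem_truncStop hx
    · have : dyadicLAvg (fun y => ‖b l y‖ₑ) l x = 0 := by
        rw [dyadicLAvg, setLIntegral_congr_dyadicCube (c := 0), zero_mul, mul_zero]
        intro y hy
        have hyS : y ∉ S l := fun h => hx (hScongr l _ _ hy h)
        simp only [b]
        rw [indicator_of_notMem hyS, enorm_zero]
      rw [this]; exact zero_le
  · have : ∀ l, ∫⁻ x, ‖b l x‖ₑ ≤ 2 * ∫⁻ x in S l, h x := fun l => by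
      have h1 := hb1 l (dyadicIndex l '' S l)
      rw [← eq_preimage_image_dyadicIndex (hScongr l)] at h1
      refine le_trans (le_of_eq ?_) h1
      rw [← lintegral_indicator (hSm l)]
      congr 1 with x
      simp only [b, ← enorm_indicator_eq_indicator_enorm, indicator_indicator, inter_self]
    calc ∑ l ∈ s, ∫⁻ x, ‖b l x‖ₑ ≤ ∑ l ∈ s, 2 * ∫⁻ x in S l, h x :=
          Finset.sum_le_sum fun l _ => this l
      _ ≤ _ := by
        rw [← Finset.mul_sum]
        gcongr
        exact tsum_setLIntegral_truncStop_le s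
  -- As n₀ < l, this is a genuine stopping level, and 2^(k+1) ≤ 2 · 2^l; a point of it in the ball
  -- would place x in the neighbourhood.
  · intro l k x hk hkl hx y hy
    refine indicator_of_notMem (fun hyS => hx ?_) _
    refine mem_stopNbhd (l := l) ⟨hyS.2.1 (hk.trans_le hkl), hyS.2.2⟩ ?_
    rw [Metric.mem_ball, dist_comm, zpow_add_one₀ two_ne_zero] at hy
    have : (2 : ℝ) ^ k ≤ 2 ^ l := zpow_le_zpow_right₀ one_le_two hkl
    linarith

end WeakType

/-! ### The weak type (1, 1) estimate -/

section WeakTypeEstimate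

variable {d : ℕ} {B : Type*} [NormedAddCommGroup B] [NormedSpace ℝ B] [CompleteSpace B]

lemma memLp_ofReal_of_lintegral_rpow {q : ℝ} (hq : 0 < q) {f : EuclideanSpace ℝ (Fin d) → B}
    (hf : AEStronglyMeasurable f volume) (h : ∫⁻ x, ‖f x‖ₑ ^ q ≠ ∞) :
    MemLp f (ENNReal.ofReal q) volume := by
  refine ⟨hf, ?_⟩
  rw [eLpNorm_lt_top_iff_lintegral_rpow_enorm_lt_top (by simpa using hq) ENNReal.ofReal_ne_top,
    ENNReal.toReal_ofReal hq.le]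
  exact h.lt_top

lemma lintegral_rpow_le_of_le {q : ℝ} (hq : 1 ≤ q) {u : EuclideanSpace ℝ (Fin d) → ℝ≥0∞}
    {M : ℝ≥0∞} (hM : M ≠ ∞) (hu : ∀ x, u x ≤ M) :
    ∫⁻ x, u x ^ q ≤ M ^ (q - 1) * ∫⁻ x, u x := by
  rw [← lintegral_const_mul' _ _ (ENNReal.rpow_ne_top_of_nonneg (by linarith) hM)]
  refine lintegral_mono fun x => ?_
  calc u x ^ q = u x ^ (q - 1) * u x ^ (1 : ℝ) := by
        rw [← ENNReal.rpow_add_of_nonneg _ _ (by linarith) zero_le_one, sub_add_cancel]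
    _ ≤ M ^ (q - 1) * u x := by
        rw [ENNReal.rpow_one]
        gcongr
        exact hu x

/-- Off the neighbourhood of the stopping cubes the short variation is controlled in `L^q`. -/
lemma exists_lintegral_compl_stopNbhd_le (d : ℕ) [NeZero d] {q : ℝ} (hq : 2 ≤ q)
    (hB : MartingaleCotype q B) :
    ∃ C : ℝ≥0∞, C ≠ ∞ ∧ ∀ f : EuclideanSpace ℝ (Fin d) → B, Integrable f volume →
      ∀ c : ℝ≥0∞, c ≠ 0 → c ≠ ∞ →
      ∫⁻ x in (stopNbhd (fun y => ‖f y‖ₑ) c)ᶜ, shortVariation q f x ^ q ≤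
        C * (c ^ (q - 1) * ∫⁻ x, ‖f x‖ₑ) := by
  have hq1 : 1 ≤ q := by linarith
  obtain ⟨C₁, hC₁, hgood⟩ := exists_tsum_lintegral_scaleSup_le (B := B) d hq hB
  obtain ⟨C₂, hC₂, hbad⟩ := exists_lintegral_scaleSup_le_of_mean_zero (B := B) d hq
  obtain ⟨K, hK, hsum⟩ := exists_scaleSup_sum_le (d := d) (B := B) (q := q) (by linarith)
  set r := ENNReal.sqrtTwo⁻¹
  have hr : 2 * (1 - r)⁻¹ ≠ ∞ :=
    ENNReal.two_mul_inv_one_sub_ne_top ENNReal.inv_sqrtTwo_lt_one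
  have hpt : ∀ {a : ℝ≥0∞} {e : ℝ}, a ≠ ∞ → 0 ≤ e → a ^ e ≠ ∞ := fun ha he =>
    ENNReal.rpow_ne_top_of_nonneg he ha
  set D₁ : ℝ≥0∞ := (2 ^ d) ^ (q - 1)
  set D₂ : ℝ≥0∞ := (2 * 2 ^ d) ^ (q - 1)
  have hD₁ : D₁ ≠ ∞ := hpt (by finiteness) (by linarith)
  have hD₂ : D₂ ≠ ∞ := hpt (by finiteness) (by linarith)
  have h2q : (2 : ℝ≥0∞) ^ q ≠ ∞ := hpt (by finiteness) (by linarith)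
  refine ⟨2 ^ q * (C₁ * D₁ + K * (C₂ * (2 * (1 - r)⁻¹ * (D₂ * 2)))), by finiteness,
    fun f hf c hc0 hct => ?_⟩
  set U := (stopNbhd (fun y => ‖f y‖ₑ) c)ᶜ
  have hU : MeasurableSet U := measurableSet_stopNbhd.compl
  have hfl : LocallyIntegrable f volume := hf.locallyIntegrable
  set I := ∫⁻ x, ‖f x‖ₑ
  have hI : I ≠ ∞ := hf.2.ne
  calc ∫⁻ x in U, shortVariation q f x ^ q ≤ ∫⁻ x in U, ∑' k : ℤ, scaleSup q f k x :=
        lintegral_mono fun x => shortVariation_rpow_le (by linarith) f x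
    _ = ∑' k : ℤ, ∫⁻ x in U, scaleSup q f k x :=
        lintegral_tsum fun k => (measurable_scaleSup q hfl k).aemeasurable
    _ ≤ _ := ?_
  -- Only finitely many scales are treated at a time. The floor n₀ of the decomposition is placed
  -- below all of them, and the constants do not depend on it.
  rw [ENNReal.tsum_eq_iSup_sum]
  refine iSup_le fun T => ?_
  obtain ⟨n₀, hn₀⟩ : ∃ n₀ : ℤ, ∀ k ∈ T, n₀ < k := by
    obtain ⟨m, hm⟩ := T.bddBelow
    exact ⟨m - 1, fun k hk => by have := hm hk; omega⟩
  obtain ⟨s, g, b, hs, hdec, hg, hg1, hg2, hb, hb0, hb1, hb2, hb3⟩ :=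
    exists_calderonZygmund_decomposition hf hc0 n₀
  have hbs : LocallyIntegrable (fun x => ∑ l ∈ s, b l x) volume :=
    LocallyIntegrable.finset_sum' fun l _ => hb l
  have hgq : ∫⁻ x, ‖g x‖ₑ ^ q ≤ D₁ * (c ^ (q - 1) * I) := by
    refine (lintegral_rpow_le_of_le hq1 (by finiteness) hg1).trans ?_
    rw [ENNReal.mul_rpow_of_nonneg _ _ (by linarith), mul_assoc]
    gcongr
  have hcq : c ^ (q - 1) ≠ ∞ := hpt hct (by linarith)
  have hgood' : ∑ k ∈ T, ∫⁻ x in U, scaleSup q g k x ≤ C₁ * (D₁ * (c ^ (q - 1) * I)) :=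
    calc ∑ k ∈ T, ∫⁻ x in U, scaleSup q g k x ≤ ∑ k ∈ T, ∫⁻ x, scaleSup q g k x :=
          Finset.sum_le_sum fun k _ => setLIntegral_le_lintegral _ _
      _ ≤ ∑' k, ∫⁻ x, scaleSup q g k x := ENNReal.sum_le_tsum T
      _ ≤ C₁ * ∫⁻ x, ‖g x‖ₑ ^ q := hgood g (memLp_ofReal_of_lintegral_rpow (by linarith)
          hg.aestronglyMeasurable (hgq.trans_lt (by finiteness)).ne)
      _ ≤ _ := by gcongr
  -- For k ≤ l the balls at scale 2^k around points of U miss the support of `b l`. For k > l the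
  -- decay 2^(-|l-k|) beats the weight √2^|l-k| and leaves r^|l-k| with r = 1/√2.
  have hbl : ∀ k ∈ T, ∀ l ∈ s, ENNReal.sqrtTwo ^ (l - k).natAbs *
      ∫⁻ x in U, scaleSup q (b l) k x ≤
      C₂ * (r ^ (l - k).natAbs * (D₂ * (c ^ (q - 1) * ∫⁻ x, ‖b l x‖ₑ))) := by
    intro k hk l hl
    rcases le_or_gt k l with hkl | hlk
    · have : ∫⁻ x in U, scaleSup q (b l) k x = 0 := by
        rw [setLIntegral_congr_fun hU (g := fun _ => 0), lintegral_zero]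
        intro x hx
        change scaleSup q (b l) k x = 0
        rw [scaleSup_congr q (g := fun _ => 0) (hb3 l k x (hn₀ k hk) hkl hx),
          scaleSup_const (by linarith)]
      rw [this, mul_zero]; exact zero_le
    · obtain ⟨n, rfl⟩ := Int.le.dest hlk.le
      have e : (l - (l + n)).natAbs = n := by omega
      rw [e]
      have h1 := hbad (b l) (hb l) l n (hb0 l)
        (fun y => (2 * (2 ^ d * c)) ^ (q - 1) * ‖b l y‖ₑ)
        ((hb l).aestronglyMeasurable.enorm.const_mul _)
        (fun x a b => lintegral_annulus_rpow_le_of_dyadic hq1 (hb1 l) x a b)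
      rw [lintegral_const_mul' _ _ (hpt (by finiteness) (by linarith)), ← mul_assoc 2,
        ENNReal.mul_rpow_of_nonneg _ _ (by linarith), mul_assoc ((2 * 2 ^ d : ℝ≥0∞) ^ (q - 1))] at h1
      calc ENNReal.sqrtTwo ^ n * ∫⁻ x in U, scaleSup q (b l) (l + n) x
          ≤ ENNReal.sqrtTwo ^ n * (C₂ * 2⁻¹ ^ n * (D₂ * (c ^ (q - 1) * ∫⁻ x, ‖b l x‖ₑ))) := by
            gcongr
            exact (setLIntegral_le_lintegral _ _).trans h1
        _ = C₂ * ((ENNReal.sqrtTwo ^ n * 2⁻¹ ^ n) *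
              (D₂ * (c ^ (q - 1) * ∫⁻ x, ‖b l x‖ₑ))) := by ring
        _ = _ := by rw [ENNReal.sqrtTwo_pow_mul_inv_two_pow]
  have hbad' : ∑ k ∈ T, ∫⁻ x in U, scaleSup q (fun x => ∑ l ∈ s, b l x) k x ≤
      K * (C₂ * (2 * (1 - r)⁻¹ * (D₂ * (c ^ (q - 1) * (2 * I))))) :=
    calc ∑ k ∈ T, ∫⁻ x in U, scaleSup q (fun x => ∑ l ∈ s, b l x) k x
        ≤ ∑ k ∈ T, K * ∑ l ∈ s, ENNReal.sqrtTwo ^ (l - k).natAbs *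
            ∫⁻ x in U, scaleSup q (b l) k x := by
          refine Finset.sum_le_sum fun k _ => ?_
          calc ∫⁻ x in U, scaleSup q (fun x => ∑ l ∈ s, b l x) k x
              ≤ ∫⁻ x in U, K * ∑ l ∈ s, ENNReal.sqrtTwo ^ (l - k).natAbs *
                  scaleSup q (b l) k x := lintegral_mono fun x => hsum s k b (fun l _ => hb l) x
            _ = _ := by
              rw [lintegral_const_mul' _ _ hK, lintegral_finsetSum]
              · congr 1
                refine Finset.sum_congr rfl fun l _ => ?_
                rw [lintegral_const_mul' _ _ (ENNReal.pow_ne_top ENNReal.sqrtTwo_ne_top)]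
              · exact fun l _ => (measurable_scaleSup q (hb l) k).const_mul _
      _ ≤ ∑ k ∈ T, K * ∑ l ∈ s,
            C₂ * (r ^ (l - k).natAbs * (D₂ * (c ^ (q - 1) * ∫⁻ x, ‖b l x‖ₑ))) :=
          Finset.sum_le_sum fun k hk => mul_le_mul_right
            (Finset.sum_le_sum fun l hl => hbl k hk l hl) _
      _ = K * (C₂ * ∑ l ∈ s, (∑ k ∈ T, r ^ (k - l).natAbs) *
            (D₂ * (c ^ (q - 1) * ∫⁻ x, ‖b l x‖ₑ))) := by
          rw [← Finset.mul_sum, Finset.sum_comm]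
          simp only [← Finset.mul_sum, Finset.sum_mul,
            show ∀ l k : ℤ, (l - k).natAbs = (k - l).natAbs by omega]
      _ ≤ K * (C₂ * ∑ l ∈ s, (2 * (1 - r)⁻¹) * (D₂ * (c ^ (q - 1) * ∫⁻ x, ‖b l x‖ₑ))) := by
          refine mul_le_mul_right (mul_le_mul_right (Finset.sum_le_sum fun l _ => ?_) _) _
          gcongr
          exact (ENNReal.sum_le_tsum T).trans (ENNReal.tsum_pow_natAbs_sub_le r l)
      _ ≤ _ := by
          simp only [← Finset.mul_sum]
          gcongr
  calc ∑ k ∈ T, ∫⁻ x in U, scaleSup q f k x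
      ≤ ∑ k ∈ T, 2 ^ q * ((∫⁻ x in U, scaleSup q g k x) +
          ∫⁻ x in U, scaleSup q (fun x => ∑ l ∈ s, b l x) k x) := by
        refine Finset.sum_le_sum fun k _ => ?_
        rw [← lintegral_add_left (measurable_scaleSup q hg k), ← lintegral_const_mul' _ _ h2q]
        refine lintegral_mono fun x => ?_
        conv_lhs => rw [hdec]
        exact scaleSup_add_le hq1 hg hbs k x
    _ ≤ 2 ^ q * (C₁ * (D₁ * (c ^ (q - 1) * I)) +
          K * (C₂ * (2 * (1 - r)⁻¹ * (D₂ * (c ^ (q - 1) * (2 * I)))))) := by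
        rw [← Finset.mul_sum, Finset.sum_add_distrib]
        gcongr
    _ = _ := by ring

/-- The weak type `(1, 1)` estimate. -/
lemma exists_mul_volume_shortVariation_le (d : ℕ) [NeZero d] {q : ℝ} (hq : 2 ≤ q)
    (hB : MartingaleCotype q B) :
    ∃ C : ℝ≥0∞, C ≠ ∞ ∧ ∀ f : EuclideanSpace ℝ (Fin d) → B, Integrable f volume →
      ∀ c : ℝ≥0∞, c ≠ 0 → c ≠ ∞ →
      c * volume {x | c < shortVariation q f x} ≤ C * ∫⁻ x, ‖f x‖ₑ := by
  obtain ⟨C, hC, h⟩ := exists_lintegral_compl_stopNbhd_le (B := B) d hq hB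
  refine ⟨5 ^ d + C, by finiteness, fun f hf c hc0 hct => ?_⟩
  set N := stopNbhd (fun y => ‖f y‖ₑ) c
  have hq0 : 0 < q := by linarith
  have hsub : {x | c < shortVariation q f x} ⊆ N ∪ ({x | c < shortVariation q f x} ∩ Nᶜ) := by
    intro x hx
    by_cases hxN : x ∈ N
    exacts [Or.inl hxN, Or.inr ⟨hx, hxN⟩]
  have hcq0 : c ^ (q - 1) ≠ 0 := by
    rw [Ne, ENNReal.rpow_eq_zero_iff]
    push Not
    exact ⟨fun h => absurd h hc0, fun h => absurd h hct⟩
  have hcqt : c ^ (q - 1) ≠ ∞ := ENNReal.rpow_ne_top_of_nonneg (by linarith) hct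
  have hpow : c ^ q = c ^ (q - 1) * c := by
    conv_rhs => rw [← ENNReal.rpow_one c]
    rw [← ENNReal.rpow_mul, one_mul, ← ENNReal.rpow_add _ _ hc0 hct, sub_add_cancel]
  have hmeas : MeasurableSet {x | c < shortVariation q f x} :=
    measurableSet_lt measurable_const (measurable_shortVariation hq0 hf.locallyIntegrable)
  -- Chebyshev's inequality at the power q, after which the factor c^(q-1) is cancelled.
  have h2 : c * volume ({x | c < shortVariation q f x} ∩ Nᶜ) ≤ C * ∫⁻ x, ‖f x‖ₑ := by
    rw [← ENNReal.mul_le_mul_iff_right hcq0 hcqt, ← mul_assoc, ← hpow, mul_left_comm]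
    refine le_trans ?_ (h f hf c hc0 hct)
    rw [← setLIntegral_const]
    refine (setLIntegral_mono' (hmeas.inter measurableSet_stopNbhd.compl) fun x hx => ?_).trans
      (lintegral_mono_set inter_subset_right)
    exact ENNReal.rpow_le_rpow (le_of_lt hx.1) hq0.le
  calc c * volume {x | c < shortVariation q f x}
      ≤ c * (volume N + volume ({x | c < shortVariation q f x} ∩ Nᶜ)) := by
        gcongr
        exact (measure_mono hsub).trans (measure_union_le _ _)
    _ ≤ _ := by
        rw [mul_add, add_mul]
        exact add_le_add mul_volume_stopNbhd_le h2

end WeakTypeEstimate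

/-! ### Comparing short variations at different points -/

section Oscillation

variable {d : ℕ} {B : Type*} [NormedAddCommGroup B] [NormedSpace ℝ B]

lemma ENNReal.Lp_le_Lp_add_Lp {ι : Type*} {q : ℝ} (hq : 1 ≤ q) {u v w : ι → ℝ≥0∞}
    (h : ∀ i, u i ≤ v i + w i) :
    (∑' i, u i ^ q) ^ (1 / q) ≤ (∑' i, v i ^ q) ^ (1 / q) + (∑' i, w i ^ q) ^ (1 / q) := by
  have hq0 : 0 < q := by linarith
  rw [one_div, ENNReal.rpow_inv_le_iff hq0, ENNReal.tsum_eq_iSup_sum]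
  refine iSup_le fun s => ?_
  rw [← ENNReal.rpow_inv_le_iff hq0, ← one_div]
  calc (∑ i ∈ s, u i ^ q) ^ (1 / q) ≤ (∑ i ∈ s, (v i + w i) ^ q) ^ (1 / q) := by
        gcongr with i; exact h i
    _ ≤ (∑ i ∈ s, v i ^ q) ^ (1 / q) + (∑ i ∈ s, w i ^ q) ^ (1 / q) :=
        ENNReal.Lp_add_le s v w hq
    _ ≤ _ := by gcongr <;> exact ENNReal.sum_le_tsum s

/-- A comparison principle for short variations. -/
lemma shortVariation_le_add {q : ℝ} (hq : 1 ≤ q) {f g : EuclideanSpace ℝ (Fin d) → B}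
    {x x' : EuclideanSpace ℝ (Fin d)} {M : ℝ≥0∞} (w : (ℕ → ℝ) → ℕ → ℝ≥0∞)
    (h1 : ∀ t, StrictMono t → (∀ i, 0 < t i) → ∀ i,
      ‖ballAverage f (t (i + 1)) x - ballAverage f (t i) x‖ₑ ≤
        ‖ballAverage g (t (i + 1)) x' - ballAverage g (t i) x'‖ₑ + w t i)
    (h2 : ∀ t, StrictMono t → (∀ i, 0 < t i) →
      (∑' k : ℤ, ∑' i : scaleIndices k t, w t i ^ q) ^ (1 / q) ≤ M) :
    shortVariation q f x ≤ shortVariation q g x' + M := by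
  refine shortVariation_le fun t ht ht0 => ?_
  refine le_trans ?_ (add_le_add (le_shortVariation q g ht ht0 x') (h2 t ht ht0))
  simp only [scaleVariation]
  simp only [← ENNReal.tsum_sigma (β := fun k : ℤ => scaleIndices k t)
    (f := fun _ i => ‖ballAverage f (t (i.1 + 1)) x - ballAverage f (t i.1) x‖ₑ ^ q),
    ← ENNReal.tsum_sigma (β := fun k : ℤ => scaleIndices k t)
    (f := fun _ i => ‖ballAverage g (t (i.1 + 1)) x' - ballAverage g (t i.1) x'‖ₑ ^ q),
    ← ENNReal.tsum_sigma (β := fun k : ℤ => scaleIndices k t) (f := fun _ i => w t i.1 ^ q)]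
  exact ENNReal.Lp_le_Lp_add_Lp hq
    (u := fun p : Σ k : ℤ, scaleIndices k t =>
      ‖ballAverage f (t (p.2.1 + 1)) x - ballAverage f (t p.2.1) x‖ₑ)
    (v := fun p => ‖ballAverage g (t (p.2.1 + 1)) x' - ballAverage g (t p.2.1) x'‖ₑ)
    (w := fun p => w t p.2.1) fun p => h1 t ht ht0 _

lemma shortVariation_le_add_shortVariation {q : ℝ} (hq : 1 ≤ q)
    {f g h : EuclideanSpace ℝ (Fin d) → B} (x : EuclideanSpace ℝ (Fin d))
    (H : ∀ t s, ‖ballAverage f t x - ballAverage f s x‖ₑ ≤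
      ‖ballAverage g t x - ballAverage g s x‖ₑ + ‖ballAverage h t x - ballAverage h s x‖ₑ) :
    shortVariation q f x ≤ shortVariation q g x + shortVariation q h x :=
  shortVariation_le_add hq
    (fun t i => ‖ballAverage h (t (i + 1)) x - ballAverage h (t i) x‖ₑ)
    (fun _ _ _ _ => H _ _) fun _ ht ht0 => le_shortVariation q h ht ht0 x

lemma shortVariation_add_le {q : ℝ} (hq : 1 ≤ q) {f g : EuclideanSpace ℝ (Fin d) → B}
    (hf : LocallyIntegrable f volume) (hg : LocallyIntegrable g volume)
    (x : EuclideanSpace ℝ (Fin d)) :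
    shortVariation q (fun y => f y + g y) x ≤ shortVariation q f x + shortVariation q g x := by
  refine shortVariation_le_add_shortVariation hq x fun t s => ?_
  rw [ballAverage_add hf hg, ballAverage_add hf hg, add_sub_add_comm]
  exact enorm_add_le _ _

lemma shortVariation_right_le {q : ℝ} (hq : 1 ≤ q) {f g : EuclideanSpace ℝ (Fin d) → B}
    (hf : LocallyIntegrable f volume) (hg : LocallyIntegrable g volume)
    (x : EuclideanSpace ℝ (Fin d)) :
    shortVariation q g x ≤ shortVariation q (fun y => f y + g y) x + shortVariation q f x := by
  refine shortVariation_le_add_shortVariation hq x fun t s => ?_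
  rw [ballAverage_add hf hg, ballAverage_add hf hg, add_sub_add_comm]
  have : ballAverage g t x - ballAverage g s x =
      (ballAverage f t x - ballAverage f s x + (ballAverage g t x - ballAverage g s x)) -
        (ballAverage f t x - ballAverage f s x) := by abel
  conv_lhs => rw [this]
  exact enorm_sub_le

lemma volume_ball_two_zpow_succ (x : EuclideanSpace ℝ (Fin d)) (k : ℤ) :
    volume (Metric.ball x ((2 : ℝ) ^ (k + 1))) = 2 ^ d * ballVol d (2 ^ k) := by
  rw [volume_ball_eq_ballVol, zpow_add_one₀ two_ne_zero, mul_comm,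
    ballVol_mul two_pos (two_zpow_pos k), ENNReal.ofReal_pow (by positivity)]
  simp

lemma tsum_scaleIndices_enorm_le {f : EuclideanSpace ℝ (Fin d) → B}
    (hf : LocallyIntegrable f volume) (k : ℤ) (x : EuclideanSpace ℝ (Fin d)) {t : ℕ → ℝ}
    (ht : StrictMono t) :
    ∑' i : scaleIndices k t, ‖ballAverage f (t (i.1 + 1)) x - ballAverage f (t i.1) x‖ₑ ≤
      (1 + 2 ^ d) * ((ballVol d (2 ^ k))⁻¹ * ∫⁻ y in Metric.ball x (2 ^ (k + 1)), ‖f y‖ₑ) := by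
  refine (tsum_enorm_ballAverage_sub_le hf x (two_zpow_pos k) ht
    (S := Metric.ball x (2 ^ (k + 1))) (Φ := ∫⁻ y in Metric.ball x (2 ^ (k + 1)), ‖f y‖ₑ)
    (fun i hi => (le_of_mem_scaleIndices ht hi).1)
    (fun i hi => sdiff_subset.trans (Metric.ball_subset_ball (le_of_mem_scaleIndices ht hi).2))
    (fun i hi => ?_)).trans ?_
  · refine (enorm_integral_le_lintegral_enorm _).trans (lintegral_mono_set ?_)
    exact Metric.ball_subset_ball
      ((ht (Nat.lt_succ_self i)).le.trans (le_of_mem_scaleIndices ht hi).2)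
  · rw [volume_ball_two_zpow_succ]
    set v := ballVol d ((2 : ℝ) ^ k)
    set J := ∫⁻ y in Metric.ball x (2 ^ (k + 1)), ‖f y‖ₑ
    have hv0 : v ≠ 0 := ballVol_ne_zero (two_zpow_pos k)
    have hvt : v ≠ ∞ := ballVol_ne_top _
    have : v⁻¹ ^ 2 * J * (2 ^ d * v) = 2 ^ d * (v⁻¹ * J) := by
      calc v⁻¹ ^ 2 * J * (2 ^ d * v) = 2 ^ d * (v⁻¹ * J) * (v⁻¹ * v) := by ring
        _ = _ := by rw [ENNReal.inv_mul_cancel hv0 hvt, mul_one]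
    rw [this, add_mul, one_mul]

lemma enorm_setIntegral_sub_setIntegral_le {f : EuclideanSpace ℝ (Fin d) → B}
    {S T U : Set (EuclideanSpace ℝ (Fin d))} (hS : MeasurableSet S) (hT : MeasurableSet T)
    (hfS : IntegrableOn f S volume) (hfT : IntegrableOn f T volume) (h1 : S \ T ⊆ U)
    (h2 : T \ S ⊆ U) :
    ‖(∫ y in S, f y) - ∫ y in T, f y‖ₑ ≤ 2 * ∫⁻ y in U, ‖f y‖ₑ := by
  rw [← integral_inter_add_sdiff hT hfS, ← integral_inter_add_sdiff hS hfT, inter_comm T S,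
    add_sub_add_left_eq_sub, two_mul]
  refine enorm_sub_le.trans (add_le_add ?_ ?_)
  · exact (enorm_integral_le_lintegral_enorm _).trans (lintegral_mono_set h1)
  · exact (enorm_integral_le_lintegral_enorm _).trans (lintegral_mono_set h2)

/-- Regularity of ball averages in the space variable. -/
lemma enorm_ballAverage_sub_ballAverage_le {f : EuclideanSpace ℝ (Fin d) → B}
    (hf : LocallyIntegrable f volume) {c x x' : EuclideanSpace ℝ (Fin d)} {R a t : ℝ}
    (hx : dist x c < R) (hx' : dist x' c < R) (ha : 0 < a) (hat : a ≤ t) :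
    ‖ballAverage f t x - ballAverage f t x'‖ₑ ≤
      (ballVol d a)⁻¹ * (2 * ∫⁻ y in annulus c (t - R) (t + R), ‖f y‖ₑ) := by
  have hpos : 0 < (ballVol d t).toReal :=
    ENNReal.toReal_pos (ballVol_ne_zero (ha.trans_le hat)) (ballVol_ne_top t)
  rw [ballAverage_eq, ballAverage_eq, ← smul_sub, enorm_smul,
    Real.enorm_of_nonneg (inv_nonneg.2 hpos.le), ENNReal.ofReal_inv_of_pos hpos,
    ENNReal.ofReal_toReal (ballVol_ne_top t)]
  have key : ∀ {z z' : EuclideanSpace ℝ (Fin d)}, dist z c < R → dist z' c < R →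
      Metric.ball z t \ Metric.ball z' t ⊆ annulus c (t - R) (t + R) := by
    rintro z z' hz hz' y ⟨hy, hy'⟩
    rw [Metric.mem_ball] at hy hy'
    rw [mem_annulus]
    constructor
    · linarith [dist_triangle y z c]
    · linarith [dist_triangle_right y z' c]
  gcongr
  · exact ballVol_mono hat
  · exact enorm_setIntegral_sub_setIntegral_le measurableSet_ball measurableSet_ball
      (hf.integrableOn_isBounded Metric.isBounded_ball)
      (hf.integrableOn_isBounded Metric.isBounded_ball) (key hx hx') (key hx' hx)

end Oscillation

/-! ### Far parts oscillate little -/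

section OscillationBound

variable {d : ℕ} {B : Type*} [NormedAddCommGroup B] [NormedSpace ℝ B]

lemma setLIntegral_rpow_le {q : ℝ} (hq : 1 ≤ q) {f : EuclideanSpace ℝ (Fin d) → B}
    (hf : AEStronglyMeasurable f volume) (S : Set (EuclideanSpace ℝ (Fin d))) :
    (∫⁻ y in S, ‖f y‖ₑ) ^ q ≤ volume S ^ (q - 1) * ∫⁻ y in S, ‖f y‖ₑ ^ q := by
  have := lintegral_rpow_le_measure_rpow_mul (volume.restrict S) hq hf.restrict.enorm
  rwa [Measure.restrict_apply_univ] at this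

lemma setLIntegral_ball_le_of_rpow {q : ℝ} (hq : 1 ≤ q) {f : EuclideanSpace ℝ (Fin d) → B}
    (hf : AEStronglyMeasurable f volume) {c : EuclideanSpace ℝ (Fin d)} {r : ℝ} (hr : 0 < r)
    {m : ℝ≥0∞} (h : ∫⁻ y in Metric.ball c r, ‖f y‖ₑ ^ q ≤ m ^ q * ballVol d r) :
    ∫⁻ y in Metric.ball c r, ‖f y‖ₑ ≤ m * ballVol d r := by
  have hq0 : 0 < q := by linarith
  rw [← ENNReal.rpow_le_rpow_iff hq0]
  refine (setLIntegral_rpow_le hq hf _).trans ?_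
  rw [volume_ball_eq_ballVol, ENNReal.mul_rpow_of_nonneg _ _ hq0.le]
  refine (mul_le_mul_right h _).trans (le_of_eq ?_)
  have : ballVol d r ^ q = ballVol d r ^ (q - 1) * ballVol d r := by
    conv_rhs => rw [← ENNReal.rpow_one (ballVol d r), ← ENNReal.rpow_mul, one_mul,
      ← ENNReal.rpow_add _ _ (ballVol_ne_zero hr) (ballVol_ne_top r)]
    simp
  rw [this]; ring

lemma ballVol_mul_two_zpow {a : ℝ} (ha : 0 < a) (k : ℤ) :
    ballVol d (a * 2 ^ k) = ENNReal.ofReal (a ^ d) * ballVol d (2 ^ k) :=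
  ballVol_mul ha (two_zpow_pos k)

lemma volume_annulus_two_zpow_le [NeZero d] (c : EuclideanSpace ℝ (Fin d)) {R t : ℝ} {k : ℤ}
    (hR : 0 ≤ R) (ht : t + R ≤ 4 * 2 ^ k) :
    volume (annulus c (t - R) (t + R)) ≤
      ENNReal.ofReal (2 * d * 4 ^ (d - 1)) * (ENNReal.ofReal (R / 2 ^ k) * ballVol d (2 ^ k)) := by
  refine (volume_annulus_le c (by linarith) ht (by positivity)).trans (le_of_eq ?_)
  have h2 := two_zpow_pos k
  rw [ballVol_eq h2, ← mul_assoc, ← mul_assoc, ← ENNReal.ofReal_mul (by positivity),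
    ← ENNReal.ofReal_mul (by positivity)]
  congr 2
  have hd : ((2 : ℝ) ^ k) ^ d = (2 ^ k) ^ (d - 1) * 2 ^ k := by
    rw [← pow_succ, Nat.sub_add_cancel (NeZero.one_le)]
  rw [hd, mul_pow]
  field_simp
  ring

/-- Interpolation between ℓ^1 and ℓ^∞ at one scale. The total variation at either point is at most a
multiple of m. Each single difference between x and x' is an integral over annuli of width about R,
and Jensen's inequality makes its q-th power at most a multiple of m^q (R / 2^k)^(q-1). -/
lemma exists_rpow_scale_sum_le (d : ℕ) [NeZero d] {q : ℝ} (hq : 2 ≤ q) :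
    ∃ C : ℝ≥0∞, C ≠ ∞ ∧ ∀ (g : EuclideanSpace ℝ (Fin d) → B), LocallyIntegrable g volume →
      ∀ (c : EuclideanSpace ℝ (Fin d)) (R : ℝ) (m : ℝ≥0∞), 0 < R →
      (∀ r, R ≤ r → ∫⁻ y in Metric.ball c r, ‖g y‖ₑ ^ q ≤ m ^ q * ballVol d r) →
      ∀ x ∈ Metric.ball c R, ∀ x' ∈ Metric.ball c R, ∀ k : ℤ, R ≤ 2 ^ k →
      ∀ t : ℕ → ℝ, StrictMono t →
      ∑' i : scaleIndices k t, ‖(ballAverage g (t (i.1 + 1)) x - ballAverage g (t i.1) x) -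
        (ballAverage g (t (i.1 + 1)) x' - ballAverage g (t i.1) x')‖ₑ ^ q ≤
        C * m ^ q * ENNReal.ofReal (R / 2 ^ k) ^ (1 / 2 : ℝ) := by
  have hq0 : 0 < q := by linarith
  have hq1 : 1 ≤ q := by linarith
  set D : ℝ≥0∞ := ENNReal.ofReal (2 * d * 4 ^ (d - 1)) with hD
  set F : ℝ≥0∞ := ENNReal.ofReal (4 ^ d) with hF
  set G : ℝ≥0∞ := (4 ^ q * D ^ (q - 1) * F) ^ ((q - 1) / q) * (2 * ((1 + 2 ^ d) * F)) with hG
  refine ⟨G, ?_, fun g hg c R m hR hm x hx x' hx' k hk t ht => ?_⟩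
  · refine ENNReal.mul_ne_top (ENNReal.rpow_ne_top_of_nonneg (by positivity)
      (ENNReal.mul_ne_top (ENNReal.mul_ne_top ?_ ?_) ENNReal.ofReal_ne_top)) ?_
    · exact ENNReal.rpow_ne_top_of_nonneg hq0.le (by simp)
    · exact ENNReal.rpow_ne_top_of_nonneg (by linarith) ENNReal.ofReal_ne_top
    · exact ENNReal.mul_ne_top (by simp) (ENNReal.mul_ne_top (by simp) ENNReal.ofReal_ne_top)
  set v := ballVol d ((2 : ℝ) ^ k) with hv
  have h2 := two_zpow_pos k
  have hv0 : v ≠ 0 := ballVol_ne_zero h2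
  have hvt : v ≠ ∞ := ballVol_ne_top _
  set s := ENNReal.ofReal (R / 2 ^ k) with hs
  have hs1 : s ≤ 1 := by
    rw [hs, ENNReal.ofReal_le_one]; exact (div_le_one h2).2 hk
  have h4 : R ≤ 4 * 2 ^ k := by linarith
  have hm4 : ∫⁻ y in Metric.ball c (4 * 2 ^ k), ‖g y‖ₑ ^ q ≤ m ^ q * (F * v) := by
    rw [hF, hv, ← ballVol_mul_two_zpow (by norm_num)]
    exact hm _ h4
  -- the `ℓ¹` bound
  have hl1 : ∀ z ∈ Metric.ball c R,
      ∑' i : scaleIndices k t, ‖ballAverage g (t (i.1 + 1)) z - ballAverage g (t i.1) z‖ₑ ≤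
        (1 + 2 ^ d) * F * m := by
    intro z hz
    refine (tsum_scaleIndices_enorm_le hg k z ht).trans ?_
    have hsub : Metric.ball z ((2 : ℝ) ^ (k + 1)) ⊆ Metric.ball c (4 * 2 ^ k) := by
      refine Metric.ball_subset_ball' ?_
      rw [zpow_add_one₀ two_ne_zero]
      linarith [Metric.mem_ball.1 hz]
    have h1 : ∫⁻ y in Metric.ball z (2 ^ (k + 1)), ‖g y‖ₑ ≤ m * (F * v) := by
      refine (lintegral_mono_set hsub).trans ?_
      rw [hF, hv, ← ballVol_mul_two_zpow (by norm_num)]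
      exact setLIntegral_ball_le_of_rpow hq1 hg.aestronglyMeasurable (by positivity) (hm _ h4)
    calc (1 + 2 ^ d) * (v⁻¹ * ∫⁻ y in Metric.ball z (2 ^ (k + 1)), ‖g y‖ₑ)
        ≤ (1 + 2 ^ d) * (v⁻¹ * (m * (F * v))) := by gcongr
      _ = (1 + 2 ^ d) * F * m * (v⁻¹ * v) := by ring
      _ = _ := by rw [ENNReal.inv_mul_cancel hv0 hvt, mul_one]
  -- the uniform bound
  have hsup1 : ∀ τ, 2 ^ k ≤ τ → τ ≤ 2 ^ (k + 1) →
      ‖ballAverage g τ x - ballAverage g τ x'‖ₑ ^ q ≤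
        2 ^ q * (D ^ (q - 1) * s ^ (q - 1) * m ^ q * F) := by
    intro τ h1 h3
    rw [zpow_add_one₀ two_ne_zero] at h3
    have hann : ∫⁻ y in annulus c (τ - R) (τ + R), ‖g y‖ₑ ^ q ≤ m ^ q * (F * v) := by
      refine (lintegral_mono_set ?_).trans hm4
      exact sdiff_subset.trans (Metric.ball_subset_ball (by linarith))
    have hvol := volume_annulus_two_zpow_le (d := d) c (t := τ) (k := k) hR.le (by linarith)
    calc ‖ballAverage g τ x - ballAverage g τ x'‖ₑ ^ q
        ≤ (v⁻¹ * (2 * ∫⁻ y in annulus c (τ - R) (τ + R), ‖g y‖ₑ)) ^ q := by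
          gcongr
          exact enorm_ballAverage_sub_ballAverage_le hg hx hx' h2 h1
      _ = 2 ^ q * (v⁻¹ ^ q * (∫⁻ y in annulus c (τ - R) (τ + R), ‖g y‖ₑ) ^ q) := by
          rw [ENNReal.mul_rpow_of_nonneg _ _ hq0.le, ENNReal.mul_rpow_of_nonneg _ _ hq0.le]; ring
      _ ≤ 2 ^ q * (v⁻¹ ^ q * ((D * (s * v)) ^ (q - 1) * (m ^ q * (F * v)))) := by
          gcongr 2 ^ q * (v⁻¹ ^ q * ?_)
          refine (setLIntegral_rpow_le hq1 hg.aestronglyMeasurable _).trans ?_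
          gcongr
      _ = 2 ^ q * (D ^ (q - 1) * s ^ (q - 1) * m ^ q * F) * (v⁻¹ ^ q * (v ^ (q - 1) * v)) := by
          rw [ENNReal.mul_rpow_of_nonneg _ _ (by linarith),
            ENNReal.mul_rpow_of_nonneg _ _ (by linarith)]; ring
      _ = _ := by
          have : v ^ (q - 1) * v = v ^ q := by
            conv_lhs => rw [← ENNReal.rpow_one v, ← ENNReal.rpow_mul, one_mul,
              ← ENNReal.rpow_add _ _ hv0 hvt]
            simp
          rw [this, ← ENNReal.mul_rpow_of_nonneg _ _ hq0.le, ENNReal.inv_mul_cancel hv0 hvt,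
            ENNReal.one_rpow, mul_one]
  set e : scaleIndices k t → ℝ≥0∞ := fun i =>
    ‖(ballAverage g (t (i.1 + 1)) x - ballAverage g (t i.1) x) -
        (ballAverage g (t (i.1 + 1)) x' - ballAverage g (t i.1) x')‖ₑ with he
  have hsup : ∀ i, e i ≤ ((4 ^ q * D ^ (q - 1) * F) * (m ^ q * s ^ (q - 1))) ^ (1 / q) := by
    intro i
    obtain ⟨hi1, hi2⟩ := le_of_mem_scaleIndices ht i.2
    have hi3 := ht (Nat.lt_succ_self i.1)
    have hb : ∀ τ, 2 ^ k ≤ τ → τ ≤ 2 ^ (k + 1) → ‖ballAverage g τ x - ballAverage g τ x'‖ₑ ≤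
        2 * ((D ^ (q - 1) * s ^ (q - 1) * m ^ q * F)) ^ (1 / q) := by
      intro τ h1 h3
      rw [← ENNReal.rpow_le_rpow_iff hq0, ENNReal.mul_rpow_of_nonneg _ _ hq0.le,
        ← ENNReal.rpow_mul, one_div_mul_cancel hq0.ne', ENNReal.rpow_one]
      exact hsup1 τ h1 h3
    have : e i ≤ 4 * (D ^ (q - 1) * s ^ (q - 1) * m ^ q * F) ^ (1 / q) := by
      calc e i = ‖(ballAverage g (t (i.1 + 1)) x - ballAverage g (t (i.1 + 1)) x') -
            (ballAverage g (t i.1) x - ballAverage g (t i.1) x')‖ₑ := by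
            simp only [he]; rw [sub_sub_sub_comm]
        _ ≤ _ := enorm_sub_le
        _ ≤ _ := add_le_add (hb _ (hi1.trans hi3.le) hi2) (hb _ hi1 (hi3.le.trans hi2))
        _ = _ := by ring
    refine this.trans (le_of_eq ?_)
    have h4q : (4 : ℝ≥0∞) = (4 ^ q) ^ (1 / q) := by
      rw [← ENNReal.rpow_mul, mul_one_div_cancel hq0.ne', ENNReal.rpow_one]
    conv_lhs => rw [h4q]
    rw [← ENNReal.mul_rpow_of_nonneg _ _ (by positivity)]
    congr 1; ring
  have hsum : ∑' i, e i ≤ 2 * ((1 + 2 ^ d) * F) * m := by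
    calc ∑' i, e i ≤ ∑' i : scaleIndices k t,
          (‖ballAverage g (t (i.1 + 1)) x - ballAverage g (t i.1) x‖ₑ +
            ‖ballAverage g (t (i.1 + 1)) x' - ballAverage g (t i.1) x'‖ₑ) :=
          ENNReal.tsum_le_tsum fun i => enorm_sub_le
      _ = _ := ENNReal.tsum_add
      _ ≤ _ := add_le_add (hl1 x hx) (hl1 x' hx')
      _ = _ := by ring
  refine (ENNReal.tsum_rpow_le_mul_tsum hq1 hsup).trans ?_
  rw [← ENNReal.rpow_mul, show 1 / q * (q - 1) = (q - 1) / q by ring]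
  have hqq : 0 ≤ (q - 1) / q := by positivity
  rw [ENNReal.mul_rpow_of_nonneg (_ * F) _ hqq, ENNReal.mul_rpow_of_nonneg (m ^ q) _ hqq,
    ← ENNReal.rpow_mul, ← ENNReal.rpow_mul, mul_div_cancel₀ _ hq0.ne']
  -- The exponent (q - 1)² / q is at least 1/2 exactly because q ≥ 2; with s ≤ 1 the power may be
  -- lowered to 1/2, a geometric rate independent of q.
  have hse : s ^ ((q - 1) * ((q - 1) / q)) ≤ s ^ (1 / 2 : ℝ) := by
    refine ENNReal.rpow_le_rpow_of_exponent_ge hs1 ?_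
    rw [← mul_div_assoc, le_div_iff₀ hq0]
    nlinarith
  have hmq : m ^ (q - 1) * m = m ^ q := by
    conv_lhs => rw [← ENNReal.rpow_one m, ← ENNReal.rpow_mul, one_mul,
      ← ENNReal.rpow_add_of_nonneg _ _ (by linarith) zero_le_one]
    simp
  calc _ ≤ (4 ^ q * D ^ (q - 1) * F) ^ ((q - 1) / q) * (m ^ (q - 1) * s ^ (1 / 2 : ℝ)) *
        (2 * ((1 + 2 ^ d) * F) * m) := by gcongr
    _ = G * (m ^ (q - 1) * m) * s ^ (1 / 2 : ℝ) := by rw [hG]; ring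
    _ = _ := by rw [hmq]

/-- The short variation of a function that vanishes near a ball oscillates little on the ball. -/
lemma exists_shortVariation_le_add_of_vanishing (d : ℕ) [NeZero d] {q : ℝ} (hq : 2 ≤ q) :
    ∃ C : ℝ≥0∞, C ≠ ∞ ∧ ∀ (g : EuclideanSpace ℝ (Fin d) → B), LocallyIntegrable g volume →
      ∀ (c : EuclideanSpace ℝ (Fin d)) (R : ℝ) (m : ℝ≥0∞), 0 < R →
      (∀ y ∈ Metric.ball c (16 * R), g y = 0) →
      (∀ r, R ≤ r → ∫⁻ y in Metric.ball c r, ‖g y‖ₑ ^ q ≤ m ^ q * ballVol d r) →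
      ∀ x ∈ Metric.ball c R, ∀ x' ∈ Metric.ball c R,
      shortVariation q g x ≤ shortVariation q g x' + C * m := by
  have hq0 : 0 < q := by linarith
  obtain ⟨C, hC, h⟩ := exists_rpow_scale_sum_le (B := B) d hq
  refine ⟨(C * (2 * (1 - ENNReal.sqrtTwo⁻¹)⁻¹)) ^ (1 / q), ENNReal.rpow_ne_top_of_nonneg
    (by positivity) (ENNReal.mul_ne_top hC
      (ENNReal.two_mul_inv_one_sub_ne_top ENNReal.inv_sqrtTwo_lt_one)),
    fun g hg c R m hR h0 hm x hx x' hx' => ?_⟩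
  refine shortVariation_le_add (by linarith)
    (fun t i => ‖(ballAverage g (t (i + 1)) x - ballAverage g (t i) x) -
        (ballAverage g (t (i + 1)) x' - ballAverage g (t i) x')‖ₑ) ?_ ?_
  · intro t _ _ i
    have := enorm_add_le (ballAverage g (t (i + 1)) x' - ballAverage g (t i) x')
      ((ballAverage g (t (i + 1)) x - ballAverage g (t i) x) -
        (ballAverage g (t (i + 1)) x' - ballAverage g (t i) x'))
    rwa [add_sub_cancel] at this
  intro t ht ht0
  -- Here 2^K < R ≤ 2^(K+1). Scales with 2^(k+1) ≤ 15 R see only the ball of radius 16 R, where g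
  -- vanishes. All others satisfy k ≥ K + 1, and the bounds decay geometrically from there.
  obtain ⟨K, hK1, hK2⟩ := exists_mem_Ioc_zpow (y := (2 : ℝ)) hR one_lt_two
  have hterm : ∀ k : ℤ, ∑' i : scaleIndices k t,
      ‖(ballAverage g (t (i.1 + 1)) x - ballAverage g (t i.1) x) -
        (ballAverage g (t (i.1 + 1)) x' - ballAverage g (t i.1) x')‖ₑ ^ q ≤
      C * m ^ q * ENNReal.sqrtTwo⁻¹ ^ (k - (K + 1)).natAbs := by
    intro k
    by_cases hk : (2 : ℝ) ^ (k + 1) ≤ 15 * R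
    · have hz : ∀ z ∈ Metric.ball c R, ∀ τ ≤ (2 : ℝ) ^ (k + 1), ballAverage g τ z = 0 := by
        intro z hz τ hτ
        rw [ballAverage_congr (g := fun _ => 0) fun y hy => h0 y ?_]
        · simp [ballAverage]
        · refine Metric.ball_subset_ball' ?_ hy
          linarith [Metric.mem_ball.1 hz]
      refine (le_of_eq ?_).trans zero_le
      rw [ENNReal.tsum_eq_zero]
      intro i
      obtain ⟨hi1, hi2⟩ := le_of_mem_scaleIndices ht i.2
      have hi3 := ht (Nat.lt_succ_self i.1)
      rw [hz x hx _ hi2, hz x' hx' _ hi2, hz x hx _ (hi3.le.trans hi2),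
        hz x' hx' _ (hi3.le.trans hi2)]
      simp [hq0]
    · rw [not_le, zpow_add_one₀ two_ne_zero] at hk
      rw [zpow_add_one₀ two_ne_zero] at hK2
      have hKk : K + 1 ≤ k := by
        have : (2 : ℝ) ^ (K + 1) ≤ 2 ^ k := by
          rw [zpow_add_one₀ two_ne_zero]; linarith
        exact (zpow_le_zpow_iff_right₀ one_lt_two).1 this
      obtain ⟨n, rfl⟩ := Int.exists_add_of_le hKk
      refine (h g hg c R m hR hm x hx x' hx' _ (by linarith) t ht).trans ?_
      gcongr
      rw [add_sub_cancel_left, Int.natAbs_natCast]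
      have hs : ENNReal.ofReal (R / 2 ^ (K + 1 + n)) ≤ 2⁻¹ ^ n := by
        have : (2 : ℝ≥0∞)⁻¹ ^ n = ENNReal.ofReal (2⁻¹ ^ n) := by
          rw [ENNReal.ofReal_pow (by positivity), ENNReal.ofReal_inv_of_pos two_pos]; simp
        rw [this]
        refine ENNReal.ofReal_le_ofReal ?_
        rw [div_le_iff₀ (two_zpow_pos _), zpow_add₀ two_ne_zero, zpow_add_one₀ two_ne_zero,
          zpow_natCast, inv_pow]
        field_simp
        linarith
      refine (ENNReal.rpow_le_rpow hs (by norm_num)).trans (le_of_eq ?_)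
      rw [← ENNReal.rpow_natCast, ← ENNReal.rpow_mul, mul_comm, ENNReal.rpow_mul,
        ENNReal.rpow_natCast, ENNReal.sqrtTwo, ENNReal.inv_rpow]
  calc _ ≤ (∑' k : ℤ, C * m ^ q * ENNReal.sqrtTwo⁻¹ ^ (k - (K + 1)).natAbs) ^ (1 / q) := by
        gcongr; exact hterm _
    _ ≤ (C * m ^ q * (2 * (1 - ENNReal.sqrtTwo⁻¹)⁻¹)) ^ (1 / q) := by
        rw [ENNReal.tsum_mul_left]
        gcongr
        exact ENNReal.tsum_pow_natAbs_sub_le _ _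
    _ = _ := by
        rw [mul_right_comm, ENNReal.mul_rpow_of_nonneg _ _ (by positivity), ← ENNReal.rpow_mul,
          mul_one_div_cancel hq0.ne', ENNReal.rpow_one]

end OscillationBound

/-! ### Oscillation on balls and the bound from L^∞ to BMO -/

section OscillationOnBalls

variable {d : ℕ} {B : Type*} [NormedAddCommGroup B] [NormedSpace ℝ B] [CompleteSpace B]

lemma ENNReal.le_mul_of_rpow_le {q : ℝ} (hq : 1 ≤ q) {I J K m v : ℝ≥0∞} (hv0 : v ≠ 0)
    (hvt : v ≠ ∞) (h1 : I ^ q ≤ v ^ (q - 1) * J) (h2 : J ≤ K * m ^ q * v) :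
    I ≤ K ^ (1 / q) * m * v := by
  have hq0 : 0 < q := by linarith
  have hv : v ^ q = v ^ (q - 1) * v := by
    conv_rhs => rw [← ENNReal.rpow_one v, ← ENNReal.rpow_mul, one_mul,
      ← ENNReal.rpow_add _ _ hv0 hvt]
    simp
  rw [← ENNReal.rpow_le_rpow_iff hq0, ENNReal.mul_rpow_of_nonneg _ _ hq0.le,
    ENNReal.mul_rpow_of_nonneg _ _ hq0.le, ← ENNReal.rpow_mul, one_div_mul_cancel hq0.ne',
    ENNReal.rpow_one, hv]
  refine h1.trans ((mul_le_mul_right h2 _).trans (le_of_eq ?_))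
  ring

lemma lintegral_enorm_indicator_rpow {q : ℝ} (hq : 0 < q) (f : EuclideanSpace ℝ (Fin d) → B)
    {S : Set (EuclideanSpace ℝ (Fin d))} (hS : MeasurableSet S) :
    ∫⁻ y, ‖S.indicator f y‖ₑ ^ q = ∫⁻ y in S, ‖f y‖ₑ ^ q := by
  rw [← lintegral_indicator hS]
  refine lintegral_congr fun y => ?_
  by_cases hy : y ∈ S <;> simp [hy, hq]

/-- Oscillation of the short variation on a ball. -/
lemma exists_shortVariation_oscillation_le (d : ℕ) [NeZero d] {q : ℝ} (hq : 2 ≤ q)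
    (hB : MartingaleCotype q B) :
    ∃ C : ℝ≥0∞, C ≠ ∞ ∧ ∀ f : EuclideanSpace ℝ (Fin d) → B, LocallyIntegrable f volume →
      ∀ (c : EuclideanSpace ℝ (Fin d)) (R : ℝ) (m : ℝ≥0∞), 0 < R → m ≠ ∞ →
      (∀ r, R ≤ r → ∫⁻ y in Metric.ball c r, ‖f y‖ₑ ^ q ≤ m ^ q * ballVol d r) →
      (¬ ∀ᵐ x ∂volume.restrict (Metric.ball c R), shortVariation q f x = ∞) →
      ∃ (a : ℝ≥0∞) (W : EuclideanSpace ℝ (Fin d) → ℝ≥0∞), a ≠ ∞ ∧ Measurable W ∧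
        ∫⁻ x in Metric.ball c R, W x ≤ C * m * ballVol d R ∧
        ∀ x ∈ Metric.ball c R, shortVariation q f x ≤ a + W x ∧ a ≤ shortVariation q f x + W x := by
  have hq0 : 0 < q := by linarith
  have hq1 : 1 ≤ q := by linarith
  obtain ⟨C₁, hC₁, h₁⟩ := exists_shortVariation_le_add_of_vanishing (B := B) d hq
  obtain ⟨C₂, hC₂, h₂⟩ := exists_lintegral_shortVariation_rpow_le d hq hB
  set K : ℝ≥0∞ := C₂ * ENNReal.ofReal (16 ^ d) with hK
  have hKt : K ^ (1 / q) ≠ ∞ := ENNReal.rpow_ne_top_of_nonneg (by positivity)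
    (ENNReal.mul_ne_top hC₂ ENNReal.ofReal_ne_top)
  refine ⟨K ^ (1 / q) + C₁, ENNReal.add_ne_top.2 ⟨hKt, hC₁⟩,
    fun f hf c R m hR hmt hm hne => ?_⟩
  set S := Metric.ball c (16 * R) with hS
  have hSm : MeasurableSet S := measurableSet_ball
  set v := ballVol d R with hv
  have hv0 : v ≠ 0 := ballVol_ne_zero hR
  have hvt : v ≠ ∞ := ballVol_ne_top R
  have hf1 : LocallyIntegrable (S.indicator f) volume := hf.indicator hSm
  have hf2 : LocallyIntegrable (Sᶜ.indicator f) volume := hf.indicator hSm.compl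
  have hadd : (fun y => S.indicator f y + Sᶜ.indicator f y) = f := by
    funext y; exact congr_fun (indicator_self_add_compl S f) y
  have hint : ∫⁻ y, ‖S.indicator f y‖ₑ ^ q ≤ m ^ q * (ENNReal.ofReal (16 ^ d) * v) := by
    rw [lintegral_enorm_indicator_rpow hq0 f hSm, hv, ← ballVol_mul (by norm_num) hR]
    exact hm _ (by linarith)
  have hLq := memLp_ofReal_of_lintegral_rpow hq0 hf1.aestronglyMeasurable
    (ne_top_of_le_ne_top (ENNReal.mul_ne_top (ENNReal.rpow_ne_top_of_nonneg hq0.le hmt)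
      (ENNReal.mul_ne_top ENNReal.ofReal_ne_top hvt)) hint)
  have hmeas := measurable_shortVariation hq0 hf1
  have hI : ∫⁻ x in Metric.ball c R, shortVariation q (S.indicator f) x ≤ K ^ (1 / q) * m * v := by
    refine ENNReal.le_mul_of_rpow_le hq1 hv0 hvt
      (J := ∫⁻ x in Metric.ball c R, shortVariation q (S.indicator f) x ^ q) ?_ ?_
    · have := lintegral_rpow_le_measure_rpow_mul (volume.restrict (Metric.ball c R)) hq1
        hmeas.aemeasurable
      rwa [Measure.restrict_apply_univ, volume_ball_eq_ballVol] at this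
    · refine ((setLIntegral_le_lintegral _ _).trans (h₂ _ hLq)).trans
        ((mul_le_mul_right hint _).trans (le_of_eq ?_))
      rw [hK]; ring
  have hIt : K ^ (1 / q) * m * v ≠ ∞ := ENNReal.mul_ne_top (ENNReal.mul_ne_top hKt hmt) hvt
  have hfin : ∀ᵐ x ∂volume.restrict (Metric.ball c R), shortVariation q (S.indicator f) x < ∞ :=
    ae_lt_top hmeas (ne_top_of_le_ne_top hIt hI)
  -- At a base point where both the short variation of f and that of its near part are finite, the
  -- far part is finite too. Its value there is the constant a; elsewhere on the ball it changes by
  -- at most C₁ * m.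
  obtain ⟨x₀, ⟨hx₀, hx₀'⟩, hx₀b⟩ : ∃ x₀, (shortVariation q f x₀ ≠ ∞ ∧
      shortVariation q (S.indicator f) x₀ < ∞) ∧ x₀ ∈ Metric.ball c R := by
    have h3 : ∃ᵐ x ∂volume.restrict (Metric.ball c R), shortVariation q f x ≠ ∞ :=
      fun h => hne (h.mono fun x hx => not_not.1 hx)
    exact ((h3.and_eventually hfin).and_eventually (ae_restrict_mem measurableSet_ball)).exists
  have hcmp : ∀ x ∈ Metric.ball c R, ∀ x' ∈ Metric.ball c R,
      shortVariation q (Sᶜ.indicator f) x ≤ shortVariation q (Sᶜ.indicator f) x' + C₁ * m := by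
    refine h₁ _ hf2 c R m hR (fun y hy => indicator_of_notMem (not_not.2 hy) f) fun r hr => ?_
    refine (lintegral_mono fun y => ?_).trans (hm r hr)
    exact ENNReal.rpow_le_rpow (enorm_indicator_le_enorm_self _ _) hq0.le
  have hle : ∀ x, shortVariation q f x ≤
      shortVariation q (S.indicator f) x + shortVariation q (Sᶜ.indicator f) x := fun x => by
    have := shortVariation_add_le hq1 hf1 hf2 x
    rwa [hadd] at this
  have hge : ∀ x, shortVariation q (Sᶜ.indicator f) x ≤
      shortVariation q f x + shortVariation q (S.indicator f) x := fun x => by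
    have := shortVariation_right_le hq1 hf1 hf2 x
    rwa [hadd] at this
  refine ⟨shortVariation q (Sᶜ.indicator f) x₀,
    fun x => shortVariation q (S.indicator f) x + C₁ * m, ?_, hmeas.add_const _, ?_,
    fun x hx => ⟨?_, ?_⟩⟩
  · exact ne_top_of_le_ne_top (ENNReal.add_ne_top.2 ⟨hx₀, hx₀'.ne⟩) (hge x₀)
  · rw [lintegral_add_right _ measurable_const, lintegral_const, Measure.restrict_apply_univ,
      volume_ball_eq_ballVol, add_mul, add_mul]
    gcongr
  · calc _ ≤ _ := hle x
      _ ≤ shortVariation q (S.indicator f) x +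
          (shortVariation q (Sᶜ.indicator f) x₀ + C₁ * m) := by gcongr; exact hcmp x hx x₀ hx₀b
      _ = _ := by ring
  · calc _ ≤ _ := hcmp x₀ hx₀b x hx
      _ ≤ (shortVariation q f x + shortVariation q (S.indicator f) x) + C₁ * m := by
          gcongr; exact hge x
      _ = _ := by ring

lemma ae_restrict_shortVariation_lt_top {q : ℝ} {f : EuclideanSpace ℝ (Fin d) → B}
    {S : Set (EuclideanSpace ℝ (Fin d))} (hS : MeasurableSet S) {a : ℝ≥0∞}
    {W : EuclideanSpace ℝ (Fin d) → ℝ≥0∞} (ha : a ≠ ∞) (hW : Measurable W)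
    (hWI : ∫⁻ x in S, W x ≠ ∞) (h : ∀ x ∈ S, shortVariation q f x ≤ a + W x) :
    ∀ᵐ x ∂volume.restrict S, shortVariation q f x < ∞ := by
  filter_upwards [ae_lt_top hW hWI, ae_restrict_mem hS] with x hx hxS
  exact (h x hxS).trans_lt (ENNReal.add_lt_top.2 ⟨ha.lt_top, hx⟩)

lemma ae_of_forall_ae_restrict_ball {P : EuclideanSpace ℝ (Fin d) → Prop} (N : ℕ)
    (h : ∀ n : ℕ, N ≤ n → ∀ᵐ x ∂volume.restrict (Metric.ball 0 n), P x) :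
    ∀ᵐ x ∂(volume : Measure (EuclideanSpace ℝ (Fin d))), P x := by
  have h' : ∀ n : ℕ, ∀ᵐ x ∂(volume : Measure (EuclideanSpace ℝ (Fin d))),
      x ∈ Metric.ball (0 : EuclideanSpace ℝ (Fin d)) ((max N n : ℕ) : ℝ) → P x := fun n =>
    (ae_restrict_iff' measurableSet_ball).1 (h _ (le_max_left _ _))
  filter_upwards [ae_all_iff.2 h'] with x hx
  obtain ⟨n, hn⟩ := exists_nat_gt (dist x 0)
  exact hx n (hn.trans_le (by exact_mod_cast le_max_right _ _))

lemma not_ae_restrict_ball_eq_top {c : EuclideanSpace ℝ (Fin d)} {R : ℝ} (hR : 0 < R)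
    {u : EuclideanSpace ℝ (Fin d) → ℝ≥0∞} (hu : ∀ᵐ x ∂volume, u x < ∞) :
    ¬ ∀ᵐ x ∂volume.restrict (Metric.ball c R), u x = ∞ := by
  intro h
  have : ∀ᵐ x ∂volume.restrict (Metric.ball c R), False := by
    filter_upwards [h, ae_restrict_of_ae hu] with x h1 h2 using h2.ne h1
  rw [ae_iff] at this
  simp only [not_false_eq_true, ofPred_true, Measure.restrict_apply_univ] at this
  exact (Metric.measure_ball_pos volume c hR).ne' this

/-- Up to a factor 2 the mean is as good a centre as any constant, so the oscillation may be
measured from the constant a of the oscillation lemma. -/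
lemma lintegral_enorm_sub_integral_le {Ω : Type*} [MeasurableSpace Ω] {ν : Measure Ω}
    [IsProbabilityMeasure ν] {g : Ω → ℝ} (hg : Integrable g ν) (a : ℝ) :
    ∫⁻ x, ‖g x - ∫ y, g y ∂ν‖ₑ ∂ν ≤ 2 * ∫⁻ x, ‖g x - a‖ₑ ∂ν := by
  have h1 : ‖a - ∫ y, g y ∂ν‖ₑ ≤ ∫⁻ x, ‖g x - a‖ₑ ∂ν := by
    have : a - ∫ y, g y ∂ν = -∫ y, (g y - a) ∂ν := by
      rw [integral_sub hg (integrable_const a)]; simp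
    rw [this, enorm_neg]
    exact enorm_integral_le_lintegral_enorm _
  calc ∫⁻ x, ‖g x - ∫ y, g y ∂ν‖ₑ ∂ν
      ≤ ∫⁻ x, (‖g x - a‖ₑ + ‖a - ∫ y, g y ∂ν‖ₑ) ∂ν := by
        refine lintegral_mono fun x => ?_
        have := enorm_add_le (g x - a) (a - ∫ y, g y ∂ν)
        rwa [sub_add_sub_cancel] at this
    _ = ∫⁻ x, ‖g x - a‖ₑ ∂ν + ‖a - ∫ y, g y ∂ν‖ₑ := by
        rw [lintegral_add_right _ measurable_const]; simp
    _ ≤ _ := by rw [two_mul]; gcongr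

lemma measurableSet_cube (c : EuclideanSpace ℝ (Fin d)) (r : ℝ) : MeasurableSet (cube c r) := by
  have : cube c r = ⋂ i, {x : EuclideanSpace ℝ (Fin d) | |x i - c i| ≤ r} := by
    ext x; simp [cube]
  rw [this]
  exact MeasurableSet.iInter fun i => measurableSet_le (by fun_prop) (by fun_prop)

lemma volume_cube (c : EuclideanSpace ℝ (Fin d)) {r : ℝ} (hr : 0 ≤ r) :
    volume (cube c r) = ENNReal.ofReal ((2 * r) ^ d) := by
  have : cube c r = {x | ∀ i, x i ∈ (fun i => Icc (c i - r) (c i + r)) i} := by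
    ext x
    simp only [cube, mem_ofPred_eq, mem_Icc]
    refine forall_congr' fun i => ?_
    rw [abs_le]
    constructor <;> rintro ⟨h1, h2⟩ <;> constructor <;> linarith
  rw [this, EuclideanSpace.volume_setOf_forall_mem _ fun i => measurableSet_Icc]
  simp only [Real.volume_Icc, add_sub_sub_cancel, Finset.prod_const, Finset.card_univ,
    Fintype.card_fin]
  rw [← two_mul, ENNReal.ofReal_pow (by positivity)]

lemma cube_subset_ball [NeZero d] (c : EuclideanSpace ℝ (Fin d)) {r : ℝ} (hr : 0 < r) :
    cube c r ⊆ Metric.ball c (2 * d * r) := by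
  intro x hx
  rw [Metric.mem_ball]
  have hd : (1 : ℝ) ≤ d := by exact_mod_cast NeZero.one_le
  calc dist x c ≤ d * r := EuclideanSpace.dist_le_card_mul hr.le hx
    _ < 2 * d * r := by nlinarith

/-- The short variation maps `L^∞` to `BMO`. -/
lemma exists_bmoSeminorm_shortVariation_le (d : ℕ) [NeZero d] {q : ℝ} (hq : 2 ≤ q)
    (hB : MartingaleCotype q B) :
    ∃ C : ℝ≥0∞, C ≠ ∞ ∧ ∀ f : EuclideanSpace ℝ (Fin d) → B, MemLp f ∞ volume →
      (HasCompactSupport f ∨ ¬ ∀ᵐ x ∂volume, shortVariation q f x = ∞) →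
        (∀ᵐ x ∂volume, shortVariation q f x < ∞) ∧
        LocallyIntegrable (fun x => (shortVariation q f x).toReal) volume ∧
        bmoSeminorm (fun x => (shortVariation q f x).toReal) ≤ C * eLpNorm f ∞ volume := by
  have hq0 : 0 < q := by linarith
  obtain ⟨C₁, hC₁, h₁⟩ := exists_shortVariation_oscillation_le d hq hB
  obtain ⟨C₂, hC₂, h₂⟩ := exists_lintegral_shortVariation_rpow_le d hq hB
  -- The ratio of the volume of the ball of radius 2 d r to that of the cube of side 2 r which it
  -- contains.
  set D := ENNReal.ofReal ((d : ℝ) ^ d) * ballVol d 1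
  refine ⟨2 * (C₁ * D), ENNReal.mul_ne_top (by simp) (ENNReal.mul_ne_top hC₁
    (ENNReal.mul_ne_top ENNReal.ofReal_ne_top (ballVol_ne_top 1))), fun f hf hor => ?_⟩
  have hfl : LocallyIntegrable f volume := hf.locallyIntegrable le_top
  set m := eLpNorm f ∞ volume with hmdef
  have hmt : m ≠ ∞ := hf.eLpNorm_ne_top
  have hfm : ∀ S : Set (EuclideanSpace ℝ (Fin d)),
      ∫⁻ y in S, ‖f y‖ₑ ^ q ≤ m ^ q * volume S := by
    intro S
    rw [← setLIntegral_const]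
    refine lintegral_mono_ae (ae_restrict_of_ae ?_)
    filter_upwards [enorm_ae_le_eLpNormEssSup f volume] with y hy
    rw [hmdef, eLpNorm_exponent_top]
    gcongr
  have hm : ∀ (c : EuclideanSpace ℝ (Fin d)) (R r : ℝ), R ≤ r →
      ∫⁻ y in Metric.ball c r, ‖f y‖ₑ ^ q ≤ m ^ q * ballVol d r := fun c R r _ => by
    rw [← volume_ball_eq_ballVol c]; exact hfm _
  have hmeas := measurable_shortVariation hq0 hfl
  have hIt : ∀ R, C₁ * m * ballVol d R ≠ ∞ := fun R =>
    ENNReal.mul_ne_top (ENNReal.mul_ne_top hC₁ hmt) (ballVol_ne_top R)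
  have hfin : ∀ᵐ x ∂volume, shortVariation q f x < ∞ := by
    rcases hor with hcs | hne
    · have h3 : ∫⁻ y, ‖f y‖ₑ ^ q ≠ ∞ := by
        rw [← setLIntegral_eq_of_support_subset (s := tsupport f)]
        · exact ne_top_of_le_ne_top (ENNReal.mul_ne_top
            (ENNReal.rpow_ne_top_of_nonneg hq0.le hmt) hcs.isCompact.measure_lt_top.ne) (hfm _)
        · refine fun y hy => subset_tsupport f fun h => hy ?_
          simp [h, hq0]
      have h4 := h₂ f (memLp_ofReal_of_lintegral_rpow hq0 hf.1 h3)
      have h5 := ae_lt_top (hmeas.pow_const q)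
        (ne_top_of_le_ne_top (ENNReal.mul_ne_top hC₂ h3) h4)
      filter_upwards [h5] with x hx
      exact (ENNReal.rpow_lt_top_iff_of_pos hq0).1 hx
    -- If the short variation is not a.e. infinite, it is not a.e. infinite on some ball about 0,
    -- hence on no larger one. The oscillation bound then gives finiteness a.e. on each larger ball.
    · obtain ⟨N, hN⟩ : ∃ N : ℕ, ¬ ∀ᵐ x ∂volume.restrict (Metric.ball 0 N),
          shortVariation q f x = ∞ := by
        by_contra! h
        exact hne (ae_of_forall_ae_restrict_ball 0 fun n _ => h n)
      refine ae_of_forall_ae_restrict_ball (N + 1) fun n hn => ?_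
      have hn0 : (0 : ℝ) < n := by exact_mod_cast (by omega : 0 < n)
      obtain ⟨a, W, ha, hW, hWI, haW⟩ := h₁ f hfl 0 n m hn0 hmt (hm 0 n) fun h => hN
        (ae_restrict_of_ae_restrict_of_subset (Metric.ball_subset_ball
          (by exact_mod_cast (by omega : N ≤ n))) h)
      exact ae_restrict_shortVariation_lt_top measurableSet_ball ha hW
        (ne_top_of_le_ne_top (hIt n) hWI) fun x hx => (haW x hx).1
  have hosc : ∀ (c : EuclideanSpace ℝ (Fin d)) (R : ℝ), 0 < R → ∃ (a : ℝ≥0∞)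
      (W : EuclideanSpace ℝ (Fin d) → ℝ≥0∞), a ≠ ∞ ∧ Measurable W ∧
        ∫⁻ x in Metric.ball c R, W x ≤ C₁ * m * ballVol d R ∧
        ∀ x ∈ Metric.ball c R, shortVariation q f x ≤ a + W x ∧ a ≤ shortVariation q f x + W x :=
    fun c R hR => h₁ f hfl c R m hR hmt (hm c R) (not_ae_restrict_ball_eq_top hR hfin)
  have hball : ∀ (c : EuclideanSpace ℝ (Fin d)) (R : ℝ), 0 < R →
      IntegrableOn (fun x => (shortVariation q f x).toReal) (Metric.ball c R) volume := by
    intro c R hR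
    obtain ⟨a, W, ha, hW, hWI, haW⟩ := hosc c R hR
    refine integrable_toReal_of_lintegral_ne_top hmeas.aemeasurable ?_
    refine ne_top_of_le_ne_top ?_ (setLIntegral_mono (g := fun x => a + W x)
      (measurable_const.add hW) fun x hx => (haW x hx).1)
    rw [lintegral_add_left measurable_const, setLIntegral_const]
    exact ENNReal.add_ne_top.2 ⟨ENNReal.mul_ne_top ha measure_ball_lt_top.ne,
      ne_top_of_le_ne_top (hIt R) hWI⟩
  refine ⟨hfin, fun x => ⟨Metric.ball x 1, Metric.ball_mem_nhds x one_pos, hball x 1 one_pos⟩, ?_⟩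
  refine iSup_le fun c => iSup_le fun r => iSup_le fun hr => ?_
  have hd : (0 : ℝ) < d := by exact_mod_cast NeZero.pos d
  obtain ⟨a, W, ha, hW, hWI, haW⟩ := hosc c (2 * d * r) (by positivity)
  have hcv := volume_cube c hr.le
  have hcv0 : volume (cube c r) ≠ 0 := by rw [hcv]; simp; positivity
  have hcvt : volume (cube c r) ≠ ∞ := by rw [hcv]; exact ENNReal.ofReal_ne_top
  have hsub := cube_subset_ball c hr
  have : NeZero (volume.restrict (cube c r)) := ⟨by simpa using hcv0⟩
  have : IsFiniteMeasure (volume.restrict (cube c r)) := ⟨by simpa using hcvt.lt_top⟩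
  have hgi : IntegrableOn (fun x => (shortVariation q f x).toReal) (cube c r) volume :=
    (hball c (2 * d * r) (by positivity)).mono_set hsub
  refine (lintegral_enorm_sub_integral_le (Integrable.to_average hgi) a.toReal).trans ?_
  rw [mul_assoc]
  refine mul_le_mul_right ?_ 2
  rw [lintegral_smul_measure, smul_eq_mul, Measure.restrict_apply_univ]
  have h6 : ∫⁻ x in cube c r, ‖(shortVariation q f x).toReal - a.toReal‖ₑ ≤
      C₁ * D * m * volume (cube c r) := by
    calc ∫⁻ x in cube c r, ‖(shortVariation q f x).toReal - a.toReal‖ₑ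
        ≤ ∫⁻ x in cube c r, W x := by
          refine lintegral_mono_ae ?_
          filter_upwards [ae_restrict_of_ae hfin, ae_restrict_mem (measurableSet_cube c r)]
            with x hx hxc
          obtain ⟨h7, h8⟩ := haW x (hsub hxc)
          by_cases hWx : W x = ∞
          · simp [hWx]
          rw [← ENNReal.ofReal_toReal hWx, Real.enorm_eq_ofReal_abs]
          refine ENNReal.ofReal_le_ofReal (abs_sub_le_iff.2 ⟨?_, ?_⟩)
          · have := ENNReal.toReal_mono (ENNReal.add_ne_top.2 ⟨ha, hWx⟩) h7
            rw [ENNReal.toReal_add ha hWx] at this; linarith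
          · have := ENNReal.toReal_mono (ENNReal.add_ne_top.2 ⟨hx.ne, hWx⟩) h8
            rw [ENNReal.toReal_add hx.ne hWx] at this; linarith
      _ ≤ ∫⁻ x in Metric.ball c (2 * d * r), W x := lintegral_mono_set hsub
      _ ≤ C₁ * m * ballVol d (2 * d * r) := hWI
      _ = _ := by
          rw [hcv, show 2 * d * r = d * (2 * r) by ring, ballVol_mul hd (by positivity),
            ballVol_eq (by positivity : 0 < 2 * r)]
          ring
  calc _ ≤ (volume (cube c r))⁻¹ * (C₁ * D * m * volume (cube c r)) := by gcongr
    _ = C₁ * D * m * ((volume (cube c r))⁻¹ * volume (cube c r)) := by ring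
    _ = _ := by rw [ENNReal.inv_mul_cancel hcv0 hcvt, mul_one]

end OscillationOnBalls

/-! ### Discrete layer cake formulas -/

section GeometricSums

lemma ENNReal.zpow_rpow_le_mul_pow_natAbs {ρ : ℝ≥0∞} (hρ : 1 < ρ) (hρt : ρ ≠ ∞) {s : ℝ}
    {m k : ℤ} (hmk : m ≤ k) :
    (ρ ^ m) ^ s ≤ (ρ ^ k) ^ s * ((ρ ^ s)⁻¹) ^ (m - k).natAbs := by
  have hρ0 : ρ ≠ 0 := (zero_lt_one.trans hρ).ne'
  obtain ⟨n, rfl⟩ := Int.exists_add_of_le hmk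
  have h0 : ρ ^ s ≠ 0 := (ENNReal.rpow_pos (pos_iff_ne_zero.2 hρ0) hρt).ne'
  have ht : ρ ^ s ≠ ∞ := ENNReal.rpow_ne_top_of_ne_zero hρ0 hρt
  have e : (m - (m + (n : ℤ))).natAbs = n := by omega
  rw [e, ENNReal.zpow_add hρ0 hρt, zpow_natCast,
    ENNReal.mul_rpow_of_ne_top (ENNReal.zpow_ne_top hρ0 hρt m) (ENNReal.pow_ne_top hρt), mul_assoc]
  have e2 : (ρ ^ n) ^ s = (ρ ^ s) ^ n := by
    rw [← ENNReal.rpow_natCast, ← ENNReal.rpow_mul, mul_comm, ENNReal.rpow_mul,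
      ENNReal.rpow_natCast]
  rw [e2, ← mul_pow, ENNReal.mul_inv_cancel h0 ht, one_pow, mul_one]

/-- The constant of the geometric sums with ratio `ρ ^ (-s)`. -/
noncomputable def ENNReal.geomConst (ρ : ℝ≥0∞) (s : ℝ) : ℝ≥0∞ := 2 * (1 - (ρ ^ s)⁻¹)⁻¹

lemma ENNReal.geomConst_ne_top {ρ : ℝ≥0∞} (hρ : 1 < ρ) {s : ℝ} (hs : 0 < s) :
    ENNReal.geomConst ρ s ≠ ∞ :=
  ENNReal.two_mul_inv_one_sub_ne_top (ENNReal.inv_lt_one.2 (ENNReal.one_lt_rpow hρ hs))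

lemma ENNReal.tsum_zpow_rpow_le {ρ : ℝ≥0∞} (hρ : 1 < ρ) (hρt : ρ ≠ ∞) (s : ℝ) (k : ℤ) :
    ∑' m : ℤ, (if m ≤ k then (ρ ^ m) ^ s else 0) ≤ (ρ ^ k) ^ s * ENNReal.geomConst ρ s := by
  calc ∑' m : ℤ, (if m ≤ k then (ρ ^ m) ^ s else 0)
      ≤ ∑' m : ℤ, (ρ ^ k) ^ s * ((ρ ^ s)⁻¹) ^ (m - k).natAbs := by
        refine ENNReal.tsum_le_tsum fun m => ?_
        split_ifs with h
        · exact ENNReal.zpow_rpow_le_mul_pow_natAbs hρ hρt h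
        · exact zero_le
    _ ≤ _ := by
        rw [ENNReal.tsum_mul_left]
        gcongr
        exact ENNReal.tsum_pow_natAbs_sub_le _ _

lemma ENNReal.tsum_zpow_rpow_ite_lt_le {ρ : ℝ≥0∞} (hρ : 1 < ρ) (hρt : ρ ≠ ∞) {s : ℝ} (hs : 0 < s)
    {a : ℝ≥0∞} (hat : a ≠ ∞) :
    ∑' m : ℤ, (if ρ ^ m < a then (ρ ^ m) ^ s else 0) ≤ ENNReal.geomConst ρ s * a ^ s := by
  rcases eq_or_ne a 0 with rfl | ha
  · simp
  obtain ⟨k, hk1, hk2⟩ := ENNReal.exists_mem_Ico_zpow ha hat hρ hρt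
  calc ∑' m : ℤ, (if ρ ^ m < a then (ρ ^ m) ^ s else 0)
      ≤ ∑' m : ℤ, (if m ≤ k then (ρ ^ m) ^ s else 0) := by
        refine ENNReal.tsum_le_tsum fun m => ?_
        split_ifs with h1 h2
        · exact le_rfl
        · exact absurd (hk2.trans_le (ENNReal.zpow_le_of_le hρ.le (by omega : k + 1 ≤ m)))
            (not_lt.2 h1.le)
        · exact zero_le
        · exact le_rfl
    _ ≤ (ρ ^ k) ^ s * ENNReal.geomConst ρ s := ENNReal.tsum_zpow_rpow_le hρ hρt s k
    _ ≤ _ := by rw [mul_comm]; gcongr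

lemma ENNReal.tsum_zpow_rpow_neg_ite_le_le {ρ : ℝ≥0∞} (hρ : 1 < ρ) (hρt : ρ ≠ ∞) {s : ℝ}
    (hs : 0 < s) {a : ℝ≥0∞} (ha : a ≠ 0) :
    ∑' m : ℤ, (if a ≤ ρ ^ m then (ρ ^ m) ^ (-s) else 0) ≤ ENNReal.geomConst ρ s * a ^ (-s) := by
  rcases eq_or_ne a ∞ with rfl | hat
  · have : ∀ m : ℤ, ¬ (∞ ≤ ρ ^ m) := fun m =>
      not_le.2 (ENNReal.zpow_lt_top (zero_lt_one.trans hρ).ne' hρt m)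
    simp [this]
  obtain ⟨k, hk1, hk2⟩ := ENNReal.exists_mem_Ioc_zpow ha hat hρ hρt
  have hinv : ∀ m : ℤ, (ρ ^ m) ^ (-s) = (ρ ^ (-m)) ^ s := fun m => by
    rw [ENNReal.rpow_neg, ENNReal.zpow_neg, ENNReal.inv_rpow]
  calc ∑' m : ℤ, (if a ≤ ρ ^ m then (ρ ^ m) ^ (-s) else 0)
      ≤ ∑' m : ℤ, (if -m ≤ -(k + 1) then (ρ ^ (-m)) ^ s else 0) := by
        refine ENNReal.tsum_le_tsum fun m => ?_
        rw [hinv]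
        split_ifs with h1 h2
        · exact le_rfl
        · exact absurd (ENNReal.zpow_le_of_le hρ.le (by omega : m ≤ k))
            (not_le.2 (hk1.trans_le h1))
        · exact zero_le
        · exact le_rfl
    _ = ∑' m : ℤ, (if m ≤ -(k + 1) then (ρ ^ m) ^ s else 0) :=
        (Equiv.neg ℤ).tsum_eq fun m => if m ≤ -(k + 1) then (ρ ^ m) ^ s else 0
    _ ≤ (ρ ^ (-(k + 1))) ^ s * ENNReal.geomConst ρ s := ENNReal.tsum_zpow_rpow_le hρ hρt s _
    _ ≤ _ := by
        rw [mul_comm, ENNReal.rpow_neg, ← ENNReal.inv_rpow, ENNReal.zpow_neg]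
        gcongr

/-- The last term alone suffices for 0 < u < ∞: if ρ^k < u ≤ ρ^(k+1) then u^p ≤ ρ^p (ρ^k)^p. For u =
∞ infinitely many terms are at least 1. -/
lemma ENNReal.rpow_le_mul_tsum_zpow {ρ : ℝ≥0∞} (hρ : 1 < ρ) (hρt : ρ ≠ ∞) {p : ℝ} (hp : 0 < p)
    (u : ℝ≥0∞) : u ^ p ≤ ρ ^ p * ∑' m : ℤ, (if ρ ^ m < u then (ρ ^ m) ^ p else 0) := by
  have hρ0 : ρ ≠ 0 := (zero_lt_one.trans hρ).ne'
  rcases eq_or_ne u 0 with rfl | hu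
  · simp [hp]
  rcases eq_or_ne u ∞ with rfl | hut
  · have h1 : ∀ m : ℤ, ρ ^ m < ∞ := fun m => ENNReal.zpow_lt_top hρ0 hρt m
    simp only [h1, if_true]
    have : ∑' m : ℤ, (ρ ^ m) ^ p = ∞ := by
      refine top_le_iff.1 ?_
      calc ∞ = ∑' _ : ℕ, (1 : ℝ≥0∞) := (ENNReal.tsum_const_eq_top_of_ne_zero one_ne_zero).symm
        _ ≤ ∑' n : ℕ, (ρ ^ (n : ℤ)) ^ p := by
            refine ENNReal.tsum_le_tsum fun n => ENNReal.one_le_rpow ?_ hp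
            rw [zpow_natCast]; exact one_le_pow₀ hρ.le
        _ ≤ _ := ENNReal.tsum_comp_le_tsum_of_injective Nat.cast_injective
            fun m : ℤ => (ρ ^ m) ^ p
    rw [this, ENNReal.mul_top (ENNReal.rpow_pos (pos_iff_ne_zero.2 hρ0) hρt).ne']
    exact le_top
  obtain ⟨k, hk1, hk2⟩ := ENNReal.exists_mem_Ioc_zpow hu hut hρ hρt
  calc u ^ p ≤ (ρ ^ (k + 1)) ^ p := by gcongr
    _ = ρ ^ p * (ρ ^ k) ^ p := by
        rw [ENNReal.zpow_add hρ0 hρt, zpow_one, mul_comm, ENNReal.mul_rpow_of_nonneg _ _ hp.le]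
    _ ≤ _ := by
        gcongr
        refine le_trans ?_ (ENNReal.le_tsum k)
        rw [if_pos hk1]

variable {α : Type*} [MeasurableSpace α] {μ : Measure α}

/-- A discrete layer cake estimate. -/
lemma lintegral_rpow_le_mul_tsum_measure {ρ : ℝ≥0∞} (hρ : 1 < ρ) (hρt : ρ ≠ ∞) {p : ℝ} (hp : 0 < p)
    {u : α → ℝ≥0∞} (hu : Measurable u) :
    ∫⁻ x, u x ^ p ∂μ ≤ ρ ^ p * ∑' m : ℤ, (ρ ^ m) ^ p * μ {x | ρ ^ m < u x} := by
  have hm : ∀ m : ℤ, MeasurableSet {x | ρ ^ m < u x} := fun m => measurableSet_lt measurable_const hu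
  calc ∫⁻ x, u x ^ p ∂μ
      ≤ ∫⁻ x, ρ ^ p * ∑' m : ℤ, {x | ρ ^ m < u x}.indicator (fun _ => (ρ ^ m) ^ p) x ∂μ := by
        refine lintegral_mono fun x => (ENNReal.rpow_le_mul_tsum_zpow hρ hρt hp (u x)).trans ?_
        refine mul_le_mul_right (ENNReal.tsum_le_tsum fun m => ?_) _
        simp [indicator_apply]
    _ = _ := by
        have hm' : ∀ m : ℤ, Measurable ({x | ρ ^ m < u x}.indicator fun _ => (ρ ^ m) ^ p) :=
          fun m => measurable_const.indicator (hm m)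
        rw [lintegral_const_mul _ (Measurable.tsum hm'),
          lintegral_tsum fun m => (hm' m).aemeasurable]
        simp only [lintegral_indicator_const (hm _)]

/-- After exchanging sum and integral, the series in m is geometric with positive exponent p - r
over ρ^m < u(x), so it is dominated by its largest terms, of order u(x)^(p-r). -/
lemma tsum_mul_setLIntegral_lt_le {ρ : ℝ≥0∞} (hρ : 1 < ρ) (hρt : ρ ≠ ∞) {p r : ℝ} (hr : 0 < r)
    (hrp : r < p) {u : α → ℝ≥0∞} (hu : Measurable u) (hut : ∀ x, u x ≠ ∞) :
    ∑' m : ℤ, (ρ ^ m) ^ (p - r) * ∫⁻ x in {x | ρ ^ m < u x}, u x ^ r ∂μ ≤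
      ENNReal.geomConst ρ (p - r) * ∫⁻ x, u x ^ p ∂μ := by
  have hm : ∀ m : ℤ, MeasurableSet {x | ρ ^ m < u x} := fun m => measurableSet_lt measurable_const hu
  have hm' : ∀ m : ℤ, Measurable ({x | ρ ^ m < u x}.indicator fun x => u x ^ r) :=
    fun m => (hu.pow_const r).indicator (hm m)
  calc ∑' m : ℤ, (ρ ^ m) ^ (p - r) * ∫⁻ x in {x | ρ ^ m < u x}, u x ^ r ∂μ
      = ∫⁻ x, ∑' m : ℤ, (ρ ^ m) ^ (p - r) * {x | ρ ^ m < u x}.indicator (fun x => u x ^ r) x ∂μ := by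
        rw [lintegral_tsum fun m => ((hm' m).const_mul _).aemeasurable]
        congr 1 with m
        rw [lintegral_const_mul _ (hm' m), lintegral_indicator (hm m)]
    _ ≤ ∫⁻ x, ENNReal.geomConst ρ (p - r) * u x ^ p ∂μ := by
        refine lintegral_mono fun x => ?_
        calc ∑' m : ℤ, (ρ ^ m) ^ (p - r) * {x | ρ ^ m < u x}.indicator (fun x => u x ^ r) x
            = (∑' m : ℤ, if ρ ^ m < u x then (ρ ^ m) ^ (p - r) else 0) * u x ^ r := by
              rw [← ENNReal.tsum_mul_right]
              congr 1 with m
              by_cases h : ρ ^ m < u x <;> simp [h]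
          _ ≤ ENNReal.geomConst ρ (p - r) * u x ^ (p - r) * u x ^ r := by
              gcongr
              exact ENNReal.tsum_zpow_rpow_ite_lt_le hρ hρt (by linarith) (hut x)
          _ = _ := by
              rw [mul_assoc, ← ENNReal.rpow_add_of_nonneg _ _ (by linarith) hr.le, sub_add_cancel]
    _ = _ := lintegral_const_mul _ (hu.pow_const p)

/-- The dual case: the exponent p - q is negative and the series runs over ρ^m ≥ u(x), so it is of
order u(x)^(p-q). Points with u(x) = 0 contribute nothing and are set apart because of this negative
power. -/
lemma tsum_mul_setLIntegral_le_le {ρ : ℝ≥0∞} (hρ : 1 < ρ) (hρt : ρ ≠ ∞) {p q : ℝ} (hp : 0 < p)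
    (hpq : p < q) {u : α → ℝ≥0∞} (hu : Measurable u) (hut : ∀ x, u x ≠ ∞) :
    ∑' m : ℤ, (ρ ^ m) ^ (p - q) * ∫⁻ x in {x | u x ≤ ρ ^ m}, u x ^ q ∂μ ≤
      ENNReal.geomConst ρ (q - p) * ∫⁻ x, u x ^ p ∂μ := by
  have hm : ∀ m : ℤ, MeasurableSet {x | u x ≤ ρ ^ m} := fun m => measurableSet_le hu measurable_const
  have hm' : ∀ m : ℤ, Measurable ({x | u x ≤ ρ ^ m}.indicator fun x => u x ^ q) :=
    fun m => (hu.pow_const q).indicator (hm m)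
  calc ∑' m : ℤ, (ρ ^ m) ^ (p - q) * ∫⁻ x in {x | u x ≤ ρ ^ m}, u x ^ q ∂μ
      = ∫⁻ x, ∑' m : ℤ, (ρ ^ m) ^ (p - q) * {x | u x ≤ ρ ^ m}.indicator (fun x => u x ^ q) x ∂μ := by
        rw [lintegral_tsum fun m => ((hm' m).const_mul _).aemeasurable]
        congr 1 with m
        rw [lintegral_const_mul _ (hm' m), lintegral_indicator (hm m)]
    _ ≤ ∫⁻ x, ENNReal.geomConst ρ (q - p) * u x ^ p ∂μ := by
        refine lintegral_mono fun x => ?_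
        rcases eq_or_ne (u x) 0 with h0 | h0
        · have hq : 0 < q := hp.trans hpq
          simp [h0, hq]
        calc ∑' m : ℤ, (ρ ^ m) ^ (p - q) * {x | u x ≤ ρ ^ m}.indicator (fun x => u x ^ q) x
            = (∑' m : ℤ, if u x ≤ ρ ^ m then (ρ ^ m) ^ (-(q - p)) else 0) * u x ^ q := by
              rw [← ENNReal.tsum_mul_right]
              congr 1 with m
              by_cases h : u x ≤ ρ ^ m <;> simp [h]
          _ ≤ ENNReal.geomConst ρ (q - p) * u x ^ (-(q - p)) * u x ^ q := by
              gcongr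
              exact ENNReal.tsum_zpow_rpow_neg_ite_le_le hρ hρt (by linarith) h0
          _ = _ := by
              rw [mul_assoc, ← ENNReal.rpow_add _ _ h0 (hut x), neg_sub, sub_add_cancel]
    _ = _ := lintegral_const_mul _ (hu.pow_const p)

end GeometricSums

/-! ### Exponents below the cotype exponent -/

section Interpolation

variable {d : ℕ} {B : Type*} [NormedAddCommGroup B] [NormedSpace ℝ B] [CompleteSpace B]

lemma shortVariation_congr_ae (q : ℝ) {f g : EuclideanSpace ℝ (Fin d) → B} (h : f =ᵐ[volume] g) :
    shortVariation q f = shortVariation q g := by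
  have : ∀ t x, ballAverage f t x = ballAverage g t x := fun t x => by
    rw [ballAverage_eq, ballAverage_eq, integral_congr_ae (ae_restrict_of_ae h)]
  funext x
  simp only [shortVariation, this]

lemma ENNReal.mul_rpow_neg_cancel {a : ℝ≥0∞} (h0 : a ≠ 0) (ht : a ≠ ∞) (p q : ℝ) :
    a ^ p * a ^ (-q) = a ^ (p - q) := by
  rw [← ENNReal.rpow_add _ _ h0 ht, sub_eq_add_neg]

/-- The strong type `(p, p)` bound for `1 < p < q`, by interpolation. -/
lemma exists_lintegral_shortVariation_rpow_le_of_lt (d : ℕ) [NeZero d] {p q : ℝ} (hq : 2 ≤ q)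
    (hB : MartingaleCotype q B) (hp : 1 < p) (hpq : p < q) :
    ∃ C : ℝ≥0∞, C ≠ ∞ ∧ ∀ f : EuclideanSpace ℝ (Fin d) → B, StronglyMeasurable f →
      LocallyIntegrable f volume → ∫⁻ x, ‖f x‖ₑ ^ p ≠ ∞ →
      ∫⁻ x, shortVariation q f x ^ p ≤ C * ∫⁻ x, ‖f x‖ₑ ^ p := by
  have hp0 : 0 < p := by linarith
  have hq0 : 0 < q := by linarith
  obtain ⟨C₁, hC₁, h₁⟩ := exists_mul_volume_shortVariation_le d hq hB
  obtain ⟨C₂, hC₂, h₂⟩ := exists_lintegral_shortVariation_rpow_le d hq hB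
  have h12 : (1 : ℝ≥0∞) < 2 := ENNReal.one_lt_two
  refine ⟨2 ^ p * (2 ^ p * (C₁ * ENNReal.geomConst 2 (p - 1) + C₂ * ENNReal.geomConst 2 (q - p))),
    ?_, fun f hfs hf hfp => ?_⟩
  · have := ENNReal.geomConst_ne_top h12 (sub_pos.2 hp)
    have := ENNReal.geomConst_ne_top h12 (sub_pos.2 hpq)
    have : (2 : ℝ≥0∞) ^ p ≠ ∞ := ENNReal.rpow_ne_top_of_nonneg hp0.le ENNReal.ofNat_ne_top
    finiteness
  have hmeas := measurable_shortVariation hq0 hf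
  have hu : Measurable fun x => ‖f x‖ₑ := hfs.enorm
  -- Marcinkiewicz at height c = 2^m: the part of f above c is integrable and gets the weak (1, 1)
  -- bound, the part below c lies in L^q and gets Chebyshev. The factor 2⁻¹ on the left lets one of
  -- the two parts exceed c.
  have key : ∀ m : ℤ, ((2 : ℝ≥0∞) ^ m) ^ p * volume {x | 2 ^ m < 2⁻¹ * shortVariation q f x} ≤
      C₁ * ((2 ^ m) ^ (p - 1) * ∫⁻ x in {x | 2 ^ m < ‖f x‖ₑ}, ‖f x‖ₑ ^ (1 : ℝ)) +
      C₂ * ((2 ^ m) ^ (p - q) * ∫⁻ x in {x | ‖f x‖ₑ ≤ 2 ^ m}, ‖f x‖ₑ ^ q) := by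
    intro m
    set c : ℝ≥0∞ := 2 ^ m with hc
    have hc0 : c ≠ 0 := (ENNReal.zpow_pos (by simp) (by simp) m).ne'
    have hct : c ≠ ∞ := ENNReal.zpow_ne_top (by simp) (by simp) m
    set S := {x | c < ‖f x‖ₑ} with hS
    have hSm : MeasurableSet S := measurableSet_lt measurable_const hu
    have hSc : Sᶜ = {x | ‖f x‖ₑ ≤ c} := by ext x; simp [hS]
    have hf1 : LocallyIntegrable (S.indicator f) volume := hf.indicator hSm
    have hf2 : LocallyIntegrable (Sᶜ.indicator f) volume := hf.indicator hSm.compl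
    have hadd : (fun y => S.indicator f y + Sᶜ.indicator f y) = f := by
      funext y; exact congr_fun (indicator_self_add_compl S f) y
    have hcp : ∀ r : ℝ, c ^ r ≠ ∞ := fun r => ENNReal.rpow_ne_top_of_ne_zero hc0 hct
    have hint1 : ∫⁻ x in S, ‖f x‖ₑ ^ (1 : ℝ) ≠ ∞ := by
      refine ne_top_of_le_ne_top (ENNReal.mul_ne_top (hcp (1 - p)) hfp) ?_
      rw [← lintegral_const_mul _ (hu.pow_const p)]
      refine (setLIntegral_mono ((hu.pow_const p).const_mul _) fun x hx => ?_).trans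
        (setLIntegral_le_lintegral _ _)
      have h0 : ‖f x‖ₑ ≠ 0 := (zero_le.trans_lt hx).ne'
      calc ‖f x‖ₑ ^ (1 : ℝ) = ‖f x‖ₑ ^ (1 - p) * ‖f x‖ₑ ^ p := by
            rw [← ENNReal.rpow_add _ _ h0 enorm_ne_top, sub_add_cancel]
        _ ≤ _ := by
            refine mul_le_mul_left ?_ _
            rw [← neg_sub p 1, ENNReal.rpow_neg, ENNReal.rpow_neg]
            exact ENNReal.inv_le_inv.2 (ENNReal.rpow_le_rpow (le_of_lt hx) (by linarith))
    have hint2 : ∫⁻ x in Sᶜ, ‖f x‖ₑ ^ q ≠ ∞ := by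
      refine ne_top_of_le_ne_top (ENNReal.mul_ne_top (hcp (q - p)) hfp) ?_
      rw [← lintegral_const_mul _ (hu.pow_const p)]
      refine (setLIntegral_mono ((hu.pow_const p).const_mul _) fun x hx => ?_).trans
        (setLIntegral_le_lintegral _ _)
      rw [hSc] at hx
      calc ‖f x‖ₑ ^ q = ‖f x‖ₑ ^ (q - p) * ‖f x‖ₑ ^ p := by
            rw [← ENNReal.rpow_add_of_nonneg _ _ (by linarith) hp0.le, sub_add_cancel]
        _ ≤ _ := by
            refine mul_le_mul_left ?_ _
            exact ENNReal.rpow_le_rpow hx (by linarith)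
    have e1 : ∫⁻ x, ‖S.indicator f x‖ₑ = ∫⁻ x in S, ‖f x‖ₑ ^ (1 : ℝ) := by
      rw [← lintegral_enorm_indicator_rpow one_pos f hSm]; simp
    have hI1 : Integrable (S.indicator f) volume :=
      ⟨hf1.aestronglyMeasurable, by rw [hasFiniteIntegral_iff_enorm, e1]; exact hint1.lt_top⟩
    have e2 := lintegral_enorm_indicator_rpow hq0 f hSm.compl
    have hI2 : MemLp (Sᶜ.indicator f) (ENNReal.ofReal q) volume :=
      memLp_ofReal_of_lintegral_rpow hq0 hf2.aestronglyMeasurable (by rw [e2]; exact hint2)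
    have hsub : {x | c < 2⁻¹ * shortVariation q f x} ⊆
        {x | c < shortVariation q (S.indicator f) x} ∪
          {x | c < shortVariation q (Sᶜ.indicator f) x} := by
      intro x hx
      by_contra hnot
      simp only [mem_union, mem_ofPred_eq, not_or, not_lt] at hnot hx
      have h3 := shortVariation_add_le (by linarith : 1 ≤ q) hf1 hf2 x
      rw [hadd] at h3
      have h4 : 2⁻¹ * shortVariation q f x ≤ 2⁻¹ * (2 * c) := by
        gcongr
        refine h3.trans ((add_le_add hnot.1 hnot.2).trans (two_mul c).ge)
      rw [← mul_assoc, ENNReal.inv_mul_cancel (by simp) (by simp), one_mul] at h4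
      exact absurd hx (not_lt.2 h4)
    have hA : volume {x | c < shortVariation q (S.indicator f) x} ≤
        C₁ * (c ^ (-1 : ℝ) * ∫⁻ x in S, ‖f x‖ₑ ^ (1 : ℝ)) := by
      have := h₁ _ hI1 c hc0 hct
      rw [e1] at this
      rw [ENNReal.rpow_neg_one, mul_left_comm, mul_comm c⁻¹, ← div_eq_mul_inv]
      rw [ENNReal.le_div_iff_mul_le (Or.inl hc0) (Or.inl hct), mul_comm]
      exact this
    have hBd : volume {x | c < shortVariation q (Sᶜ.indicator f) x} ≤
        C₂ * (c ^ (-q) * ∫⁻ x in Sᶜ, ‖f x‖ₑ ^ q) := by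
      have h5 := mul_meas_ge_le_lintegral (μ := volume)
        ((measurable_shortVariation hq0 hf2).pow_const q) (c ^ q)
      have h6 := h5.trans (h₂ _ hI2)
      rw [e2] at h6
      have h7 : volume {x | c < shortVariation q (Sᶜ.indicator f) x} ≤
          volume {x | c ^ q ≤ shortVariation q (Sᶜ.indicator f) x ^ q} :=
        measure_mono fun x hx => ENNReal.rpow_le_rpow (le_of_lt hx) hq0.le
      refine h7.trans ?_
      rw [ENNReal.rpow_neg, mul_left_comm, mul_comm (c ^ q)⁻¹, ← div_eq_mul_inv]
      rw [ENNReal.le_div_iff_mul_le (Or.inl (ENNReal.rpow_pos (pos_iff_ne_zero.2 hc0) hct).ne')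
        (Or.inl (hcp q)), mul_comm]
      exact h6
    rw [← hSc]
    calc c ^ p * volume {x | c < 2⁻¹ * shortVariation q f x}
        ≤ c ^ p * (C₁ * (c ^ (-1 : ℝ) * ∫⁻ x in S, ‖f x‖ₑ ^ (1 : ℝ)) +
            C₂ * (c ^ (-q) * ∫⁻ x in Sᶜ, ‖f x‖ₑ ^ q)) := by
          gcongr
          exact (measure_mono hsub).trans ((measure_union_le _ _).trans (add_le_add hA hBd))
      _ = C₁ * (c ^ p * c ^ (-1 : ℝ) * ∫⁻ x in S, ‖f x‖ₑ ^ (1 : ℝ)) +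
            C₂ * (c ^ p * c ^ (-q) * ∫⁻ x in Sᶜ, ‖f x‖ₑ ^ q) := by ring
      _ = _ := by
          rw [ENNReal.mul_rpow_neg_cancel hc0 hct, ENNReal.mul_rpow_neg_cancel hc0 hct]
  have hsv : ∀ x, shortVariation q f x ^ p = 2 ^ p * (2⁻¹ * shortVariation q f x) ^ p := fun x => by
    rw [← ENNReal.mul_rpow_of_nonneg _ _ hp0.le, ← mul_assoc,
      ENNReal.mul_inv_cancel (by simp) (by simp), one_mul]
  simp only [hsv]
  rw [lintegral_const_mul _ ((hmeas.const_mul _).pow_const p), mul_assoc, mul_assoc]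
  refine mul_le_mul_right ((lintegral_rpow_le_mul_tsum_measure h12 (by simp) hp0
    (hmeas.const_mul 2⁻¹)).trans (mul_le_mul_right ?_ _)) _
  refine (ENNReal.tsum_le_tsum key).trans ?_
  rw [ENNReal.tsum_add, ENNReal.tsum_mul_left, ENNReal.tsum_mul_left, add_mul, mul_assoc, mul_assoc]
  gcongr
  · exact tsum_mul_setLIntegral_lt_le h12 (by simp) one_pos hp hu fun x => enorm_ne_top
  · exact tsum_mul_setLIntegral_le_le h12 (by simp) hp0 hpq hu fun x => enorm_ne_top

end Interpolation

/-! ### The dyadic maximal function -/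

section StopUnion

variable {d : ℕ}

/-- The union of all stopping cubes: the set where the dyadic maximal function exceeds `c`. -/
def stopUnion (h : EuclideanSpace ℝ (Fin d) → ℝ≥0∞) (c : ℝ≥0∞) : Set (EuclideanSpace ℝ (Fin d)) :=
  ⋃ l : ℤ, stopLevel h c l

variable {h : EuclideanSpace ℝ (Fin d) → ℝ≥0∞} {c : ℝ≥0∞}

lemma measurableSet_stopUnion : MeasurableSet (stopUnion h c) :=
  MeasurableSet.iUnion fun _ => measurableSet_stopLevel

lemma volume_stopUnion : volume (stopUnion h c) = ∑' l : ℤ, volume (stopLevel h c l) :=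
  measure_iUnion (fun _ _ hne => disjoint_stopLevel hne) fun _ => measurableSet_stopLevel

lemma exists_lt_dyadicLAvg_of_mem_stopUnion {x : EuclideanSpace ℝ (Fin d)}
    (hx : x ∈ stopUnion h c) : ∃ k, c < dyadicLAvg h k x := by
  obtain ⟨l, hl⟩ := mem_iUnion.1 hx
  exact ⟨l, hl.1⟩

lemma mul_volume_stopUnion_le : c * volume (stopUnion h c) ≤ ∫⁻ x, h x := by
  rw [volume_stopUnion, ← ENNReal.tsum_mul_left]
  exact (ENNReal.tsum_le_tsum fun l => mul_volume_stopLevel_le).trans tsum_setLIntegral_stopLevel_le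

/-- Weak type (q, q) of the dyadic maximal function with constant 1: Jensen's inequality on each
stopping cube, then disjointness. -/
lemma rpow_mul_volume_stopUnion_le {q : ℝ} (hq : 1 ≤ q) (hh : AEMeasurable h volume) :
    c ^ q * volume (stopUnion h c) ≤ ∫⁻ x, h x ^ q := by
  rw [volume_stopUnion, ← ENNReal.tsum_mul_left]
  calc ∑' l : ℤ, c ^ q * volume (stopLevel h c l)
      ≤ ∑' l : ℤ, ∫⁻ x in stopLevel h c l, h x ^ q := by
        refine ENNReal.tsum_le_tsum fun l => ?_
        rw [← setLIntegral_dyadicLAvg_of_dyadicIndex (l := l) fun _ _ => mem_stopLevel_congr,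
          ← setLIntegral_const]
        refine setLIntegral_mono' measurableSet_stopLevel fun x hx => ?_
        exact (ENNReal.rpow_le_rpow hx.1.le (by linarith)).trans (dyadicLAvg_rpow_le hq hh l x)
    _ = ∫⁻ x in stopUnion h c, h x ^ q :=
        (lintegral_iUnion (fun l => measurableSet_stopLevel)
          (fun _ _ hne => disjoint_stopLevel hne) _).symm
    _ ≤ _ := setLIntegral_le_lintegral _ _

/-- Integrability of h^q is enough for maximal cubes to exist, because the means of h^q over growing
cubes tend to 0 and dominate the q-th powers of the means of h. -/
lemma mem_stopUnion_of_lt [NeZero d] {q : ℝ} (hq : 1 ≤ q) (hh : AEMeasurable h volume)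
    (hI : ∫⁻ x, h x ^ q ≠ ∞) (hc : c ≠ 0) {k : ℤ} {x : EuclideanSpace ℝ (Fin d)}
    (hx : c < dyadicLAvg h k x) : x ∈ stopUnion h c := by
  have hq0 : 0 < q := by linarith
  obtain ⟨L, hL⟩ := exists_dyadicVol_inv_mul_le (d := d) hI
    (ENNReal.rpow_pos_of_nonneg (pos_iff_ne_zero.2 hc) hq0.le).ne'
  obtain ⟨l, -, hl⟩ := exists_mem_stopLevel_of_forall_le (fun l hl => by
    rw [← ENNReal.rpow_le_rpow_iff hq0]
    exact (dyadicLAvg_rpow_le hq hh l x).trans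
      ((dyadicLAvg_le_of_dyadicVol l x).trans (hL l hl))) hx
  exact mem_iUnion.2 ⟨l, hl⟩

lemma dyadicLAvg_const (a : ℝ≥0∞) (k : ℤ) (x : EuclideanSpace ℝ (Fin d)) :
    dyadicLAvg (fun _ => a) k x = a := by
  rw [dyadicLAvg, setLIntegral_const, volume_dyadicCube, mul_comm, mul_assoc,
    ENNReal.mul_inv_cancel (dyadicVol_ne_zero k) (dyadicVol_ne_top k), mul_one]

lemma dyadicLAvg_mono {g : EuclideanSpace ℝ (Fin d) → ℝ≥0∞} {k : ℤ} {x : EuclideanSpace ℝ (Fin d)}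
    (hle : ∀ y, dyadicIndex k y = dyadicIndex k x → h y ≤ g y) :
    dyadicLAvg h k x ≤ dyadicLAvg g k x := by
  rw [dyadicLAvg, dyadicLAvg]
  exact mul_le_mul_right (setLIntegral_mono' (measurableSet_dyadicIndex k {dyadicIndex k x})
    fun y hy => hle y hy) _

lemma dyadicLAvg_add_right (g : EuclideanSpace ℝ (Fin d) → ℝ≥0∞) {h : EuclideanSpace ℝ (Fin d) → ℝ≥0∞}
    (hh : Measurable h) (k : ℤ) (x : EuclideanSpace ℝ (Fin d)) :
    dyadicLAvg (fun y => g y + h y) k x = dyadicLAvg g k x + dyadicLAvg h k x := by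
  rw [dyadicLAvg, dyadicLAvg, dyadicLAvg, lintegral_add_right _ hh, mul_add]

/-- A lower semicontinuous function is dominated by its dyadic maximal function. -/
lemma LowerSemicontinuous.exists_lt_dyadicLAvg (hh : LowerSemicontinuous h)
    {x : EuclideanSpace ℝ (Fin d)} (hx : c < h x) : ∃ k, c < dyadicLAvg h k x := by
  obtain ⟨c', hc, hc'⟩ := exists_between hx
  obtain ⟨ε, hε, hball⟩ := Metric.eventually_nhds_iff_ball.1 (hh x c' hc')
  have hd : (0 : ℝ) < d + 1 := by positivity
  obtain ⟨k, hk1, hk2⟩ := exists_mem_Ico_zpow (div_pos hε hd) (one_lt_two (α := ℝ))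
  refine ⟨k - 1, hc.trans_le ?_⟩
  rw [← dyadicLAvg_const c' (k - 1) x]
  refine dyadicLAvg_mono fun y hy => (hball y ?_).le
  have h1 := dist_le_of_dyadicIndex_eq hy
  have h2 : (2 : ℝ) ^ (k - 1) < 2 ^ k := zpow_lt_zpow_right₀ one_lt_two (by omega)
  rw [le_div_iff₀ hd] at hk1
  rw [Metric.mem_ball]
  have h3 := two_zpow_pos (k - 1)
  nlinarith [Nat.cast_nonneg (α := ℝ) d]

end StopUnion

/-! ### The good-λ inequality -/

section GoodLambda

variable {d : ℕ} {B : Type*} [NormedAddCommGroup B] [NormedSpace ℝ B] [CompleteSpace B]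

lemma dyadicIndex_subset_ball [NeZero d] (l : ℤ) (x : EuclideanSpace ℝ (Fin d)) :
    dyadicIndex l ⁻¹' {dyadicIndex l x} ⊆ Metric.ball x (2 * d * 2 ^ l) := by
  intro y hy
  have h1 := dist_le_of_dyadicIndex_eq (show dyadicIndex l y = dyadicIndex l x from hy)
  have h2 := two_zpow_pos l
  have hd : (0 : ℝ) < d := by exact_mod_cast NeZero.pos d
  rw [Metric.mem_ball]
  nlinarith [mul_pos hd h2]

lemma ballVol_two_mul_zpow [NeZero d] (l : ℤ) :
    ballVol d (2 * d * 2 ^ l) =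
      ENNReal.ofReal ((2 * d) ^ d) * ballVol d 1 * dyadicVol d l := by
  have hd : (0 : ℝ) < d := by exact_mod_cast NeZero.pos d
  rw [ballVol_mul_two_zpow (by positivity), ballVol_eq (two_zpow_pos l), dyadicVol]
  ring

/-- The local good-`λ` estimate on a stopping cube. -/
lemma exists_mul_volume_stopUnion_inter_le (d : ℕ) [NeZero d] {q : ℝ} (hq : 2 ≤ q)
    (hB : MartingaleCotype q B) :
    ∃ D : ℝ≥0∞, D ≠ ∞ ∧ ∀ f : EuclideanSpace ℝ (Fin d) → B, LocallyIntegrable f volume →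
      (∀ᵐ x ∂volume, shortVariation q f x < ∞) →
      ∀ c m : ℝ≥0∞, c ≠ 0 → c ≠ ∞ → m ≠ ∞ → D * m ≤ c →
      ∀ (l : ℤ) (x₀ : EuclideanSpace ℝ (Fin d)), x₀ ∈ stopLevel (shortVariation q f) c l →
      (∀ r, 0 < r → ∫⁻ y in Metric.ball x₀ r, ‖f y‖ₑ ^ q ≤ m ^ q * ballVol d r) →
      c * volume (stopUnion (shortVariation q f) (3 * c) ∩ dyadicIndex l ⁻¹' {dyadicIndex l x₀}) ≤
        D * m * dyadicVol d l := by
  obtain ⟨C, hC, hosc⟩ := exists_shortVariation_oscillation_le d hq hB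
  set V : ℝ≥0∞ := ENNReal.ofReal ((2 * d) ^ d) * ballVol d 1 with hV
  have hVt : V ≠ ∞ := ENNReal.mul_ne_top ENNReal.ofReal_ne_top (ballVol_ne_top 1)
  refine ⟨2 ^ d * (C * V), by finiteness, fun f hf hfin c m hc hct hm hDm l x₀ hx₀ hfm => ?_⟩
  have hd : (0 : ℝ) < d := by exact_mod_cast NeZero.pos d
  have hR : (0 : ℝ) < 2 * d * 2 ^ (l + 1) := by positivity
  -- Large enough for the ball about x₀ to contain the parent of the stopping cube, where the mean
  -- of the short variation is at most c.
  set R : ℝ := 2 * d * 2 ^ (l + 1) with hRdef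
  set F := shortVariation q f with hF
  obtain ⟨a, W, ha, hW, hWI, haW⟩ := hosc f hf x₀ R m hR hm (fun r hr => hfm r (hR.trans_le hr))
    (not_ae_restrict_ball_eq_top hR hfin)
  rw [hRdef, ballVol_two_mul_zpow, ← hRdef, ← hV] at hWI
  set v := dyadicVol d (l + 1) with hv
  have hv0 : v ≠ 0 := dyadicVol_ne_zero _
  have hvt : v ≠ ∞ := dyadicVol_ne_top _
  have hparent : dyadicIndex (l + 1) ⁻¹' {dyadicIndex (l + 1) x₀} ⊆ Metric.ball x₀ R :=
    dyadicIndex_subset_ball _ _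
  have hchild : dyadicIndex l ⁻¹' {dyadicIndex l x₀} ⊆
      dyadicIndex (l + 1) ⁻¹' {dyadicIndex (l + 1) x₀} :=
    fun y hy => dyadicIndex_eq_of_le (by omega) hy
  -- Averaging a ≤ F + W over the parent cube bounds a by c, from maximality of the stopping cube,
  -- plus the mean of W, which is at most D * m ≤ c.
  have ha2 : a ≤ 2 * c := by
    have h1 : a ≤ dyadicLAvg F (l + 1) x₀ + dyadicLAvg W (l + 1) x₀ := by
      rw [← dyadicLAvg_add_right _ hW]
      conv_lhs => rw [← dyadicLAvg_const a (l + 1) x₀]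
      exact dyadicLAvg_mono fun y hy => (haW y (hparent hy)).2
    have h2 : dyadicLAvg W (l + 1) x₀ ≤ C * V * m := by
      rw [dyadicLAvg, ← hv]
      calc v⁻¹ * ∫⁻ y in dyadicIndex (l + 1) ⁻¹' {dyadicIndex (l + 1) x₀}, W y
          ≤ v⁻¹ * (C * m * (V * v)) := by
            gcongr
            exact (lintegral_mono_set hparent).trans hWI
        _ = C * V * m * (v⁻¹ * v) := by ring
        _ = _ := by rw [ENNReal.inv_mul_cancel hv0 hvt, mul_one]
    have h3 : C * V * m ≤ 2 ^ d * (C * V) * m := by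
      rw [mul_assoc (2 ^ d)]
      exact le_mul_of_one_le_left' (one_le_pow₀ one_le_two)
    calc a ≤ c + c := h1.trans (add_le_add (hx₀.2 _ (by omega)) (h2.trans (h3.trans hDm)))
      _ = _ := (two_mul c).symm
  set Q := dyadicIndex (d := d) l ⁻¹' {dyadicIndex l x₀} with hQ
  have hQm : MeasurableSet Q := measurableSet_dyadicIndex _ _
  have hW' : Measurable (Q.indicator W) := hW.indicator hQm
  have hWQ : ∫⁻ x, Q.indicator W x ≤ C * m * (V * v) := by
    rw [lintegral_indicator hQm]
    exact (lintegral_mono_set (hchild.trans hparent)).trans hWI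
  -- Cubes strictly larger than Q around its points have mean at most c, so a mean above 3c occurs
  -- on a subcube of Q. There F ≤ a + W with a ≤ 2c, so W has mean above c, and the weak (1, 1)
  -- bound of the maximal function applies.
  have hsub : stopUnion F (3 * c) ∩ Q ⊆ stopUnion (Q.indicator W) c := by
    rintro y ⟨hy, hyQ⟩
    obtain ⟨k, hk⟩ := exists_lt_dyadicLAvg_of_mem_stopUnion hy
    have hyl : dyadicIndex l y = dyadicIndex l x₀ := hyQ
    have hkl : k ≤ l := by
      by_contra hlt
      have h4 := (mem_stopLevel_congr hyl.symm hx₀).2 k (by omega)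
      refine absurd (hk.trans_le h4) (not_lt.2 ?_)
      exact le_mul_of_one_le_left' (by norm_num)
    have h5 : dyadicLAvg F k y ≤ a + dyadicLAvg (Q.indicator W) k y := by
      conv_rhs => rw [← dyadicLAvg_const a k y]
      rw [← dyadicLAvg_add_right _ hW']
      refine dyadicLAvg_mono fun z hz => ?_
      have hzQ : z ∈ Q := (dyadicIndex_eq_of_le hkl hz).trans hyl
      rw [indicator_of_mem hzQ]
      exact (haW z (hparent (hchild hzQ))).1
    have h6 : c < dyadicLAvg (Q.indicator W) k y := by
      by_contra hle
      refine absurd (hk.trans_le (h5.trans (add_le_add ha2 (not_lt.1 hle)))) (not_lt.2 ?_)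
      exact le_of_eq (by ring)
    refine mem_iUnion.2 ?_
    obtain ⟨l', -, hl'⟩ := exists_mem_stopLevel (ne_top_of_le_ne_top (by finiteness) hWQ) hc h6
    exact ⟨l', hl'⟩
  calc c * volume (stopUnion F (3 * c) ∩ Q) ≤ c * volume (stopUnion (Q.indicator W) c) := by
        gcongr
    _ ≤ C * m * (V * v) := mul_volume_stopUnion_le.trans hWQ
    _ = _ := by rw [hv, dyadicVol_succ]; ring

/-- The good-`λ` inequality. -/
lemma exists_volume_stopUnion_le (d : ℕ) [NeZero d] {q : ℝ} (hq : 2 ≤ q)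
    (hB : MartingaleCotype q B) :
    ∃ D : ℝ≥0∞, D ≠ ∞ ∧ ∀ f : EuclideanSpace ℝ (Fin d) → B, StronglyMeasurable f →
      LocallyIntegrable f volume → ∫⁻ x, ‖f x‖ₑ ^ q ≠ ∞ →
      ∫⁻ x, shortVariation q f x ^ q ≠ ∞ →
      ∀ c γ : ℝ≥0∞, c ≠ 0 → c ≠ ∞ → γ ≠ 0 → γ ≠ ∞ → D * γ ≤ 1 →
      volume (stopUnion (shortVariation q f) (3 * c)) ≤
        D * γ * volume (stopUnion (shortVariation q f) c) +
        D * ((γ * c) ^ (-q) * ∫⁻ x in {x | γ * c < ‖f x‖ₑ}, ‖f x‖ₑ ^ q) := by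
  have hq0 : 0 < q := by linarith
  have hq1 : 1 ≤ q := by linarith
  obtain ⟨D, hD, hloc⟩ := exists_mul_volume_stopUnion_inter_le d hq hB
  set K : ℝ≥0∞ := ENNReal.ofReal ((1 + 2 * d) ^ d) + 1 with hK
  have hKt : K ^ (1 / q) ≠ ∞ := ENNReal.rpow_ne_top_of_nonneg (by positivity) (by finiteness)
  refine ⟨D * K ^ (1 / q) + 5 ^ d, by finiteness,
    fun f hfs hf hfq hFq c γ hc hct hγ hγt hDγ => ?_⟩
  set F := shortVariation q f with hF
  have hFm : Measurable F := measurable_shortVariation hq0 hf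
  have hfin : ∀ᵐ x ∂volume, F x < ∞ := by
    filter_upwards [ae_lt_top (hFm.pow_const q) hFq] with x hx
    exact (ENNReal.rpow_lt_top_iff_of_pos hq0).1 hx
  set b := γ * c with hb
  have hb0 : b ≠ 0 := mul_ne_zero hγ hc
  have hbt : b ≠ ∞ := ENNReal.mul_ne_top hγt hct
  have hbq0 : b ^ q ≠ 0 := (ENNReal.rpow_pos (pos_iff_ne_zero.2 hb0) hbt).ne'
  have hbqt : b ^ q ≠ ∞ := ENNReal.rpow_ne_top_of_nonneg hq0.le hbt
  set S := {x | b < ‖f x‖ₑ} with hS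
  have hSm : MeasurableSet S := measurableSet_lt measurable_const hfs.enorm
  -- Only the values of ‖f‖ above b enter the exceptional set N; the rest adds at most b^q to each
  -- mean of ‖f‖^q, which is the summand 1 in K. The error is thus an integral over {‖f‖ > b}, as
  -- needed for summing over levels.
  set h : EuclideanSpace ℝ (Fin d) → ℝ≥0∞ := S.indicator fun x => ‖f x‖ₑ ^ q with hh
  have hhI : ∫⁻ x, h x = ∫⁻ x in S, ‖f x‖ₑ ^ q := lintegral_indicator hSm _
  have hhI' : ∫⁻ x, h x ≠ ∞ := by
    rw [hhI]; exact ne_top_of_le_ne_top hfq (setLIntegral_le_lintegral _ _)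
  set N := stopNbhd h (b ^ q) with hN
  have hNm : MeasurableSet N := measurableSet_stopNbhd
  have hNv : volume N ≤ 5 ^ d * (b ^ (-q) * ∫⁻ x in S, ‖f x‖ₑ ^ q) := by
    have h1 : b ^ q * volume N ≤ 5 ^ d * ∫⁻ x, h x := mul_volume_stopNbhd_le
    rw [hhI] at h1
    rw [ENNReal.rpow_neg, mul_left_comm, mul_comm (b ^ q)⁻¹, ← div_eq_mul_inv,
      ENNReal.le_div_iff_mul_le (Or.inl hbq0) (Or.inl hbqt), mul_comm]
    exact h1
  set m := K ^ (1 / q) * b with hm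
  have hmt : m ≠ ∞ := ENNReal.mul_ne_top hKt hbt
  have hDm : D * m ≤ c := by
    calc D * m = D * K ^ (1 / q) * γ * c := by rw [hm, hb]; ring
      _ ≤ 1 * c := by
          gcongr
          refine le_trans ?_ hDγ
          gcongr
          exact le_self_add
      _ = c := one_mul c
  have hgood : ∀ x₀, x₀ ∉ N → ∀ r, 0 < r →
      ∫⁻ y in Metric.ball x₀ r, ‖f y‖ₑ ^ q ≤ m ^ q * ballVol d r := by
    intro x₀ hx₀ r hr
    have h2 := setLIntegral_ball_le_of_notMem_stopNbhd hhI' hbq0 hx₀ hr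
    calc ∫⁻ y in Metric.ball x₀ r, ‖f y‖ₑ ^ q
        ≤ ∫⁻ y in Metric.ball x₀ r, (h y + b ^ q) := by
          refine lintegral_mono fun y => ?_
          by_cases hy : y ∈ S
          · simp only [hh, indicator_of_mem hy]; exact le_self_add
          · simp only [hh, indicator_of_notMem hy, zero_add]
            exact ENNReal.rpow_le_rpow (not_lt.1 hy) hq0.le
      _ = (∫⁻ y in Metric.ball x₀ r, h y) + b ^ q * ballVol d r := by
          rw [lintegral_add_right _ measurable_const, setLIntegral_const, volume_ball_eq_ballVol]
      _ ≤ ENNReal.ofReal ((1 + 2 * d) ^ d) * b ^ q * ballVol d r + b ^ q * ballVol d r := by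
          gcongr
      _ = K * b ^ q * ballVol d r := by rw [hK]; ring
      _ = _ := by
          rw [hm, ENNReal.mul_rpow_of_nonneg (K ^ (1 / q)) b hq0.le, ← ENNReal.rpow_mul,
            one_div_mul_cancel hq0.ne', ENNReal.rpow_one]
  set U := stopUnion F (3 * c) with hU
  have hUm : MeasurableSet U := measurableSet_stopUnion
  have hlevel : ∀ l : ℤ, volume ((U \ N) ∩ stopLevel F c l) ≤
      D * K ^ (1 / q) * γ * volume (stopLevel F c l) := by
    intro l
    rw [volume_eq_tsum_dyadicCube l _ ((hUm.diff hNm).inter measurableSet_stopLevel),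
      volume_eq_tsum_dyadicCube l (stopLevel F c l) measurableSet_stopLevel,
      ← ENNReal.tsum_mul_left]
    refine ENNReal.tsum_le_tsum fun n => ?_
    rcases ((U \ N) ∩ stopLevel F c l ∩ dyadicIndex l ⁻¹' {n}).eq_empty_or_nonempty with he | hne
    · rw [he]; simp
    -- A single point of the cube outside N suffices: it serves as the centre at which all L^q means
    -- of f are at most m.
    obtain ⟨x₀, ⟨⟨hx₀U, hx₀N⟩, hx₀s⟩, hx₀n⟩ := hne
    obtain rfl : dyadicIndex l x₀ = n := hx₀n
    have h3 : stopLevel F c l ∩ dyadicIndex l ⁻¹' {dyadicIndex l x₀} =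
        dyadicIndex l ⁻¹' {dyadicIndex l x₀} :=
      inter_eq_right.2 fun y hy => mem_stopLevel_congr (Eq.symm hy) hx₀s
    rw [h3, volume_dyadicCube]
    have h4 := hloc f hf hfin c m hc hct hmt hDm l x₀ hx₀s (hgood x₀ hx₀N)
    rw [← ENNReal.mul_le_mul_iff_right hc hct]
    calc c * volume ((U \ N) ∩ stopLevel F c l ∩ dyadicIndex l ⁻¹' {dyadicIndex l x₀})
        ≤ c * volume (U ∩ dyadicIndex l ⁻¹' {dyadicIndex l x₀}) := by
          gcongr
          exact inter_subset_left.trans sdiff_subset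
      _ ≤ _ := h4
      _ = _ := by rw [hm, hb]; ring
  have hUsub : U \ N ⊆ ⋃ l : ℤ, (U \ N) ∩ stopLevel F c l := by
    intro x hx
    obtain ⟨k, hk⟩ := exists_lt_dyadicLAvg_of_mem_stopUnion hx.1
    have h5 : x ∈ stopUnion F c := mem_stopUnion_of_lt hq1 hFm.aemeasurable hFq hc
      ((le_mul_of_one_le_left' (by norm_num)).trans_lt hk)
    obtain ⟨l, hl⟩ := mem_iUnion.1 h5
    exact mem_iUnion.2 ⟨l, hx, hl⟩
  calc volume U ≤ volume (U \ N ∪ N) := measure_mono (by rw [sdiff_union_self]; exact subset_union_left)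
    _ ≤ volume (U \ N) + volume N := measure_union_le _ _
    _ ≤ D * K ^ (1 / q) * γ * volume (stopUnion F c) +
        5 ^ d * (b ^ (-q) * ∫⁻ x in S, ‖f x‖ₑ ^ q) := by
        refine add_le_add ?_ hNv
        calc volume (U \ N) ≤ ∑' l : ℤ, volume ((U \ N) ∩ stopLevel F c l) :=
              (measure_mono hUsub).trans (measure_iUnion_le _)
          _ ≤ ∑' l : ℤ, D * K ^ (1 / q) * γ * volume (stopLevel F c l) :=
              ENNReal.tsum_le_tsum hlevel
          _ = _ := by rw [ENNReal.tsum_mul_left, volume_stopUnion]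
    _ ≤ _ := by
        gcongr
        · exact le_self_add
        · exact le_add_self

end GoodLambda

/-! ### Exponents above the cotype exponent and the full range -/

section LargeExponents

/-- Sum the recursion and absorb half of the left side. Absorption needs finiteness, so the sums are
first cut off at M; the shift by one sends the cut-off sum into itself. -/
lemma ENNReal.tsum_le_two_mul_tsum_of_succ_le {S R : ℤ → ℝ≥0∞}
    (h : ∀ m, S (m + 1) ≤ 2⁻¹ * S m + R m)
    (hfin : ∀ M : ℤ, ∑' m : ℤ, (if m ≤ M then S m else 0) ≠ ∞) :
    ∑' m, S m ≤ 2 * ∑' m, R m := by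
  have key : ∀ M : ℤ, ∑' m : ℤ, (if m ≤ M then S m else 0) ≤ 2 * ∑' m, R m := by
    intro M
    set A := ∑' m : ℤ, (if m ≤ M then S m else 0) with hA
    have h1 : A ≤ 2⁻¹ * A + ∑' m, R m := by
      calc A = ∑' m : ℤ, (if m + 1 ≤ M then S (m + 1) else 0) :=
            ((Equiv.addRight (1 : ℤ)).tsum_eq fun m => if m ≤ M then S m else 0).symm
        _ ≤ ∑' m : ℤ, (2⁻¹ * (if m ≤ M then S m else 0) + R m) := by
            refine ENNReal.tsum_le_tsum fun m => ?_
            split_ifs with h2 h3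
            · exact h m
            · omega
            · exact zero_le
            · exact zero_le
        _ = _ := by rw [ENNReal.tsum_add, ENNReal.tsum_mul_left]
    have h2 : 2⁻¹ * A + 2⁻¹ * A = A := by
      rw [← add_mul, ENNReal.inv_two_add_inv_two, one_mul]
    have h3 : 2⁻¹ * A ≤ ∑' m, R m := by
      rw [← ENNReal.add_le_add_iff_left (ENNReal.mul_ne_top (ENNReal.inv_ne_top.2 two_ne_zero) (hfin M)),
        h2]
      exact h1
    calc A = 2 * (2⁻¹ * A) := by
          rw [← mul_assoc, ENNReal.mul_inv_cancel (by simp) (by simp), one_mul]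
      _ ≤ _ := by gcongr
  rw [ENNReal.tsum_eq_iSup_sum]
  refine iSup_le fun s => ?_
  obtain ⟨M, hM⟩ := s.bddAbove
  refine le_trans ?_ (key M)
  refine le_trans (le_of_eq (Finset.sum_congr rfl fun m hm => ?_)) (ENNReal.sum_le_tsum s)
  rw [if_pos (hM hm)]

variable {d : ℕ} {B : Type*} [NormedAddCommGroup B] [NormedSpace ℝ B] [CompleteSpace B]

/-- The strong type `(p, p)` bound for `p > q` on functions that are also in `L^q`. -/
lemma exists_lintegral_shortVariation_rpow_le_of_memLp (d : ℕ) [NeZero d] {p q : ℝ} (hq : 2 ≤ q)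
    (hB : MartingaleCotype q B) (hqp : q < p) :
    ∃ C : ℝ≥0∞, C ≠ ∞ ∧ ∀ f : EuclideanSpace ℝ (Fin d) → B, StronglyMeasurable f →
      LocallyIntegrable f volume → ∫⁻ x, ‖f x‖ₑ ^ q ≠ ∞ →
      ∫⁻ x, shortVariation q f x ^ p ≤ C * ∫⁻ x, ‖f x‖ₑ ^ p := by
  have hq0 : 0 < q := by linarith
  have hq1 : 1 ≤ q := by linarith
  have hp0 : 0 < p := by linarith
  obtain ⟨D, hD, hgood⟩ := exists_volume_stopUnion_le d hq hB
  obtain ⟨C₂, hC₂, h₂⟩ := exists_lintegral_shortVariation_rpow_le d hq hB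
  have h13 : (1 : ℝ≥0∞) < 3 := by norm_num
  have h30 : (3 : ℝ≥0∞) ≠ 0 := by norm_num
  have h3t : (3 : ℝ≥0∞) ≠ ∞ := ENNReal.ofNat_ne_top
  have h3p : (3 : ℝ≥0∞) ^ p ≠ ∞ := ENNReal.rpow_ne_top_of_nonneg hp0.le h3t
  have h3p1 : 1 ≤ (3 : ℝ≥0∞) ^ p := ENNReal.one_le_rpow h13.le hp0
  -- The good-λ parameter is γ = G⁻¹, small enough that 3^p D γ ≤ 1/2, where 3^p is the growth of
  -- the weight from one level to the next.
  set G : ℝ≥0∞ := 2 * 3 ^ p * (D + 1) with hG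
  have hG0 : G ≠ 0 := mul_ne_zero (mul_ne_zero two_ne_zero (zero_lt_one.trans_le h3p1).ne')
    (by simp)
  have hGt : G ≠ ∞ := by finiteness
  have hDG : 2 * 3 ^ p * D ≤ G := by rw [hG]; gcongr; exact le_self_add
  have hDG' : D * G⁻¹ ≤ 1 := by
    refine ENNReal.div_le_of_le_mul ?_
    rw [one_mul]
    refine le_trans (le_mul_of_one_le_left' ?_) hDG
    exact one_le_mul one_le_two h3p1
  set Kg := ENNReal.geomConst 3 (p - q) with hKg
  have hKgt : Kg ≠ ∞ := ENNReal.geomConst_ne_top h13 (sub_pos.2 hqp)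
  have hGp : G ^ p ≠ ∞ := ENNReal.rpow_ne_top_of_nonneg hp0.le hGt
  refine ⟨3 ^ p * (2 * (3 ^ p * D * (Kg * G ^ p))), by finiteness, fun f hfs hf hfq => ?_⟩
  set F := shortVariation q f with hF
  have hFm : Measurable F := measurable_shortVariation hq0 hf
  have hFq : ∫⁻ x, F x ^ q ≠ ∞ := ne_top_of_le_ne_top (ENNReal.mul_ne_top hC₂ hfq)
    (h₂ f (memLp_ofReal_of_lintegral_rpow hq0 hf.aestronglyMeasurable hfq))
  have hz0 : ∀ m : ℤ, (3 : ℝ≥0∞) ^ m ≠ 0 := fun m => (ENNReal.zpow_pos h30 h3t m).ne'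
  have hzt : ∀ m : ℤ, (3 : ℝ≥0∞) ^ m ≠ ∞ := fun m => ENNReal.zpow_ne_top h30 h3t m
  -- The condition ‖f‖ > γ 3^m reads u > 3^m, so the error terms form a layer cake sum for u.
  set u : EuclideanSpace ℝ (Fin d) → ℝ≥0∞ := fun x => G * ‖f x‖ₑ with hu
  have hum : Measurable u := hfs.enorm.const_mul G
  set S : ℤ → ℝ≥0∞ := fun m => (3 ^ m) ^ p * volume (stopUnion F (3 ^ m)) with hS
  set R : ℤ → ℝ≥0∞ := fun m => (3 ^ m) ^ (p - q) * ∫⁻ x in {x | 3 ^ m < u x}, u x ^ q with hR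
  have hstep : ∀ m, S (m + 1) ≤ 2⁻¹ * S m + 3 ^ p * D * R m := by
    intro m
    set c : ℝ≥0∞ := 3 ^ m with hc
    have hc3 : (3 : ℝ≥0∞) ^ (m + 1) = 3 * c := by
      rw [ENNReal.zpow_add h30 h3t, zpow_one, mul_comm]
    have h1 := hgood f hfs hf hfq hFq c G⁻¹ (hz0 m) (hzt m) (ENNReal.inv_ne_zero.2 hGt)
      (ENNReal.inv_ne_top.2 hG0) hDG'
    have h2 : {x | G⁻¹ * c < ‖f x‖ₑ} = {x | c < u x} := by
      ext x
      simp only [mem_ofPred_eq, hu]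
      rw [← ENNReal.mul_lt_mul_iff_right hG0 hGt (b := G⁻¹ * c), ← mul_assoc,
        ENNReal.mul_inv_cancel hG0 hGt, one_mul]
    have h3 : (G⁻¹ * c) ^ (-q) * ∫⁻ x in {x | c < u x}, ‖f x‖ₑ ^ q =
        c ^ (-q) * ∫⁻ x in {x | c < u x}, u x ^ q := by
      simp only [hu, ENNReal.mul_rpow_of_nonneg _ _ hq0.le]
      rw [lintegral_const_mul _ (hfs.enorm.pow_const q),
        ENNReal.mul_rpow_of_ne_top (ENNReal.inv_ne_top.2 hG0) (hzt m), ENNReal.rpow_neg G⁻¹,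
        ENNReal.inv_rpow, inv_inv]
      ring
    rw [h2, h3] at h1
    have h4 : 3 ^ p * (D * G⁻¹) ≤ 2⁻¹ := by
      rw [ENNReal.le_inv_iff_mul_le]
      calc 3 ^ p * (D * G⁻¹) * 2 = 2 * 3 ^ p * D * G⁻¹ := by ring
        _ ≤ 1 := ENNReal.div_le_of_le_mul (by rwa [one_mul])
    calc S (m + 1) = 3 ^ p * c ^ p * volume (stopUnion F (3 * c)) := by
          simp only [hS]
          rw [hc3, ENNReal.mul_rpow_of_nonneg _ _ hp0.le]
      _ ≤ 3 ^ p * c ^ p * (D * G⁻¹ * volume (stopUnion F c) +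
          D * (c ^ (-q) * ∫⁻ x in {x | c < u x}, u x ^ q)) := by gcongr
      _ = 3 ^ p * (D * G⁻¹) * (c ^ p * volume (stopUnion F c)) +
          3 ^ p * D * (c ^ p * c ^ (-q) * ∫⁻ x in {x | c < u x}, u x ^ q) := by ring
      _ ≤ _ := by
          rw [ENNReal.mul_rpow_neg_cancel (hz0 m) (hzt m)]
          gcongr
  -- The a priori finiteness uses f in L^q: the maximal function of F is of weak type (q, q), so S m
  -- is at most a constant times (3^m)^(p-q), summable towards -∞ because p > q.
  have hfin : ∀ M : ℤ, ∑' m : ℤ, (if m ≤ M then S m else 0) ≠ ∞ := by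
    intro M
    refine ne_top_of_le_ne_top (b := (3 ^ M) ^ (p - q) * Kg * ∫⁻ x, F x ^ q) ?_ ?_
    · have : ((3 : ℝ≥0∞) ^ M) ^ (p - q) ≠ ∞ := ENNReal.rpow_ne_top_of_ne_zero (hz0 M) (hzt M)
      finiteness
    · refine le_trans ?_ (mul_le_mul_left (ENNReal.tsum_zpow_rpow_le h13 h3t (p - q) M) _)
      rw [← ENNReal.tsum_mul_right]
      refine ENNReal.tsum_le_tsum fun m => ?_
      split_ifs
      · calc S m = (3 ^ m) ^ (p - q) * ((3 ^ m) ^ q * volume (stopUnion F (3 ^ m))) := by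
              simp only [hS]
              rw [← mul_assoc, ← ENNReal.rpow_add _ _ (hz0 m) (hzt m), sub_add_cancel]
          _ ≤ _ := by gcongr; exact rpow_mul_volume_stopUnion_le hq1 hFm.aemeasurable
      · exact zero_le
  have hlsc : LowerSemicontinuous F := lowerSemicontinuous_shortVariation hq0 hf
  calc ∫⁻ x, F x ^ p ≤ 3 ^ p * ∑' m : ℤ, (3 ^ m) ^ p * volume {x | 3 ^ m < F x} :=
        lintegral_rpow_le_mul_tsum_measure h13 h3t hp0 hFm
    _ ≤ 3 ^ p * ∑' m, S m := by
        refine mul_le_mul_right (ENNReal.tsum_le_tsum fun m => mul_le_mul_right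
          (measure_mono fun x hx => ?_) _) _
        -- Lower semicontinuity gives F ≤ its dyadic maximal function at every point, so the level
        -- sets of F lie in the stopping sets.
        obtain ⟨k, hk⟩ := hlsc.exists_lt_dyadicLAvg hx
        exact mem_stopUnion_of_lt hq1 hFm.aemeasurable hFq (hz0 m) hk
    _ ≤ 3 ^ p * (2 * ∑' m, 3 ^ p * D * R m) := by
        gcongr
        exact ENNReal.tsum_le_two_mul_tsum_of_succ_le hstep hfin
    _ ≤ 3 ^ p * (2 * (3 ^ p * D * (Kg * ∫⁻ x, u x ^ p))) := by
        rw [ENNReal.tsum_mul_left]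
        gcongr
        exact tsum_mul_setLIntegral_lt_le h13 h3t hq0 hqp hum
          fun x => ENNReal.mul_ne_top hGt enorm_ne_top
    _ = _ := by
        simp only [hu, ENNReal.mul_rpow_of_nonneg _ _ hp0.le]
        rw [lintegral_const_mul _ (hfs.enorm.pow_const p)]
        ring

/-- To exceed c, one sequence of radii and finitely many scales suffice, and at scale 2^k the
averages at x see f only in the ball of radius 2^(k+1). A large truncation ball leaves them
unchanged. -/
lemma eventually_lt_shortVariation_indicator {q : ℝ} (hq : 0 < q)
    (f : EuclideanSpace ℝ (Fin d) → B) {x : EuclideanSpace ℝ (Fin d)} {c : ℝ≥0∞}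
    (hc : c < shortVariation q f x) :
    ∀ᶠ n : ℕ in atTop, c < shortVariation q ((Metric.ball 0 n).indicator f) x := by
  rw [shortVariation_eq] at hc
  obtain ⟨t, hc⟩ := lt_iSup_iff.1 hc
  obtain ⟨ht, hc⟩ := lt_iSup_iff.1 hc
  obtain ⟨ht0, hc⟩ := lt_iSup_iff.1 hc
  rw [one_div, ENNReal.lt_rpow_inv_iff hq, ENNReal.tsum_eq_iSup_sum] at hc
  obtain ⟨s, hs⟩ := lt_iSup_iff.1 hc
  have hev : ∀ᶠ n : ℕ in atTop, ∀ k ∈ s, dist x 0 + (2 : ℝ) ^ (k + 1) ≤ n :=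
    (Filter.eventually_all_finset s).2 fun k _ => tendsto_natCast_atTop_atTop.eventually_ge_atTop _
  filter_upwards [hev] with n hn
  refine lt_of_lt_of_le ?_ (le_shortVariation q _ ht ht0 x)
  rw [one_div, ENNReal.lt_rpow_inv_iff hq]
  refine hs.trans_le (le_trans (le_of_eq (Finset.sum_congr rfl fun k hk => ?_))
    (ENNReal.sum_le_tsum s))
  refine scaleVariation_congr q ht fun y hy => ?_
  rw [indicator_of_mem]
  exact Metric.ball_subset_ball' (by linarith [hn k hk]) hy

lemma shortVariation_rpow_le_liminf {p q : ℝ} (hq : 0 < q) (hp : 0 < p)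
    (f : EuclideanSpace ℝ (Fin d) → B) (x : EuclideanSpace ℝ (Fin d)) :
    shortVariation q f x ^ p ≤
      liminf (fun n : ℕ => shortVariation q ((Metric.ball 0 n).indicator f) x ^ p) atTop := by
  refine le_of_forall_lt fun b hb => ?_
  obtain ⟨b', hbb', hb'⟩ := exists_between hb
  rw [← ENNReal.rpow_inv_lt_iff hp] at hb'
  refine hbb'.trans_le (le_liminf_of_le (by isBoundedDefault) ?_)
  filter_upwards [eventually_lt_shortVariation_indicator hq f hb'] with n hn
  exact ((ENNReal.rpow_inv_lt_iff hp).1 hn).le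

/-- The strong type `(p, p)` bound for `p > q`. -/
lemma exists_lintegral_shortVariation_rpow_le_of_gt (d : ℕ) [NeZero d] {p q : ℝ} (hq : 2 ≤ q)
    (hB : MartingaleCotype q B) (hqp : q < p) :
    ∃ C : ℝ≥0∞, C ≠ ∞ ∧ ∀ f : EuclideanSpace ℝ (Fin d) → B, StronglyMeasurable f →
      LocallyIntegrable f volume → ∫⁻ x, ‖f x‖ₑ ^ p ≠ ∞ →
      ∫⁻ x, shortVariation q f x ^ p ≤ C * ∫⁻ x, ‖f x‖ₑ ^ p := by
  have hq0 : 0 < q := by linarith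
  have hp0 : 0 < p := by linarith
  obtain ⟨C, hC, h⟩ := exists_lintegral_shortVariation_rpow_le_of_memLp d hq hB hqp
  refine ⟨C, hC, fun f hfs hf hfp => ?_⟩
  have hloc : ∀ n : ℕ, LocallyIntegrable ((Metric.ball 0 (n : ℝ)).indicator f) volume :=
    fun n => hf.indicator measurableSet_ball
  have hbound : ∀ n : ℕ, ∫⁻ x, shortVariation q ((Metric.ball 0 n).indicator f) x ^ p ≤
      C * ∫⁻ x, ‖f x‖ₑ ^ p := by
    intro n
    refine (h _ (hfs.indicator measurableSet_ball) (hloc n) ?_).trans ?_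
    -- On a bounded set ‖f‖^q ≤ 1 + ‖f‖^p is integrable, so every truncation of f lies in L^q.
    · rw [lintegral_enorm_indicator_rpow hq0 f measurableSet_ball]
      refine ne_top_of_le_ne_top (b := volume (Metric.ball (0 : EuclideanSpace ℝ (Fin d)) n) +
        ∫⁻ x, ‖f x‖ₑ ^ p) (ENNReal.add_ne_top.2 ⟨measure_ball_lt_top.ne, hfp⟩) ?_
      calc ∫⁻ x in Metric.ball 0 n, ‖f x‖ₑ ^ q
          ≤ ∫⁻ x in Metric.ball 0 n, (1 + ‖f x‖ₑ ^ p) := by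
            refine lintegral_mono fun x => ?_
            rcases le_total ‖f x‖ₑ 1 with h1 | h1
            · exact (ENNReal.rpow_le_one h1 hq0.le).trans le_self_add
            · exact (ENNReal.rpow_le_rpow_of_exponent_le h1 hqp.le).trans le_add_self
        _ = volume (Metric.ball (0 : EuclideanSpace ℝ (Fin d)) n) +
            ∫⁻ x in Metric.ball 0 n, ‖f x‖ₑ ^ p := by
            rw [lintegral_add_left measurable_const, setLIntegral_one]
        _ ≤ _ := by gcongr; exact Measure.restrict_le_self
    · rw [lintegral_enorm_indicator_rpow hp0 f measurableSet_ball]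
      gcongr
      exact Measure.restrict_le_self
  calc ∫⁻ x, shortVariation q f x ^ p
      ≤ ∫⁻ x, liminf (fun n : ℕ => shortVariation q ((Metric.ball 0 n).indicator f) x ^ p) atTop :=
        lintegral_mono fun x => shortVariation_rpow_le_liminf hq0 hp0 f x
    _ ≤ liminf (fun n : ℕ => ∫⁻ x, shortVariation q ((Metric.ball 0 n).indicator f) x ^ p) atTop :=
        lintegral_liminf_le fun n => (measurable_shortVariation hq0 (hloc n)).pow_const p
    _ ≤ liminf (fun _ : ℕ => C * ∫⁻ x, ‖f x‖ₑ ^ p) atTop :=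
        liminf_le_liminf (Eventually.of_forall hbound)
    _ = _ := liminf_const _

/-- The strong type `(p, p)` bound for all `1 < p < ∞`. -/
lemma exists_eLpNorm_shortVariation_le (d : ℕ) [NeZero d] {q : ℝ} (hq : 2 ≤ q)
    (hB : MartingaleCotype q B) {p : ℝ≥0∞} (hp : 1 < p) (hpt : p < ∞) :
    ∃ C : ℝ≥0, ∀ f : EuclideanSpace ℝ (Fin d) → B, MemLp f p volume →
      eLpNorm (shortVariation q f) p volume ≤ C * eLpNorm f p volume := by
  have hp1 : 1 < p.toReal := by
    rw [← ENNReal.toReal_one]; exact ENNReal.toReal_strict_mono hpt.ne hp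
  have hp0 : 0 < p.toReal := by linarith
  obtain ⟨C, hC, h⟩ : ∃ C : ℝ≥0∞, C ≠ ∞ ∧ ∀ f : EuclideanSpace ℝ (Fin d) → B,
      StronglyMeasurable f → LocallyIntegrable f volume → ∫⁻ x, ‖f x‖ₑ ^ p.toReal ≠ ∞ →
      ∫⁻ x, shortVariation q f x ^ p.toReal ≤ C * ∫⁻ x, ‖f x‖ₑ ^ p.toReal := by
    rcases lt_trichotomy p.toReal q with hlt | heq | hgt
    · exact exists_lintegral_shortVariation_rpow_le_of_lt d hq hB hp1 hlt
    · obtain ⟨C, hC, h⟩ := exists_lintegral_shortVariation_rpow_le d hq hB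
      rw [heq]
      exact ⟨C, hC, fun f hfs _ hfq => h f (memLp_ofReal_of_lintegral_rpow (by linarith)
        hfs.aestronglyMeasurable hfq)⟩
    · exact exists_lintegral_shortVariation_rpow_le_of_gt d hq hB hgt
  refine ⟨(C ^ (1 / p.toReal)).toNNReal, fun f hf => ?_⟩
  rw [ENNReal.coe_toNNReal (ENNReal.rpow_ne_top_of_nonneg (by positivity) hC)]
  -- Ball averages do not see null sets, so f may be replaced by a strongly measurable
  -- representative, whose level sets are measurable.
  have hfg := hf.1.ae_eq_mk
  set g := hf.1.mk f
  have hg : MemLp g p volume := (memLp_congr_ae hfg).1 hf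
  rw [shortVariation_congr_ae q hfg, eLpNorm_congr_ae hfg,
    eLpNorm_eq_lintegral_rpow_enorm_toReal (zero_lt_one.trans hp).ne' hpt.ne,
    eLpNorm_eq_lintegral_rpow_enorm_toReal (zero_lt_one.trans hp).ne' hpt.ne,
    ← ENNReal.mul_rpow_of_nonneg _ _ (by positivity)]
  simp only [enorm_eq_self]
  gcongr
  exact h g hf.1.stronglyMeasurable_mk (hg.locallyIntegrable hp.le)
    (lintegral_rpow_enorm_lt_top_of_eLpNorm_lt_top (zero_lt_one.trans hp).ne' hpt.ne hg.2).ne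

end LargeExponents

end

theorem mainTheorem9 (d : ℕ) (hd : 1 ≤ d) (B : Type*) [NormedAddCommGroup B] [NormedSpace ℝ B]
    [CompleteSpace B] (q₀ : ℝ) (hq₀ : 2 ≤ q₀) (hB : MartingaleCotype q₀ B) :
    -- measurability
    (∀ f : EuclideanSpace ℝ (Fin d) → B, LocallyIntegrable f volume →
      Measurable (shortVariation q₀ f)) ∧
    -- strong type `(p, p)`
    (∀ p : ℝ≥0∞, 1 < p → p < ∞ → ∃ C : ℝ≥0, ∀ f : EuclideanSpace ℝ (Fin d) → B,
      MemLp f p volume →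
        eLpNorm (shortVariation q₀ f) p volume ≤ C * eLpNorm f p volume) ∧
    -- weak type `(1, 1)`
    (∃ C : ℝ≥0, ∀ f : EuclideanSpace ℝ (Fin d) → B, MemLp f 1 volume →
      ∀ lam : ℝ, 0 < lam →
        volume {x | ENNReal.ofReal lam < shortVariation q₀ f x} ≤
          C / ENNReal.ofReal lam * eLpNorm f 1 volume) ∧
    -- `L^∞` to `BMO`
    (∃ C : ℝ≥0, ∀ f : EuclideanSpace ℝ (Fin d) → B, MemLp f ∞ volume →
      (HasCompactSupport f ∨ ¬ ∀ᵐ x ∂volume, shortVariation q₀ f x = ∞) →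
        (∀ᵐ x ∂volume, shortVariation q₀ f x < ∞) ∧
        LocallyIntegrable (fun x => (shortVariation q₀ f x).toReal) volume ∧
        bmoSeminorm (fun x => (shortVariation q₀ f x).toReal) ≤ C * eLpNorm f ∞ volume) := by
  have : NeZero d := ⟨by omega⟩
  have hq0 : 0 < q₀ := by linarith
  refine ⟨fun f hf => measurable_shortVariation hq0 hf,
    fun p hp hpt => exists_eLpNorm_shortVariation_le d hq₀ hB hp hpt, ?_, ?_⟩
  · obtain ⟨C, hC, h⟩ := exists_mul_volume_shortVariation_le d hq₀ hB
    refine ⟨C.toNNReal, fun f hf lam hlam => ?_⟩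
    have h0 : ENNReal.ofReal lam ≠ 0 := (ENNReal.ofReal_pos.2 hlam).ne'
    have h1 := h f (memLp_one_iff_integrable.1 hf) _ h0 ENNReal.ofReal_ne_top
    rw [ENNReal.coe_toNNReal hC, eLpNorm_one_eq_lintegral_enorm, ENNReal.mul_comm_div,
      ← mul_div_assoc, ENNReal.le_div_iff_mul_le (Or.inl h0) (Or.inl ENNReal.ofReal_ne_top),
      mul_comm]
    exact h1
  · obtain ⟨C, hC, h⟩ := exists_bmoSeminorm_shortVariation_le d hq₀ hB
    refine ⟨C.toNNReal, fun f hf hor => ?_⟩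
    rw [ENNReal.coe_toNNReal hC]
    exact h f hf hor
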